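/- **Setting.** A *block* is a simple graph $G$ on a set of labeled vertices with four distinct special vertices $s_1,s_2,t_1,t_2$ such that $G$ has exactly two connected components and either $s_1,t_1$ lie in one component and $s_2,t_2$ in the other, or $s_1,t_2$ lie in one component and $s_2,t_1$ in the other. In a (randomized) sketching protocol, the player at each vertex $v$ sees $v$, the set of neighbors of $v$, and a shared random string, and sends a bit string (its *sketch*) to a referee; the referee sees all sketches and the shared random string, but not $G$, and answers "$t_1$" or "$t_2$". The vertex labels, including which vertices are $s_1,s_2,t_1,t_2$, are fixed and known to everybody. On an input distribution $\mathcal D$, independent of the shared randomness, the protocol *decides whether $s_1$ is connected to $t_1$ or to $t_2$ with error at most $\varepsilon$* if, with probability at least $1-\varepsilon$ over $G\sim\mathcal D$ and the shared randomness, the referee names the one of $t_1,t_2$ that lies in the component of $s_1$. The *expected average sketch size* is the expectation, over $G\sim\mathcal D$ and the shared randomness, of the average over all vertices of the lengths in bits of the sketches. **Lemma 4.1.** There are constants $c>0$ and $N$ such that for every integer $n\ge N$ there is a probability distribution $\overline{\mathcal D_{\mathrm{blk}}}$ on blocks with $\lfloor\sqrt n\rfloor$ vertices and fixed special vertices $s_1,s_2,t_1,t_2$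 with the following property: every randomized sketching protocol that decides, on $\overline{\mathcal D_{\mathrm{blk}}}$, whether $s_1$ is connected to $t_1$ or to $t_2$ with error at most $2/\sqrt n$ has expected average sketch size at least $c\log^3 n$. -/

import Mathlib

open MeasureTheory
open scoped ENNReal

/-- `G` is a block with special vertices `s₁, s₂, t₁, t₂`: these are four distinct vertices, `G` has
exactly two connected components, and either `s₁, t₁` lie in one component and `s₂, t₂` in the
other, or `s₁, t₂` lie in one component and `s₂, t₁` in the other. -/
structure IsBlock {V : Type*} (G : SimpleGraph V) (s₁ s₂ t₁ t₂ : V) : Prop where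
  distinct : [s₁, s₂, t₁, t₂].Nodup
  two_components : Nat.card G.ConnectedComponent = 2
  separated : ¬ G.Reachable s₁ s₂
  joined : (G.Reachable s₁ t₁ ∧ G.Reachable s₂ t₂) ∨ (G.Reachable s₁ t₂ ∧ G.Reachable s₂ t₁)

/-- A (randomized) distributed sketching protocol on the labeled vertex set `V`. All players and the
referee see the shared random string `ω : Ω`. The player at `v` knows `v` and its neighborhood and
sends a bit string; the referee sees the bit strings of all the players (and not the graph) and
answers with one bit. -/
structure SketchProtocol (V : Type*) (Ω : Type*) [MeasurableSpace Ω] where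
  sketch : Ω → V → Set V → List Bool
  referee : Ω → (V → List Bool) → Bool
  measurableSet_sketch : ∀ (v : V) (A : Set V) (m : List Bool),
    MeasurableSet {ω | sketch ω v A = m}
  measurableSet_referee : ∀ m : V → List Bool, MeasurableSet {ω | referee ω m = true}

namespace SketchProtocol

variable {V : Type*} {Ω : Type*} [MeasurableSpace Ω]

/-- The sketch sent by the player at `v` when the input graph is `G`. -/
def message (P : SketchProtocol V Ω) (ω : Ω) (G : SimpleGraph V) (v : V) : List Bool :=
  P.sketch ω v (G.neighborSet v)

/-- The answer of the referee when the input graph is `G`. -/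
def output (P : SketchProtocol V Ω) (ω : Ω) (G : SimpleGraph V) : Bool :=
  P.referee ω (P.message ω G)

/-- The answer is right: `true` means that `s₁` is connected to `t₁`, and `false` means that `s₁` is
connected to `t₂`. -/
def Correct (P : SketchProtocol V Ω) (s₁ t₁ t₂ : V) (ω : Ω) (G : SimpleGraph V) : Prop :=
  (P.output ω G = true ∧ G.Reachable s₁ t₁) ∨ (P.output ω G = false ∧ G.Reachable s₁ t₂)

/-- The probability, over a graph drawn from `D` and independent shared randomness drawn from `μ`,
that the referee decides correctly whether `s₁` is connected to `t₁` or to `t₂`. -/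
noncomputable def successProb (P : SketchProtocol V Ω) (μ : Measure Ω) (D : PMF (SimpleGraph V))
    (s₁ t₁ t₂ : V) : ℝ≥0∞ :=
  ∑' G : SimpleGraph V, D G * μ {ω | P.Correct s₁ t₁ t₂ ω G}

/-- The expectation, over a graph drawn from `D` and independent shared randomness drawn from `μ`,
of the average over all the vertices of the number of bits sent. -/
noncomputable def expectedAverageSize [Fintype V] (P : SketchProtocol V Ω) (μ : Measure Ω)
    (D : PMF (SimpleGraph V)) : ℝ≥0∞ :=
  ∑' G : SimpleGraph V, D G *
    ∫⁻ ω, (∑ v : V, ((P.message ω G v).length : ℝ≥0∞)) / (Fintype.card V : ℝ≥0∞) ∂μ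

end SketchProtocol

open scoped Finset
set_option linter.unusedSectionVars false

/-! The hard blocks hide one bit. Every column has a role, a line and a side, shown by its edge to a
hub. Every line carries `N` pairs of rows, one row for each half `η`, and each pair is joined to a
random set of columns. On a line other than the distinguished line `l`, this set lies inside the
columns of the line itself. The `i`-th pair on `l` is a key: its set meets the columns of the line
`l.succAbove i` and, on the side `b i ^^ η`, the columns of `l`, so that it ties the hubs of
`l.succAbove i` to the sink chosen by the hidden bit `b i`. The sources are attached to the line
`l.succAbove k`, so the answer is `b k`. The densities are tuned so that, averaged over the roles,
the set of a key has density `q`, exactly as the set of a plain row, and a column of `l` sees what a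
column of another line sees (unless the latter is in a key set). So the players on `l` do not know
that their messages matter.

Fix the line `l`. The key index `k` affects only edges at the sources, so answering for all `k`
amounts to guessing all the `N` bits at once. The columns on `l` are a fraction of about `φ / N` of
all the columns. If messages are short, those of the columns on `l` hold together far fewer than `N`
bits, and `sum_bayesError_le` shows that they hardly help. Each bit must then be guessed from the
roles and from the messages of the two rows of its own key (`Admissible.sum_thinBayes_le`): a
message about a random set `S` of density `q` is given, each element of `S` is revealed with
probability `1 - φ`, and the roles of the others are shifted by the bit.

The main inequality `Levels.Holds` shows that no message shorter than order `log ^ 3` allows this at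
all the rates `φ₀ * r ^ j` for `j < J`, where `J` is of order `log ^ 2`. Consider the law of `S`
given the message. If it is spread, that is, if no set `G` is contained in the hidden set with
probability above `q' ^ #G`, then a second moment computation (`Channel.spread_le_bayes`) shows that
the roles look alike for both values of the bit. If it is not spread, fixing the elements of such a
`G` uses about `#G * log w` of the entropy of the message. At the later levels `G` is likely to be
revealed, and then it is useless. When errors below `exp (-t)`, with `t` of order `log w`, are
ignored, a forced element spoils only boundedly many levels, so spoiling all of them takes order `J
* log w`, that is `log ^ 3`, bits. Averaging over `j`, `l` and `k` gives an error of order `exp (-t)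
= w ^ (-1/4)` for short messages (`gridRates_trade_off`). Since `√n ≥ 16 * w`, this exceeds `2 /
√n`. -/

open Finset in
/-- Summing over ordered pairs of disjoint sets amounts to summing over a set and its subsets. -/
theorem sum_disjoint_pairs {ι : Type*} [Fintype ι] [DecidableEq ι]
    (F : Finset ι → Finset ι → ℝ) :
    ∑ X : Finset ι, ∑ Y : Finset ι, (if Disjoint X Y then F X Y else 0) =
      ∑ Z : Finset ι, ∑ X ∈ Z.powerset, F X (Z \ X) := by
  have h1 : ∀ Z : Finset ι, ∑ X ∈ Z.powerset, F X (Z \ X) =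
      ∑ X : Finset ι, if X ⊆ Z then F X (Z \ X) else 0 := by
    intro Z
    rw [← Finset.sum_filter]
    refine Finset.sum_congr ?_ fun _ _ => rfl
    ext X; simp
  simp_rw [h1]
  rw [Finset.sum_comm (s := (univ : Finset (Finset ι))) (t := (univ : Finset (Finset ι)))
    (f := fun Z X => if X ⊆ Z then F X (Z \ X) else 0)]
  refine Finset.sum_congr rfl fun X _ => ?_
  rw [← Finset.sum_filter, ← Finset.sum_filter]
  refine Finset.sum_bij' (fun Y _ => X ∪ Y) (fun Z _ => Z \ X) ?_ ?_ ?_ ?_ ?_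
  · intro Y _; simp
  · intro Z _; simpa using Finset.disjoint_sdiff
  · intro Y hY
    have hd : Disjoint X Y := by simpa using hY
    exact Finset.union_sdiff_cancel_left hd
  · intro Z hZ
    have hs : X ⊆ Z := by simpa using hZ
    exact Finset.union_sdiff_of_subset hs
  · intro Y hY
    have hd : Disjoint X Y := by simpa using hY
    rw [Finset.union_sdiff_cancel_left hd]

/-! ### Observation channels and their Bayes errors. -/

/-- The coordinatewise transition kernels of an observation channel. A coordinate is already
revealed (`rev`), a hidden member (`mem`), or a nonmember (`non`); the laws of the observed role in
the last two cases depend on a hidden bit. -/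
structure Channel (ι R : Type*) where
  rev : ι → R → ℝ
  mem : Bool → ι → R → ℝ
  non : Bool → ι → R → ℝ
  rev_nonneg : ∀ x r, 0 ≤ rev x r
  mem_nonneg : ∀ b x r, 0 ≤ mem b x r
  non_nonneg : ∀ b x r, 0 ≤ non b x r

namespace Channel

variable {ι R : Type*} [Fintype ι] [DecidableEq ι] [Fintype R]

/-- The kernel at one coordinate. -/
def coord (K : Channel ι R) (T W : Finset ι) (b : Bool) (x : ι) (r : R) : ℝ :=
  if x ∈ T then K.rev x r else if x ∈ W then K.mem b x r else K.non b x r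

/-- The kernel of the whole channel. -/
def ker (K : Channel ι R) (T W : Finset ι) (b : Bool) (c : ι → R) : ℝ :=
  ∏ x, K.coord T W b x (c x)

theorem coord_nonneg (K : Channel ι R) (T W : Finset ι) (b : Bool) (x : ι) (r : R) :
    0 ≤ K.coord T W b x r := by
  unfold coord
  split_ifs
  exacts [K.rev_nonneg _ _, K.mem_nonneg _ _ _, K.non_nonneg _ _ _]

theorem ker_nonneg (K : Channel ι R) (T W : Finset ι) (b : Bool) (c : ι → R) :
    0 ≤ K.ker T W b c := Finset.prod_nonneg fun _ _ => K.coord_nonneg _ _ _ _ _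

/-- The law of the observation under the weights `g` on the hidden set. -/
noncomputable def law (K : Channel ι R) (T : Finset ι) (g : Finset ι → ℝ) (b : Bool) (c : ι → R) :
    ℝ := ∑ W, g W * K.ker T W b c

/-- The Bayes error of guessing the hidden uniform bit from the observation. -/
noncomputable def bayes (K : Channel ι R) (T : Finset ι) (g : Finset ι → ℝ) : ℝ :=
  ∑ c : ι → R, min (1 / 2 * K.law T g true c) (1 / 2 * K.law T g false c)

theorem law_nonneg (K : Channel ι R) (T : Finset ι) {g : Finset ι → ℝ} (hg : ∀ W, 0 ≤ g W)
    (b : Bool) (c : ι → R) : 0 ≤ K.law T g b c :=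
  Finset.sum_nonneg fun _ _ => mul_nonneg (hg _) (K.ker_nonneg _ _ _ _)

theorem bayes_nonneg (K : Channel ι R) (T : Finset ι) {g : Finset ι → ℝ} (hg : ∀ W, 0 ≤ g W) :
    0 ≤ K.bayes T g :=
  Finset.sum_nonneg fun _ _ => le_min
    (mul_nonneg (by norm_num) (K.law_nonneg _ hg _ _)) (mul_nonneg (by norm_num) (K.law_nonneg _ hg _ _))

theorem bayes_zero (K : Channel ι R) (T : Finset ι) : K.bayes T (fun _ => 0) = 0 := by
  simp [bayes, law]

/-- The minimum is superadditive: merging two families of weights forgets which of them was drawn,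
and this can only raise the Bayes error. -/
theorem bayes_add_le (K : Channel ι R) (T : Finset ι) (g g' : Finset ι → ℝ) :
    K.bayes T g + K.bayes T g' ≤ K.bayes T (fun W => g W + g' W) := by
  unfold bayes
  rw [← Finset.sum_add_distrib]
  refine Finset.sum_le_sum fun c _ => ?_
  have h : ∀ b, K.law T (fun W => g W + g' W) b c = K.law T g b c + K.law T g' b c := by
    intro b; simp [law, add_mul, Finset.sum_add_distrib]
  rw [h, h, mul_add, mul_add]
  exact min_add_min_le_min_add_add

theorem bayes_sum_le (K : Channel ι R) (T : Finset ι) {α : Type*} (s : Finset α)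
    (g : α → Finset ι → ℝ) :
    ∑ i ∈ s, K.bayes T (g i) ≤ K.bayes T (fun W => ∑ i ∈ s, g i W) := by
  classical
  induction s using Finset.induction_on with
  | empty => simp [bayes_zero]
  | insert i s hi ih =>
    simp only [Finset.sum_insert hi]
    exact (add_le_add_right ih _).trans (K.bayes_add_le T _ _)

theorem bayes_smul (K : Channel ι R) (T : Finset ι) (g : Finset ι → ℝ) {k : ℝ} (hk : 0 ≤ k) :
    K.bayes T (fun W => k * g W) = k * K.bayes T g := by
  unfold bayes
  rw [Finset.mul_sum]
  refine Finset.sum_congr rfl fun c _ => ?_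
  have h : ∀ b, K.law T (fun W => k * g W) b c = k * K.law T g b c := by
    intro b; simp [law, mul_assoc, Finset.mul_sum]
  rw [h, h, mul_min_of_nonneg _ _ hk]
  congr 1 <;> ring

end Channel

/-! ### Thinning of the hidden set. -/

section Thinning

variable {ι R : Type*} [Fintype ι] [DecidableEq ι] [Fintype R]

/-- Thinning: every element of the hidden set survives with probability `al`; this is the part of
the weights `g` for which exactly the elements of `X` are removed. -/
def thin (al : ℝ) (g : Finset ι → ℝ) (X W : Finset ι) : ℝ :=
  if Disjoint X W then g (W ∪ X) * (1 - al) ^ #X * al ^ #W else 0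

/-- The weights of the rest of the hidden set once the elements of `G` are removed. -/
def strip (g : Finset ι → ℝ) (G W : Finset ι) : ℝ := if Disjoint G W then g (W ∪ G) else 0

theorem thin_nonneg {al : ℝ} (h0 : 0 ≤ al) (h1 : al ≤ 1) {g : Finset ι → ℝ} (hg : ∀ W, 0 ≤ g W)
    (X W : Finset ι) : 0 ≤ thin al g X W := by
  unfold thin
  split_ifs
  · have := hg (W ∪ X); have : 0 ≤ 1 - al := by linarith
    positivity
  · exact le_rfl

theorem strip_nonneg {g : Finset ι → ℝ} (hg : ∀ W, 0 ≤ g W) (G W : Finset ι) :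
    0 ≤ strip g G W := by
  unfold strip; split_ifs; exacts [hg _, le_rfl]

theorem thin_disjoint {al : ℝ} {g : Finset ι → ℝ} {T : Finset ι}
    (hg : ∀ W, g W ≠ 0 → Disjoint T W) (X W : Finset ι) (h : thin al g X W ≠ 0) :
    Disjoint (T ∪ X) W := by
  unfold thin at h
  split_ifs at h with hd
  · have : g (W ∪ X) ≠ 0 := by intro h'; simp [h'] at h
    have := hg _ this
    rw [Finset.disjoint_union_right] at this
    exact Finset.disjoint_union_left.2 ⟨this.1, hd⟩
  · exact absurd rfl h

theorem strip_disjoint {g : Finset ι → ℝ} {T : Finset ι}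
    (hg : ∀ W, g W ≠ 0 → Disjoint T W) (G W : Finset ι) (h : strip g G W ≠ 0) :
    Disjoint (T ∪ G) W := by
  unfold strip at h
  split_ifs at h with hd
  · have := hg _ h
    rw [Finset.disjoint_union_right] at this
    exact Finset.disjoint_union_left.2 ⟨this.1, hd⟩
  · exact absurd rfl h

theorem sum_powerset_pow (Z : Finset ι) (a b : ℝ) :
    ∑ X ∈ Z.powerset, a ^ #X * b ^ #(Z \ X) = (a + b) ^ #Z := by
  rw [← Finset.sum_pow_mul_eq_add_pow a b Z]
  refine Finset.sum_congr rfl fun X hX => ?_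
  rw [Finset.card_sdiff_of_subset (Finset.mem_powerset.1 hX)]

theorem sum_thin_mul (al : ℝ) (g φ : Finset ι → ℝ) :
    ∑ X, ∑ W, thin al g X W * φ W =
      ∑ Z, g Z * ∑ X ∈ Z.powerset, (1 - al) ^ #X * al ^ #(Z \ X) * φ (Z \ X) := by
  have h := sum_disjoint_pairs (ι := ι)
    (fun X W => g (W ∪ X) * (1 - al) ^ #X * al ^ #W * φ W)
  simp only [thin, ite_mul, zero_mul]
  rw [h]
  refine Finset.sum_congr rfl fun Z _ => ?_
  rw [Finset.mul_sum]
  refine Finset.sum_congr rfl fun X hX => ?_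
  rw [Finset.sdiff_union_of_subset (Finset.mem_powerset.1 hX)]
  ring

theorem sum_thin (al : ℝ) (g : Finset ι → ℝ) : ∑ X, ∑ W, thin al g X W = ∑ Z, g Z := by
  have h := sum_thin_mul al g (fun _ => 1)
  simp only [mul_one] at h
  rw [h]
  refine Finset.sum_congr rfl fun Z _ => ?_
  rw [sum_powerset_pow]; simp

theorem sum_thin_mul_le {al : ℝ} (h0 : 0 ≤ al) (h1 : al ≤ 1) {g φ : Finset ι → ℝ}
    (hg : ∀ W, 0 ≤ g W) (hφ : Monotone φ) :
    ∑ X, ∑ W, thin al g X W * φ W ≤ ∑ Z, g Z * φ Z := by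
  rw [sum_thin_mul]
  refine Finset.sum_le_sum fun Z _ => mul_le_mul_of_nonneg_left ?_ (hg Z)
  have h2 : 0 ≤ 1 - al := by linarith
  calc _ ≤ ∑ X ∈ Z.powerset, (1 - al) ^ #X * al ^ #(Z \ X) * φ Z :=
        Finset.sum_le_sum fun X _ => mul_le_mul_of_nonneg_left (hφ Finset.sdiff_subset)
          (by positivity)
    _ = φ Z := by rw [← Finset.sum_mul, sum_powerset_pow]; simp

namespace Channel

/-- The Bayes error after thinning. -/
noncomputable def thinBayes (K : Channel ι R) (al : ℝ) (T : Finset ι) (g : Finset ι → ℝ) : ℝ :=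
  ∑ X, K.bayes (T ∪ X) (thin al g X)

theorem thinBayes_add_le (K : Channel ι R) (al : ℝ) (T : Finset ι) (g g' : Finset ι → ℝ) :
    K.thinBayes al T g + K.thinBayes al T g' ≤ K.thinBayes al T (fun W => g W + g' W) := by
  unfold thinBayes
  rw [← Finset.sum_add_distrib]
  refine Finset.sum_le_sum fun X _ => (K.bayes_add_le _ _ _).trans (le_of_eq ?_)
  congr 1
  ext W
  unfold thin
  split_ifs <;> ring

theorem thinBayes_one (K : Channel ι R) (T : Finset ι) {g : Finset ι → ℝ} :
    K.thinBayes 1 T g = K.bayes T g := by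
  unfold thinBayes
  rw [Finset.sum_eq_single ∅]
  · have : thin 1 g ∅ = g := by
      ext W; simp [thin]
    rw [this, Finset.union_empty]
  · intro X _ hX
    have : thin 1 g X = fun _ => 0 := by
      ext W
      have : #X ≠ 0 := by simpa using hX
      simp [thin, this]
    rw [this, bayes_zero]
  · simp

/-- Thinning in two steps gives more information than thinning in one step. -/
theorem sum_thinBayes_thin_le (K : Channel ι R) (al be : ℝ) (T : Finset ι) (g : Finset ι → ℝ) :
    ∑ X, K.thinBayes al (T ∪ X) (thin be g X) ≤ K.thinBayes (be * al) T g := by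
  have h1 : ∑ X, K.thinBayes al (T ∪ X) (thin be g X) =
      ∑ X, ∑ Y, (if Disjoint X Y then
        K.bayes (T ∪ (X ∪ Y)) (thin al (thin be g X) Y) else 0) := by
    unfold thinBayes
    refine Finset.sum_congr rfl fun X _ => Finset.sum_congr rfl fun Y _ => ?_
    split_ifs with hd
    · rw [Finset.union_assoc]
    · have : thin al (thin be g X) Y = fun _ => 0 := by
        ext W
        unfold thin
        have : ¬ Disjoint X (W ∪ Y) := fun h => hd (Finset.disjoint_union_right.1 h).2
        simp [this]
      rw [this, bayes_zero]
  -- Overlapping `X` and `Y` contribute nothing, so the sum runs over the union `Z` of the two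
  -- removed sets. Adding up the splittings of `Z` forgets in which step an element was removed.
  rw [h1, sum_disjoint_pairs (fun X Y => K.bayes (T ∪ (X ∪ Y)) (thin al (thin be g X) Y))]
  unfold thinBayes
  refine Finset.sum_le_sum fun Z _ => ?_
  calc _ = ∑ X ∈ Z.powerset, K.bayes (T ∪ Z) (thin al (thin be g X) (Z \ X)) := by
        refine Finset.sum_congr rfl fun X hX => ?_
        rw [Finset.union_sdiff_of_subset (Finset.mem_powerset.1 hX)]
    _ ≤ K.bayes (T ∪ Z) (fun W => ∑ X ∈ Z.powerset, thin al (thin be g X) (Z \ X) W) :=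
        K.bayes_sum_le _ _ _
    _ = _ := by
        congr 1
        ext W
        by_cases hd : Disjoint Z W
        -- An element of `Z` is removed at once, with factor `1 - be`, or survives and is removed
        -- later, with factor `be * (1 - al)`. The factors add up to `1 - be * al`.
        · have h2 : ∀ X ∈ Z.powerset, thin al (thin be g X) (Z \ X) W =
              g (W ∪ Z) * (be * al) ^ #W * ((1 - be) ^ #X * (be * (1 - al)) ^ #(Z \ X)) := by
            intro X hX
            have hX := Finset.mem_powerset.1 hX
            have hd1 : Disjoint (Z \ X) W := hd.mono_left Finset.sdiff_subset
            have hd2 : Disjoint X (W ∪ Z \ X) :=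
              Finset.disjoint_union_right.2 ⟨hd.mono_left hX, Finset.disjoint_sdiff⟩
            have e : W ∪ Z \ X ∪ X = W ∪ Z := by
              rw [Finset.union_assoc, Finset.sdiff_union_of_subset hX]
            have e2 : #(W ∪ Z \ X) = #W + #(Z \ X) := Finset.card_union_of_disjoint hd1.symm
            simp only [thin, hd1, hd2, if_true, e, e2]
            rw [mul_pow, mul_pow, pow_add]; ring
          rw [Finset.sum_congr rfl h2, ← Finset.mul_sum, sum_powerset_pow]
          simp only [thin, hd, if_true]
          ring
        · have h2 : ∀ X ∈ Z.powerset, thin al (thin be g X) (Z \ X) W = 0 := by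
            intro X hX
            have hX := Finset.mem_powerset.1 hX
            unfold thin
            split_ifs with h3 h4
            · exfalso
              apply hd
              rw [← Finset.union_sdiff_of_subset hX]
              exact Finset.disjoint_union_left.2 ⟨(Finset.disjoint_union_right.1 h4).1, h3⟩
            · simp
            · rfl
          rw [Finset.sum_eq_zero h2]
          simp [thin, hd]

/-- If all the hidden sets contain `G`, then with probability at least `(1 - al) ^ #G` all of `G`
is removed by the thinning. -/
theorem thinBayes_strip_le (K : Channel ι R) {al : ℝ} (h0 : 0 ≤ al) (h1 : al ≤ 1) (T G : Finset ι)
    {g : Finset ι → ℝ} (hg : ∀ W, 0 ≤ g W) :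
    (1 - al) ^ #G * K.thinBayes al (T ∪ G) (strip g G) ≤ K.thinBayes al T g := by
  unfold thinBayes
  have hz : ∀ X, ¬ Disjoint G X → K.bayes (T ∪ G ∪ X) (thin al (strip g G) X) = 0 := by
    intro X hX
    have : thin al (strip g G) X = fun _ => 0 := by
      ext W
      unfold thin strip
      have : ¬ Disjoint G (W ∪ X) := fun h => hX (Finset.disjoint_union_right.1 h).2
      simp [this]
    rw [this, bayes_zero]
  -- On the right only the removed sets that contain `G` are kept; `X ↦ G ∪ X` matches them with the
  -- sets removed after stripping.
  rw [← Finset.sum_filter_of_ne (p := fun X => Disjoint G X) (fun X _ h => by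
    by_contra hX; exact h (hz X hX)), Finset.mul_sum]
  have hinj : Set.InjOn (fun X => G ∪ X)
      ((Finset.univ.filter fun X : Finset ι => Disjoint G X : Finset (Finset ι)) :
        Set (Finset ι)) := by
    intro X hX Y hY h
    have hX : Disjoint G X := by simpa using hX
    have hY : Disjoint G Y := by simpa using hY
    simp only at h
    rw [← Finset.union_sdiff_cancel_left hX, h, Finset.union_sdiff_cancel_left hY]
  calc _ ≤ ∑ X ∈ Finset.univ.filter (fun X : Finset ι => Disjoint G X),
        K.bayes (T ∪ (G ∪ X)) (thin al g (G ∪ X)) := by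
        refine Finset.sum_le_sum fun X hX => ?_
        have hX : Disjoint G X := by simpa using hX
        have h2 : 0 ≤ 1 - al := by linarith
        rw [← K.bayes_smul _ _ (by positivity), Finset.union_assoc]
        apply le_of_eq
        congr 1
        ext W
        unfold thin strip
        by_cases h3 : Disjoint X W <;> by_cases h4 : Disjoint G W
        · have h5 : Disjoint G (W ∪ X) := Finset.disjoint_union_right.2 ⟨h4, hX⟩
          have h6 : Disjoint (G ∪ X) W := Finset.disjoint_union_left.2 ⟨h4, h3⟩
          have e : W ∪ X ∪ G = W ∪ (G ∪ X) := by
            rw [Finset.union_assoc, Finset.union_comm X G]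
          simp only [h3, h5, h6, if_true, e, Finset.card_union_of_disjoint hX, pow_add]
          ring
        · have h5 : ¬ Disjoint G (W ∪ X) := fun h => h4 (Finset.disjoint_union_right.1 h).1
          have h6 : ¬ Disjoint (G ∪ X) W := fun h => h4 (Finset.disjoint_union_left.1 h).1
          simp [h5, h6]
        · have h6 : ¬ Disjoint (G ∪ X) W := fun h => h3 (Finset.disjoint_union_left.1 h).2
          simp [h3, h6]
        · have h6 : ¬ Disjoint (G ∪ X) W := fun h => h3 (Finset.disjoint_union_left.1 h).2
          simp [h3, h6]
    _ = ∑ Z ∈ (Finset.univ.filter (fun X : Finset ι => Disjoint G X)).image (fun X => G ∪ X),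
        K.bayes (T ∪ Z) (thin al g Z) := by rw [Finset.sum_image hinj]
    _ ≤ _ := Finset.sum_le_sum_of_subset_of_nonneg (Finset.subset_univ _)
        fun _ _ _ => K.bayes_nonneg _ (thin_nonneg h0 h1 hg _)

end Channel

end Thinning

/-! ### Inequalities for entropies and logarithmic series. -/

/-- The log-sum inequality, from `log x ≤ x - 1`. It lets the entropy term of `Levels.target` be
recombined after the weights have been decomposed by the removed set. -/
theorem sum_mul_log_le {α : Type*} (s : Finset α) {y p : α → ℝ} {κ : ℝ}
    (hy : ∀ i ∈ s, 0 ≤ y i) (hp : ∀ i ∈ s, 0 ≤ p i) (hps : ∑ i ∈ s, p i ≤ 1) (hκ : 0 ≤ κ)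
    (hyp : ∀ i ∈ s, y i ≤ κ * p i) :
    ∑ i ∈ s, y i * Real.log (κ * p i / y i) ≤
      (∑ i ∈ s, y i) * Real.log (κ / ∑ i ∈ s, y i) := by
  set Y := ∑ i ∈ s, y i with hY
  have hY0 : 0 ≤ Y := Finset.sum_nonneg hy
  rcases hY0.eq_or_lt with h0 | hYpos
  · have hz : ∀ i ∈ s, y i = 0 := (Finset.sum_eq_zero_iff_of_nonneg hy).1 h0.symm
    rw [← h0, zero_mul]
    exact (Finset.sum_eq_zero fun i hi => by rw [hz i hi, zero_mul]).le
  have hκpos : 0 < κ := by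
    rcases hκ.eq_or_lt with h | h
    · exfalso
      have : Y ≤ 0 := Finset.sum_nonpos fun i hi => by
        have := hyp i hi; rwa [← h, zero_mul] at this
      linarith
    · exact h
  have key : ∀ i ∈ s, y i * Real.log (κ * p i / y i) ≤
      y i * Real.log (κ / Y) + (p i * Y - y i) := by
    intro i hi
    rcases (hy i hi).eq_or_lt with h | h
    · rw [← h]; simp only [zero_mul, zero_add, sub_zero]
      exact mul_nonneg (hp i hi) hY0
    · have hppos : 0 < p i := by
        by_contra hc
        have : p i = 0 := le_antisymm (not_lt.1 hc) (hp i hi)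
        have := hyp i hi
        simp_all
        linarith
      have e : κ * p i / y i = κ / Y * (p i * Y / y i) := by field_simp
      rw [e, Real.log_mul (by positivity) (by positivity), mul_add]
      have h1 : Real.log (p i * Y / y i) ≤ p i * Y / y i - 1 :=
        Real.log_le_sub_one_of_pos (by positivity)
      have h2 := mul_le_mul_of_nonneg_left h1 h.le
      have h3 : y i * (p i * Y / y i - 1) = p i * Y - y i := by field_simp
      linarith
  calc _ ≤ ∑ i ∈ s, (y i * Real.log (κ / Y) + (p i * Y - y i)) := Finset.sum_le_sum key
    _ = Y * Real.log (κ / Y) + ((∑ i ∈ s, p i) * Y - Y) := by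
        rw [Finset.sum_add_distrib, Finset.sum_sub_distrib, ← Finset.sum_mul, ← Finset.sum_mul]
    _ ≤ _ := by nlinarith

/-- Splitting off a part of relative mass at least `q ^ k` costs at most `k * y₁ * log (1 / q)` of
entropy for this part and at most `y₁` for the rest. The factor `o ^ k` in the density bound of the
first part more than makes up for it when `q` is much larger than `o`. -/
theorem mul_log_split_le {y₁ y₂ κ o q : ℝ} {k : ℕ} (hy₁ : 0 < y₁) (hy₂ : 0 ≤ y₂) (hκ : 0 < κ)
    (ho : 0 < o) (hq : 0 < q) (h : q ^ k * (y₁ + y₂) ≤ y₁) :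
    y₁ * Real.log (κ * o ^ k / y₁) + y₂ * Real.log (κ / y₂) ≤
      (y₁ + y₂) * Real.log (κ / (y₁ + y₂)) - y₁ * (k * Real.log (q / o) - 1) := by
  have hY : 0 < y₁ + y₂ := by linarith
  have h1 : Real.log (κ * o ^ k / y₁) ≤ Real.log (κ / (y₁ + y₂)) - k * Real.log (q / o) := by
    have e : Real.log (κ / (y₁ + y₂)) - k * Real.log (q / o) =
        Real.log (κ * o ^ k / (q ^ k * (y₁ + y₂))) := by
      rw [← Real.log_pow, ← Real.log_div (by positivity) (by positivity)]
      congr 1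
      rw [div_pow]
      field_simp
    rw [e]
    exact Real.log_le_log (by positivity) (div_le_div_of_nonneg_left (by positivity)
      (by positivity) h)
  have h2 : y₂ * Real.log (κ / y₂) ≤ y₂ * Real.log (κ / (y₁ + y₂)) + y₁ := by
    rcases hy₂.eq_or_lt with h0 | h0
    · rw [← h0]; simp only [zero_mul, zero_add]; exact hy₁.le
    · have e : κ / y₂ = κ / (y₁ + y₂) * ((y₁ + y₂) / y₂) := by field_simp
      rw [e, Real.log_mul (by positivity) (by positivity), mul_add]
      have h3 := Real.log_le_sub_one_of_pos (x := (y₁ + y₂) / y₂) (by positivity)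
      have h4 := mul_le_mul_of_nonneg_left h3 h0.le
      have h5 : y₂ * ((y₁ + y₂) / y₂ - 1) = y₁ := by field_simp; ring
      linarith
  have h3 := mul_le_mul_of_nonneg_left h1 hy₁.le
  linarith [mul_comm y₁ (Real.log (κ / (y₁ + y₂)))]

/-- Expand the logarithms into power series and sum over `d` first: the geometric series with ratio
`r ^ (k + 1)` is at most `1 / ((k + 1) * (1 - r))`. This bounds the total discount charged for one
forced element. -/
theorem sum_neg_log_one_sub_pow_le {r : ℝ} (hr0 : 0 < r) (hr1 : r < 1) (D : ℕ) :
    ∑ d ∈ Finset.range D, -Real.log (1 - r ^ (d + 1)) ≤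
      (∑' k : ℕ, 1 / ((k : ℝ) + 1) ^ 2) * (1 - r)⁻¹ := by
  have hlt : ∀ d : ℕ, |r ^ (d + 1)| < 1 := by
    intro d
    rw [abs_of_pos (by positivity)]
    exact pow_lt_one₀ hr0.le hr1 (by omega)
  have hs : ∀ d ∈ Finset.range D,
      HasSum (fun n : ℕ => (r ^ (d + 1)) ^ (n + 1) / ((n : ℝ) + 1)) (-Real.log (1 - r ^ (d + 1))) :=
    fun d _ => Real.hasSum_pow_div_log_of_abs_lt_one (hlt d)
  have hsum := hasSum_sum hs
  have hS : Summable fun k : ℕ => 1 / ((k : ℝ) + 1) ^ 2 := by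
    have := (summable_nat_add_iff 1).2 (Real.summable_one_div_nat_pow.2 (by norm_num : 1 < 2))
    simpa using this
  rw [← hsum.tsum_eq, ← tsum_mul_right]
  refine hsum.summable.tsum_le_tsum (fun k => ?_) (hS.mul_right _)
  have h1r : 0 < 1 - r := by linarith
  have hk : (0 : ℝ) < (k : ℝ) + 1 := by positivity
  have hgeom : ∑ d ∈ Finset.range D, (r ^ (d + 1)) ^ (k + 1) ≤ 1 / (((k : ℝ) + 1) * (1 - r)) := by
    set y := r ^ (k + 1) with hy
    have hy0 : 0 < y := by positivity
    have hy1 : y < 1 := pow_lt_one₀ hr0.le hr1 (by omega)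
    have e : ∀ d : ℕ, (r ^ (d + 1)) ^ (k + 1) = y * y ^ d := by
      intro d; rw [hy, ← pow_mul, ← pow_mul, ← pow_add]; congr 1; ring
    simp_rw [e]
    rw [← Finset.mul_sum]
    have h2 : ∑ d ∈ Finset.range D, y ^ d ≤ 1 / (1 - y) := by
      have hm := mul_neg_geom_sum y D
      rw [le_div_iff₀ (by linarith)]
      nlinarith [pow_pos hy0 D]
    have h3 : y * ((k : ℝ) + 1) * (1 - r) ≤ 1 - y := by
      have hm := mul_neg_geom_sum r (k + 1)
      rw [← hy] at hm
      rw [← hm]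
      have : ((k : ℝ) + 1) * y ≤ ∑ i ∈ Finset.range (k + 1), r ^ i := by
        calc ((k : ℝ) + 1) * y = ∑ i ∈ Finset.range (k + 1), y := by simp
          _ ≤ _ := Finset.sum_le_sum fun i hi => by
            rw [hy]
            exact pow_le_pow_of_le_one hr0.le hr1.le (by
              have := Finset.mem_range.1 hi; omega)
      nlinarith
    calc y * ∑ d ∈ Finset.range D, y ^ d ≤ y * (1 / (1 - y)) :=
          mul_le_mul_of_nonneg_left h2 hy0.le
      _ ≤ _ := by
          rw [mul_one_div, div_le_div_iff₀ (by linarith) (by positivity)]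
          linarith
  rw [← Finset.sum_div]
  calc _ ≤ 1 / (((k : ℝ) + 1) * (1 - r)) / ((k : ℝ) + 1) :=
        div_le_div_of_nonneg_right hgeom hk.le
    _ = _ := by field_simp

/-! ### The main inequality, by induction over the levels. -/

section Levels

variable {ι R : Type*} [Fintype ι] [DecidableEq ι] [Fintype R]

/-- The law of a random set with odds `o`, off the set `T`. -/
noncomputable def oddsLaw (o : ℝ) (T W : Finset ι) : ℝ :=
  if Disjoint T W then o ^ #W / (1 + o) ^ #Tᶜ else 0

theorem sum_disjoint_pow (T : Finset ι) (a b : ℝ) :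
    ∑ W : Finset ι, (if Disjoint T W then a ^ #W * b ^ (#Tᶜ - #W) else 0) = (a + b) ^ #Tᶜ := by
  rw [← Finset.sum_pow_mul_eq_add_pow a b Tᶜ, ← Finset.sum_filter]
  refine Finset.sum_congr ?_ fun _ _ => rfl
  ext W
  simp only [Finset.mem_filter, Finset.mem_univ, true_and, Finset.mem_powerset]
  rw [disjoint_comm]
  exact Finset.subset_compl_iff_disjoint_right.symm

theorem oddsLaw_nonneg {o : ℝ} (ho : 0 ≤ o) (T W : Finset ι) : 0 ≤ oddsLaw o T W := by
  unfold oddsLaw; split_ifs <;> positivity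

theorem sum_oddsLaw {o : ℝ} (ho : 0 ≤ o) (T : Finset ι) : ∑ W, oddsLaw o T W = 1 := by
  have h := sum_disjoint_pow T o 1
  simp only [one_pow, mul_one] at h
  have h1 : 1 + o ≠ 0 := by positivity
  have : ∀ W, oddsLaw o T W = (if Disjoint T W then o ^ #W else 0) / (1 + o) ^ #Tᶜ := by
    intro W; unfold oddsLaw; split_ifs <;> simp
  simp_rw [this]
  rw [← Finset.sum_div, h, add_comm o 1, div_self (by positivity)]

/-- The elements of `G` contribute `o ^ #G` to the density; their factors `1 + o` in the denominator
are dropped. -/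
theorem oddsLaw_strip_le {o κ : ℝ} (ho : 0 ≤ o) (hκ : 0 ≤ κ) {T G : Finset ι} {g : Finset ι → ℝ}
    (hg : ∀ W, g W ≤ κ * oddsLaw o T W) (W : Finset ι) :
    strip g G W ≤ κ * o ^ #G * oddsLaw o (T ∪ G) W := by
  unfold strip
  split_ifs with h
  · refine (hg _).trans ?_
    unfold oddsLaw
    by_cases h2 : Disjoint T (W ∪ G)
    · have h3 : Disjoint (T ∪ G) W :=
        Finset.disjoint_union_left.2 ⟨(Finset.disjoint_union_right.1 h2).1, h⟩
      simp only [h2, h3, if_true, Finset.card_union_of_disjoint h.symm, pow_add]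
      have hc : #(T ∪ G)ᶜ ≤ #Tᶜ := Finset.card_le_card (by
        rw [Finset.compl_subset_compl]; exact Finset.subset_union_left)
      have h4 : (1 + o) ^ #(T ∪ G)ᶜ ≤ (1 + o) ^ #Tᶜ := pow_le_pow_right₀ (by linarith) hc
      have h5 : o ^ #W * o ^ #G / (1 + o) ^ #Tᶜ ≤ o ^ #W * o ^ #G / (1 + o) ^ #(T ∪ G)ᶜ :=
        div_le_div_of_nonneg_left (by positivity) (by positivity) h4
      calc κ * (o ^ #W * o ^ #G / (1 + o) ^ #Tᶜ)
          ≤ κ * (o ^ #W * o ^ #G / (1 + o) ^ #(T ∪ G)ᶜ) := mul_le_mul_of_nonneg_left h5 hκ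
        _ = _ := by ring
    · simp only [h2, if_false, mul_zero]
      split_ifs <;> positivity
  · have := oddsLaw_nonneg ho (T ∪ G) W
    positivity

/-- The probability that thinning a random set with odds `o` removes exactly `X`. -/
noncomputable def removedLaw (o be : ℝ) (T X : Finset ι) : ℝ :=
  if Disjoint T X then (o * (1 - be)) ^ #X * (1 + o * be) ^ (#Tᶜ - #X) / (1 + o) ^ #Tᶜ else 0

theorem removedLaw_nonneg {o be : ℝ} (ho : 0 ≤ o) (h0 : 0 ≤ be) (h1 : be ≤ 1) (T X : Finset ι) :
    0 ≤ removedLaw o be T X := by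
  have : 0 ≤ 1 - be := by linarith
  unfold removedLaw; split_ifs <;> positivity

theorem sum_removedLaw {o be : ℝ} (ho : 0 ≤ o) (T : Finset ι) :
    ∑ X, removedLaw o be T X = 1 := by
  have h := sum_disjoint_pow T (o * (1 - be)) (1 + o * be)
  have h1 : 1 + o ≠ 0 := by positivity
  have : ∀ X, removedLaw o be T X = (if Disjoint T X then
      (o * (1 - be)) ^ #X * (1 + o * be) ^ (#Tᶜ - #X) else 0) / (1 + o) ^ #Tᶜ := by
    intro W; unfold removedLaw; split_ifs <;> simp
  simp_rw [this]
  rw [← Finset.sum_div, h]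
  rw [show o * (1 - be) + (1 + o * be) = 1 + o by ring, div_self (by positivity)]

/-- Given that exactly `X` is removed, an element off `T ∪ X` is present and kept, with weight `o *
be`, or absent, with weight `1`. So the survivors form a random set with odds `o * be`. -/
theorem oddsLaw_thin_le {o κ be : ℝ} (ho : 0 ≤ o) (hκ : 0 ≤ κ) (h0 : 0 ≤ be) (h1 : be ≤ 1)
    {T : Finset ι} {g : Finset ι → ℝ} (hg : ∀ W, g W ≤ κ * oddsLaw o T W) (X W : Finset ι) :
    thin be g X W ≤ κ * removedLaw o be T X * oddsLaw (o * be) (T ∪ X) W := by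
  have hb : 0 ≤ 1 - be := by linarith
  unfold thin
  split_ifs with h
  · have h2 : g (W ∪ X) * (1 - be) ^ #X * be ^ #W ≤
        κ * oddsLaw o T (W ∪ X) * (1 - be) ^ #X * be ^ #W := by
      gcongr; exact hg _
    refine h2.trans ?_
    unfold oddsLaw removedLaw
    by_cases h2 : Disjoint T (W ∪ X)
    · obtain ⟨h4, h5⟩ := Finset.disjoint_union_right.1 h2
      have h3 : Disjoint (T ∪ X) W := Finset.disjoint_union_left.2 ⟨h4, h⟩
      have hc : #(T ∪ X)ᶜ = #Tᶜ - #X := by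
        rw [Finset.card_compl, Finset.card_compl, Finset.card_union_of_disjoint h5]
        omega
      simp only [h2, h3, h5, if_true, Finset.card_union_of_disjoint h.symm, pow_add, hc]
      have : 1 + o ≠ 0 := by positivity
      have : 1 + o * be ≠ 0 := by positivity
      apply le_of_eq
      rw [mul_pow, mul_pow]
      field_simp
    · simp only [h2, if_false, mul_zero, zero_mul]
      split_ifs <;> positivity
  · have := oddsLaw_nonneg (mul_nonneg ho h0) (T ∪ X) W
    have := removedLaw_nonneg ho h0 h1 T X
    positivity

/-- A sequence of channels, one for each level, for which the Bayes error is large for spread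
weights. -/
structure Levels (ι R : Type*) [Fintype ι] [DecidableEq ι] [Fintype R] where
  K : ℕ → Channel ι R
  J : ℕ
  r : ℝ
  t : ℝ
  a : ℝ
  o : ℝ
  q : ℝ
  C : ℝ
  ρ : Finset ι → ℝ
  r_pos : 0 < r
  r_lt : r < 1
  t_pos : 0 < t
  a_nonneg : 0 ≤ a
  o_pos : 0 < o
  q_pos : 0 < q
  C_nonneg : 0 ≤ C
  -- The left side is the charge for an element forced at one level, over all the later levels; `C`
  -- measures it in units of `t`.
  sum_log : ∀ D : ℕ, ∑ d ∈ Finset.range D, -Real.log (1 - r ^ (d + 1)) ≤ C * t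
  one_le_log : 1 ≤ Real.log (q / o)
  -- Forcing `k` elements lowers the entropy term by `a * (k * log (q / o) - 1)`. This has to pay `1
  -- / 4` for the skipped level and `k * C / 4` for the discount.
  gain : (1 + C) / 4 ≤ a * (Real.log (q / o) - 1)
  ρ_nonneg : ∀ W, 0 ≤ ρ W
  ρ_mono : Monotone ρ
  spread : ∀ i < J, ∀ (T : Finset ι) (g : Finset ι → ℝ), (∀ W, 0 ≤ g W) →
    (∀ W, g W ≠ 0 → Disjoint T W) →
    (∀ G : Finset ι, G.Nonempty → ∑ W, (if G ⊆ W then g W else 0) ≤ q ^ #G * ∑ W, g W) →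
    (∑ W, g W) / 4 - ∑ W, g W * ρ W ≤ (K i).bayes T g

namespace Levels

variable (S : Levels ι R)

/-- The right-hand side of the main inequality, for weights of total mass `y` that are dominated by
`κ` times a probability measure and have weighted error `e`. -/
noncomputable def target (i : ℕ) (ψ : ℕ → ℝ) (κ y e : ℝ) : ℝ :=
  Real.exp (-S.t) * (y * ∑ j ∈ Finset.Ico i S.J, (1 - ψ j / S.t) / 4 -
    S.a * (y * Real.log (κ / y))) - ((S.J : ℝ) - i) * e

/-- The sum over the levels from `i'` on of the discounted Bayes errors, for weights that are
thinned from level `i` on. -/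
noncomputable def total (i' i : ℕ) (ψ : ℕ → ℝ) (T : Finset ι) (g : Finset ι → ℝ) : ℝ :=
  ∑ j ∈ Finset.Ico i' S.J, Real.exp (-ψ j) * (S.K j).thinBayes (S.r ^ (j - i)) T g

/-- The main inequality at level `i`. -/
def Holds (i : ℕ) : Prop :=
  ∀ (T : Finset ι) (g : Finset ι → ℝ) (κ : ℝ) (ψ : ℕ → ℝ), (∀ W, 0 ≤ g W) →
    (∀ W, g W ≠ 0 → Disjoint T W) → 0 ≤ κ → (∀ W, g W ≤ κ * oddsLaw (S.o * S.r ^ i) T W) →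
    (∀ j, 0 ≤ ψ j) →
    S.target i ψ κ (∑ W, g W) (∑ W, g W * S.ρ W) ≤ S.total i i ψ T g

theorem pow_pos' (d : ℕ) : 0 < S.r ^ d := pow_pos S.r_pos d

theorem pow_le_one' (d : ℕ) : S.r ^ d ≤ 1 := pow_le_one₀ S.r_pos.le S.r_lt.le

theorem odds_pos (i : ℕ) : 0 < S.o * S.r ^ i := mul_pos S.o_pos (S.pow_pos' i)

theorem total_add_le (i' i : ℕ) (ψ : ℕ → ℝ) (T : Finset ι) (g g' : Finset ι → ℝ) :
    S.total i' i ψ T g + S.total i' i ψ T g' ≤ S.total i' i ψ T (fun W => g W + g' W) := by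
  unfold total
  rw [← Finset.sum_add_distrib]
  refine Finset.sum_le_sum fun j _ => ?_
  rw [← mul_add]
  exact mul_le_mul_of_nonneg_left ((S.K j).thinBayes_add_le _ _ _ _) (Real.exp_pos _).le

theorem sum_total_thin_le (i : ℕ) (ψ : ℕ → ℝ) (T : Finset ι) (g : Finset ι → ℝ) :
    ∑ X, S.total (i + 1) (i + 1) ψ (T ∪ X) (thin S.r g X) ≤ S.total (i + 1) i ψ T g := by
  unfold total
  rw [Finset.sum_comm]
  refine Finset.sum_le_sum fun j hj => ?_
  rw [← Finset.mul_sum]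
  refine mul_le_mul_of_nonneg_left ?_ (Real.exp_pos _).le
  have h := (S.K j).sum_thinBayes_thin_le (S.r ^ (j - (i + 1))) S.r T g
  have hj := (Finset.mem_Ico.1 hj).1
  rwa [← pow_succ', show j - (i + 1) + 1 = j - i by omega] at h

/-- After one thinning by `S.r`, the inequality at level `i + 1` applies for each removed set `X`
separately. `sum_mul_log_le` recombines the entropy terms, and forgetting `X` only raises the Bayes
errors. -/
theorem le_total_succ {i : ℕ} (h : S.Holds (i + 1)) (hi : i < S.J) {T : Finset ι}
    {g : Finset ι → ℝ} {κ : ℝ} {ψ : ℕ → ℝ}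
    (hg : ∀ W, 0 ≤ g W) (hT : ∀ W, g W ≠ 0 → Disjoint T W) (hκ : 0 ≤ κ)
    (hκg : ∀ W, g W ≤ κ * oddsLaw (S.o * S.r ^ i) T W) (hψ : ∀ j, 0 ≤ ψ j) :
    S.target (i + 1) ψ κ (∑ W, g W) (∑ W, g W * S.ρ W) ≤ S.total (i + 1) i ψ T g := by
  refine le_trans ?_ (S.sum_total_thin_le i ψ T g)
  have hr0 := S.r_pos.le
  have hr1 := S.r_lt.le
  have ho := (S.odds_pos i).le
  have h1 : ∀ X : Finset ι, S.target (i + 1) ψ (κ * removedLaw (S.o * S.r ^ i) S.r T X)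
      (∑ W, thin S.r g X W) (∑ W, thin S.r g X W * S.ρ W) ≤
      S.total (i + 1) (i + 1) ψ (T ∪ X) (thin S.r g X) := by
    intro X
    refine h _ _ _ _ (thin_nonneg hr0 hr1 hg X) (thin_disjoint hT X)
      (mul_nonneg hκ (removedLaw_nonneg ho hr0 hr1 _ _)) (fun W => ?_) hψ
    have := oddsLaw_thin_le ho hκ hr0 hr1 hκg X W
    rwa [mul_assoc S.o, ← pow_succ] at this
  refine le_trans ?_ (Finset.sum_le_sum fun X _ => h1 X)
  have hlog := sum_mul_log_le (Finset.univ : Finset (Finset ι))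
    (y := fun X => ∑ W, thin S.r g X W) (p := fun X => removedLaw (S.o * S.r ^ i) S.r T X) (κ := κ)
    (fun X _ => Finset.sum_nonneg fun W _ => thin_nonneg hr0 hr1 hg X W)
    (fun X _ => removedLaw_nonneg ho hr0 hr1 _ _) (sum_removedLaw ho T).le hκ
    (fun X _ => by
      have h2 : ∀ W, thin S.r g X W ≤ κ * removedLaw (S.o * S.r ^ i) S.r T X *
          oddsLaw (S.o * S.r ^ i * S.r) (T ∪ X) W := oddsLaw_thin_le ho hκ hr0 hr1 hκg X
      calc _ ≤ ∑ W, κ * removedLaw (S.o * S.r ^ i) S.r T X *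
          oddsLaw (S.o * S.r ^ i * S.r) (T ∪ X) W := Finset.sum_le_sum fun W _ => h2 W
        _ = _ := by rw [← Finset.mul_sum, sum_oddsLaw (mul_nonneg ho hr0), mul_one])
  rw [sum_thin] at hlog
  have hρ := sum_thin_mul_le hr0 hr1 hg S.ρ_mono
  unfold target
  rw [Finset.sum_sub_distrib, ← Finset.mul_sum, Finset.sum_sub_distrib, ← Finset.sum_mul, sum_thin,
    ← Finset.mul_sum, ← Finset.mul_sum]
  have hJ : (0 : ℝ) ≤ (S.J : ℝ) - ((i + 1 : ℕ) : ℝ) := by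
    rw [sub_nonneg]; exact_mod_cast hi
  have h2 := mul_le_mul_of_nonneg_left hρ hJ
  have h3 := mul_le_mul_of_nonneg_left hlog S.a_nonneg
  have h4 := (Real.exp_pos (-S.t)).le
  nlinarith [mul_le_mul_of_nonneg_left h3 h4]

theorem holds_last : S.Holds S.J := by
  intro T g κ ψ hg hT hκ hκg hψ
  have ho := (S.odds_pos S.J).le
  have hY : ∑ W, g W ≤ κ := by
    calc _ ≤ ∑ W, κ * oddsLaw (S.o * S.r ^ S.J) T W := Finset.sum_le_sum fun W _ => hκg W
      _ = κ := by rw [← Finset.mul_sum, sum_oddsLaw ho, mul_one]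
  have hY0 : 0 ≤ ∑ W, g W := Finset.sum_nonneg fun W _ => hg W
  have hl : 0 ≤ (∑ W, g W) * Real.log (κ / ∑ W, g W) := by
    rcases hY0.eq_or_lt with h | h
    · rw [← h, zero_mul]
    · exact mul_nonneg hY0 (Real.log_nonneg ((one_le_div h).2 hY))
  unfold target total
  simp only [Finset.Ico_self, Finset.sum_empty, mul_zero, zero_sub, sub_self, zero_mul, sub_zero]
  have := mul_nonneg S.a_nonneg hl
  have := (Real.exp_pos (-S.t)).le
  nlinarith

/-- This makes the discounts linear, so that the charges of successively forced sets add up. The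
price is the overall factor `exp (-S.t)`; past `x = S.t` the left side is negative. -/
theorem exp_discount (x : ℝ) (hx : 0 ≤ x) :
    Real.exp (-S.t) * (1 - x / S.t) ≤ Real.exp (-x) := by
  rcases le_or_gt x S.t with h | h
  · have h1 : Real.exp (-S.t) ≤ Real.exp (-x) := Real.exp_le_exp.2 (by linarith)
    have h2 : 1 - x / S.t ≤ 1 := by
      have := div_nonneg hx S.t_pos.le; linarith
    calc _ ≤ Real.exp (-S.t) * 1 := mul_le_mul_of_nonneg_left h2 (Real.exp_pos _).le
      _ ≤ _ := by linarith
  · have h1 : 1 - x / S.t ≤ 0 := by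
      have := (one_lt_div S.t_pos).2 h; linarith
    have := mul_nonpos_of_nonneg_of_nonpos (Real.exp_pos (-S.t)).le h1
    exact this.trans (Real.exp_pos _).le

theorem total_succ_le {i : ℕ} (hi : i < S.J) (ψ : ℕ → ℝ) (T : Finset ι) (g : Finset ι → ℝ) :
    S.total i i ψ T g = Real.exp (-ψ i) * (S.K i).bayes T g + S.total (i + 1) i ψ T g := by
  unfold total
  rw [Finset.sum_eq_sum_Ico_succ_bot hi]
  simp [Channel.thinBayes_one]

/-- The extra discount for forcing `k` elements at level `i`. -/
noncomputable def discount (i k : ℕ) (ψ : ℕ → ℝ) (j : ℕ) : ℝ :=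
  ψ j + if i < j then k * -Real.log (1 - S.r ^ (j - i)) else 0

theorem neg_log_nonneg {d : ℕ} (hd : d ≠ 0) : 0 ≤ -Real.log (1 - S.r ^ d) := by
  have h1 : S.r ^ d < 1 := pow_lt_one₀ S.r_pos.le S.r_lt hd
  have h2 := S.pow_pos' d
  have := Real.log_nonpos (x := 1 - S.r ^ d) (by linarith) (by linarith)
  linarith

theorem discount_nonneg {i k : ℕ} {ψ : ℕ → ℝ} (hψ : ∀ j, 0 ≤ ψ j) (j : ℕ) :
    0 ≤ S.discount i k ψ j := by
  unfold discount
  split_ifs with h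
  · exact add_nonneg (hψ j) (mul_nonneg (Nat.cast_nonneg _) (S.neg_log_nonneg (by omega)))
  · simpa using hψ j

theorem sum_discount_le (i k : ℕ) (ψ : ℕ → ℝ) :
    ∑ j ∈ Finset.Ico (i + 1) S.J, (1 - ψ j / S.t) / 4 - k * S.C / 4 ≤
      ∑ j ∈ Finset.Ico (i + 1) S.J, (1 - S.discount i k ψ j / S.t) / 4 := by
  have h1 : ∑ j ∈ Finset.Ico (i + 1) S.J, (1 - S.discount i k ψ j / S.t) / 4 =
      ∑ j ∈ Finset.Ico (i + 1) S.J, (1 - ψ j / S.t) / 4 -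
        k / (4 * S.t) * ∑ j ∈ Finset.Ico (i + 1) S.J, -Real.log (1 - S.r ^ (j - i)) := by
    rw [Finset.mul_sum, ← Finset.sum_sub_distrib]
    refine Finset.sum_congr rfl fun j hj => ?_
    have : i < j := (Finset.mem_Ico.1 hj).1
    have ht := S.t_pos.ne'
    simp only [discount, this, if_true]
    field_simp
    ring
  have h2 : ∑ j ∈ Finset.Ico (i + 1) S.J, -Real.log (1 - S.r ^ (j - i)) ≤ S.C * S.t := by
    rw [Finset.sum_Ico_eq_sum_range]
    refine le_trans (le_of_eq (Finset.sum_congr rfl fun d _ => ?_)) (S.sum_log (S.J - (i + 1)))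
    rw [show i + 1 + d - i = d + 1 by omega]
  have ht := S.t_pos
  have h3 : (k : ℝ) / (4 * S.t) * ∑ j ∈ Finset.Ico (i + 1) S.J, -Real.log (1 - S.r ^ (j - i)) ≤
      k * S.C / 4 := by
    calc _ ≤ (k : ℝ) / (4 * S.t) * (S.C * S.t) := mul_le_mul_of_nonneg_left h2 (by positivity)
      _ = _ := by field_simp
  rw [h1]
  linarith

/-- At level `j` the whole of `G` is revealed with probability `(1 - r ^ (j - i)) ^ #G`, and then
knowing `G` in advance makes no difference. -/
theorem total_discount_le {i : ℕ} (ψ : ℕ → ℝ) (T G : Finset ι) {g : Finset ι → ℝ}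
    (hg : ∀ W, 0 ≤ g W) :
    S.total (i + 1) i (S.discount i #G ψ) (T ∪ G) (strip g G) ≤ S.total (i + 1) i ψ T g := by
  unfold total
  refine Finset.sum_le_sum fun j hj => ?_
  have hj : i < j := (Finset.mem_Ico.1 hj).1
  have h1 : 0 < 1 - S.r ^ (j - i) := by
    have : S.r ^ (j - i) < 1 := pow_lt_one₀ S.r_pos.le S.r_lt (by omega)
    linarith
  have h2 : Real.exp (-S.discount i #G ψ j) = Real.exp (-ψ j) * (1 - S.r ^ (j - i)) ^ #G := by
    simp only [discount, hj, if_true]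
    rw [show -(ψ j + (#G : ℝ) * -Real.log (1 - S.r ^ (j - i))) =
      -ψ j + (#G : ℝ) * Real.log (1 - S.r ^ (j - i)) by ring, Real.exp_add, Real.exp_nat_mul,
      Real.exp_log h1]
  rw [h2, mul_assoc]
  exact mul_le_mul_of_nonneg_left
    ((S.K j).thinBayes_strip_le (S.pow_pos' _).le (S.pow_le_one' _) T G hg) (Real.exp_pos _).le

theorem sum_strip {g : Finset ι → ℝ} {G : Finset ι} (hG : ∀ W, g W ≠ 0 → G ⊆ W)
    (φ : Finset ι → ℝ) :
    ∑ W, strip g G W * φ (W ∪ G) = ∑ W, g W * φ W := by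
  unfold strip
  simp only [ite_mul, zero_mul]
  rw [← Finset.sum_filter]
  rw [← Finset.sum_filter_of_ne (s := Finset.univ) (p := fun W => G ⊆ W)
    (f := fun W => g W * φ W) (fun W _ h => hG W (left_ne_zero_of_mul h))]
  refine Finset.sum_bij' (fun W _ => W ∪ G) (fun W _ => W \ G) ?_ ?_ ?_ ?_ ?_
  · intro W _; simp
  · intro W _; simpa using Finset.disjoint_sdiff
  · intro W hW
    have hd : Disjoint G W := by simpa using hW
    exact Finset.union_sdiff_cancel_right hd.symm
  · intro W hW
    have hs : G ⊆ W := by simpa using hW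
    exact Finset.sdiff_union_of_subset hs
  · intro W _; rfl

/-- Spread weights have a large Bayes error at level `i`, and the later levels follow from the
inequality at `i + 1`. Otherwise some `G` is contained in the hidden set with too large a mass. The
part with `G ⊆ W` gives up level `i` and treats `G` as known, at a higher discount. The other part
has a smaller support, which is the measure of the inner induction. -/
theorem holds_of_succ {i : ℕ} (hi : i < S.J) (h : S.Holds (i + 1)) : S.Holds i := by
  intro T g κ ψ
  induction hN : #(Finset.univ.filter fun W => g W ≠ 0) using Nat.strong_induction_on
    generalizing g with
  | _ N ih =>
  intro hg hT hκ hκg hψ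
  have hE := Real.exp_pos (-S.t)
  have hsumIco : ∀ ψ : ℕ → ℝ, ∑ j ∈ Finset.Ico i S.J, (1 - ψ j / S.t) / 4 =
      (1 - ψ i / S.t) / 4 + ∑ j ∈ Finset.Ico (i + 1) S.J, (1 - ψ j / S.t) / 4 := fun ψ =>
    Finset.sum_eq_sum_Ico_succ_bot hi _
  have hJ : (0 : ℝ) ≤ (S.J : ℝ) - ((i + 1 : ℕ) : ℝ) := by
    rw [sub_nonneg]; exact_mod_cast hi
  have hcast : ((i + 1 : ℕ) : ℝ) = i + 1 := by push_cast; rfl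
  by_cases hsp : ∀ G : Finset ι, G.Nonempty →
      ∑ W, (if G ⊆ W then g W else 0) ≤ S.q ^ #G * ∑ W, g W
  · have h1 := S.spread i hi T g hg hT hsp
    have h2 := S.le_total_succ h hi hg hT hκ hκg hψ
    rw [S.total_succ_le hi]
    have hY0 : 0 ≤ ∑ W, g W := Finset.sum_nonneg fun W _ => hg W
    have hR0 : 0 ≤ ∑ W, g W * S.ρ W :=
      Finset.sum_nonneg fun W _ => mul_nonneg (hg W) (S.ρ_nonneg W)
    have h3 : Real.exp (-S.t) * (1 - ψ i / S.t) * ((∑ W, g W) / 4) - ∑ W, g W * S.ρ W ≤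
        Real.exp (-ψ i) * (S.K i).bayes T g := by
      have h4 := S.exp_discount (ψ i) (hψ i)
      have h5 : Real.exp (-ψ i) ≤ 1 := Real.exp_le_one_iff.2 (by linarith [hψ i])
      have h6 := Real.exp_pos (-ψ i)
      have h7 := mul_le_mul_of_nonneg_left h1 h6.le
      have h8 := mul_le_mul_of_nonneg_right h4 (by positivity : (0 : ℝ) ≤ (∑ W, g W) / 4)
      nlinarith
    unfold target at h2 ⊢
    rw [hsumIco, hcast] at *
    nlinarith
  · push Not at hsp
    obtain ⟨G, hGne, hG⟩ := hsp
    set g₁ : Finset ι → ℝ := fun W => if G ⊆ W then g W else 0 with hg₁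
    set g₂ : Finset ι → ℝ := fun W => if G ⊆ W then 0 else g W with hg₂
    have hadd : (fun W => g₁ W + g₂ W) = g := by
      ext W; simp only [hg₁, hg₂]; split_ifs <;> simp
    have hg₁0 : ∀ W, 0 ≤ g₁ W := fun W => by
      simp only [hg₁]; split_ifs; exacts [hg W, le_rfl]
    have hg₂0 : ∀ W, 0 ≤ g₂ W := fun W => by
      simp only [hg₂]; split_ifs; exacts [le_rfl, hg W]
    have hg₁le : ∀ W, g₁ W ≤ g W := fun W => by
      have : g₁ W + g₂ W = g W := congrFun hadd W; linarith [hg₂0 W]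
    have hg₂le : ∀ W, g₂ W ≤ g W := fun W => by
      have : g₁ W + g₂ W = g W := congrFun hadd W; linarith [hg₁0 W]
    have hne₁ : ∀ W, g₁ W ≠ 0 → g W ≠ 0 := fun W h0 h1 =>
      h0 (le_antisymm (h1 ▸ hg₁le W) (hg₁0 W))
    have hne₂ : ∀ W, g₂ W ≠ 0 → g W ≠ 0 := fun W h0 h1 =>
      h0 (le_antisymm (h1 ▸ hg₂le W) (hg₂0 W))
    have hY : ∑ W, g W = ∑ W, g₁ W + ∑ W, g₂ W := by
      rw [← Finset.sum_add_distrib]; exact Finset.sum_congr rfl fun W _ => (congrFun hadd W).symm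
    have hRho : ∑ W, g W * S.ρ W = ∑ W, g₁ W * S.ρ W + ∑ W, g₂ W * S.ρ W := by
      rw [← Finset.sum_add_distrib]
      exact Finset.sum_congr rfl fun W _ => by rw [← add_mul]; rw [← congrFun hadd W]
    have hY0 : 0 ≤ ∑ W, g W := Finset.sum_nonneg fun W _ => hg W
    have hy₂ : 0 ≤ ∑ W, g₂ W := Finset.sum_nonneg fun W _ => hg₂0 W
    have hy₁ : 0 < ∑ W, g₁ W :=
      lt_of_le_of_lt (mul_nonneg (pow_nonneg S.q_pos.le _) hY0) hG
    have hκpos : 0 < κ := by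
      rcases hκ.eq_or_lt with h0 | h0
      · exfalso
        have : ∑ W, g W ≤ 0 := Finset.sum_nonpos fun W _ => by
          have := hκg W; rwa [← h0, zero_mul] at this
        linarith
      · exact h0
    have hcard : #(Finset.univ.filter fun W => g₂ W ≠ 0) < N := by
      rw [← hN]
      refine Finset.card_lt_card ⟨fun W hW => ?_, fun hsub => ?_⟩
      · simp only [Finset.mem_filter, Finset.mem_univ, true_and] at hW ⊢
        exact hne₂ W hW
      · obtain ⟨W, _, hW⟩ := Finset.exists_ne_zero_of_sum_ne_zero hy₁.ne'
        have h1 := hsub (Finset.mem_filter.2 ⟨Finset.mem_univ W, hne₁ W hW⟩)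
        simp only [Finset.mem_filter, Finset.mem_univ, true_and, hg₂] at h1
        by_cases h0 : G ⊆ W
        · exact h1 (if_pos h0)
        · exact hW (if_neg h0)
    have ih₂ := ih _ hcard g₂ rfl hg₂0 (fun W hW => hT W (hne₂ W hW)) hκ
      (fun W => (hg₂le W).trans (hκg W)) hψ
    have ho := S.odds_pos i
    have hT₁ : ∀ W, g₁ W ≠ 0 → Disjoint T W := fun W hW => hT W (hne₁ W hW)
    have hG₁ : ∀ W, g₁ W ≠ 0 → G ⊆ W := fun W hW => by
      simp only [hg₁] at hW; split_ifs at hW with h0; exacts [h0, absurd rfl hW]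
    -- The stripped part enters level `i + 1` with `κ` multiplied by the `#G`-th power of the odds;
    -- this is the source of the gain in entropy.
    have h₁ := S.le_total_succ h hi (strip_nonneg hg₁0 G) (strip_disjoint hT₁ G)
      (mul_nonneg hκ (pow_nonneg ho.le #G))
      (oddsLaw_strip_le ho.le hκ fun W => (hg₁le W).trans (hκg W))
      (S.discount_nonneg (i := i) (k := #G) hψ)
    have h₂ := h₁.trans (S.total_discount_le ψ T G hg₁0)
    have hmass : ∑ W, strip g₁ G W = ∑ W, g₁ W := by
      simpa using sum_strip hG₁ (fun _ => 1)
    have hrho₁ : ∑ W, strip g₁ G W * S.ρ W ≤ ∑ W, g₁ W * S.ρ W := by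
      rw [← sum_strip hG₁ S.ρ]
      exact Finset.sum_le_sum fun W _ => mul_le_mul_of_nonneg_left
        (S.ρ_mono Finset.subset_union_left) (strip_nonneg hg₁0 G W)
    have hrho0 : 0 ≤ ∑ W, g₁ W * S.ρ W :=
      Finset.sum_nonneg fun W _ => mul_nonneg (hg₁0 W) (S.ρ_nonneg W)
    have h₃ : S.total (i + 1) i ψ T g₁ ≤ S.total i i ψ T g₁ := by
      rw [S.total_succ_le hi]
      have := mul_nonneg (Real.exp_pos (-ψ i)).le ((S.K i).bayes_nonneg T hg₁0)
      linarith
    have h₄ := S.total_add_le i i ψ T g₁ g₂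
    rw [hadd] at h₄
    refine le_trans ?_ h₄
    refine le_trans ?_ (add_le_add (h₂.trans h₃) ih₂)
    rw [hmass]
    have hlog := mul_log_split_le (k := #G) hy₁ hy₂ hκpos ho S.q_pos (by rw [← hY]; exact hG.le)
    rw [← hY] at hlog
    have hdisc := S.sum_discount_le i #G ψ
    have hk : (1 : ℝ) ≤ #G := by exact_mod_cast hGne.card_pos
    -- It is enough to multiply `S.gain` by `#G ≥ 1`: the odds at level `i` are at most `S.o`, so
    -- the logarithm only grows.
    have hgain : (1 + #G * S.C) / 4 ≤ S.a * (#G * Real.log (S.q / (S.o * S.r ^ i)) - 1) := by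
      have hl : Real.log (S.q / S.o) ≤ Real.log (S.q / (S.o * S.r ^ i)) := by
        have := S.q_pos
        have := S.o_pos
        refine Real.log_le_log (by positivity) ?_
        refine div_le_div_of_nonneg_left (by positivity) ho ?_
        nlinarith [S.pow_le_one' i]
      have h1 := S.gain
      have h2 := S.one_le_log
      have h3 := S.C_nonneg
      have h4 := S.a_nonneg
      calc (1 + #G * S.C) / 4 ≤ #G * ((1 + S.C) / 4) := by nlinarith
        _ ≤ #G * (S.a * (Real.log (S.q / S.o) - 1)) := by gcongr
        _ = S.a * (#G * (Real.log (S.q / S.o) - 1)) := by ring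
        _ ≤ S.a * (#G * Real.log (S.q / (S.o * S.r ^ i)) - 1) := by
            refine mul_le_mul_of_nonneg_left ?_ h4
            nlinarith
    unfold target
    rw [hsumIco, hcast, hRho]
    have hψi : (1 - ψ i / S.t) / 4 ≤ 1 / 4 := by
      have := div_nonneg (hψ i) S.t_pos.le; linarith
    set y₁ := ∑ W, g₁ W
    set y₂ := ∑ W, g₂ W
    set A₀ := ∑ j ∈ Finset.Ico (i + 1) S.J, (1 - ψ j / S.t) / 4
    set A₁ := ∑ j ∈ Finset.Ico (i + 1) S.J, (1 - S.discount i #G ψ j / S.t) / 4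
    set lam := Real.log (S.q / (S.o * S.r ^ i))
    rw [hcast] at hJ
    have e1 : ((S.J : ℝ) - (i + 1)) * ∑ W, strip g₁ G W * S.ρ W ≤
        ((S.J : ℝ) - i) * ∑ W, g₁ W * S.ρ W := by
      have := mul_le_mul_of_nonneg_left hrho₁ hJ
      linarith
    have e2 : y₁ * (A₀ - #G * S.C / 4) ≤ y₁ * A₁ := mul_le_mul_of_nonneg_left hdisc hy₁.le
    have e3 := mul_le_mul_of_nonneg_left hlog S.a_nonneg
    have e4 := mul_le_mul_of_nonneg_left hgain hy₁.le
    have e5 : y₁ * ((1 - ψ i / S.t) / 4) ≤ y₁ * (1 / 4) := mul_le_mul_of_nonneg_left hψi hy₁.le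
    have e6 : (∑ W, g W) * ((1 - ψ i / S.t) / 4 + A₀) -
        S.a * ((∑ W, g W) * Real.log (κ / ∑ W, g W)) ≤
        (y₁ * A₁ - S.a * (y₁ * Real.log (κ * (S.o * S.r ^ i) ^ #G / y₁))) +
        (y₂ * ((1 - ψ i / S.t) / 4 + A₀) - S.a * (y₂ * Real.log (κ / y₂))) := by
      rw [hY] at e3 ⊢
      linarith
    have e7 := mul_le_mul_of_nonneg_left e6 hE.le
    linarith

theorem holds_zero : S.Holds 0 :=
  Nat.decreasingInduction (motive := fun i _ => S.Holds i) (fun _ hk h => S.holds_of_succ hk h)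
    S.holds_last (Nat.zero_le _)

/-- The main inequality for weights that are thinned once more at the beginning. -/
theorem le_sum_thinBayes {φ κ : ℝ} (h0 : 0 ≤ φ) (h1 : φ ≤ 1) {o₀ : ℝ} (ho₀ : 0 ≤ o₀)
    (ho : o₀ * φ = S.o) {g : Finset ι → ℝ} (hg : ∀ W, 0 ≤ g W) (hκ : 0 ≤ κ)
    (hκg : ∀ W, g W ≤ κ * oddsLaw o₀ ∅ W) :
    Real.exp (-S.t) * ((∑ W, g W) * (S.J / 4) -
        S.a * ((∑ W, g W) * Real.log (κ / ∑ W, g W))) - S.J * ∑ W, g W * S.ρ W ≤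
      ∑ j ∈ Finset.range S.J, (S.K j).thinBayes (φ * S.r ^ j) ∅ g := by
  have h2 : ∀ X : Finset ι, S.target 0 (fun _ => 0) (κ * removedLaw o₀ φ ∅ X)
      (∑ W, thin φ g X W) (∑ W, thin φ g X W * S.ρ W) ≤ S.total 0 0 (fun _ => 0) (∅ ∪ X) (thin φ g X) := by
    intro X
    refine S.holds_zero _ _ _ _ (thin_nonneg h0 h1 hg X)
      (thin_disjoint (T := ∅) (fun W _ => Finset.disjoint_empty_left W) X)
      (mul_nonneg hκ (removedLaw_nonneg ho₀ h0 h1 _ _)) (fun W => ?_) (fun _ => le_rfl)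
    have := oddsLaw_thin_le ho₀ hκ h0 h1 hκg X W
    simpa [ho] using this
  have h3 : ∑ X, S.total 0 0 (fun _ => 0) (∅ ∪ X) (thin φ g X) ≤
      ∑ j ∈ Finset.range S.J, (S.K j).thinBayes (φ * S.r ^ j) ∅ g := by
    unfold total
    rw [Finset.sum_comm, Nat.Ico_zero_eq_range]
    refine Finset.sum_le_sum fun j _ => ?_
    simp only [neg_zero, Real.exp_zero, one_mul, Nat.sub_zero]
    exact (S.K j).sum_thinBayes_thin_le _ _ _ _
  refine le_trans ?_ ((Finset.sum_le_sum fun X _ => h2 X).trans h3)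
  have hlog := sum_mul_log_le (Finset.univ : Finset (Finset ι))
    (y := fun X => ∑ W, thin φ g X W) (p := fun X => removedLaw o₀ φ ∅ X) (κ := κ)
    (fun X _ => Finset.sum_nonneg fun W _ => thin_nonneg h0 h1 hg X W)
    (fun X _ => removedLaw_nonneg ho₀ h0 h1 _ _) (sum_removedLaw ho₀ ∅).le hκ
    (fun X _ => by
      calc _ ≤ ∑ W, κ * removedLaw o₀ φ ∅ X * oddsLaw (o₀ * φ) (∅ ∪ X) W :=
            Finset.sum_le_sum fun W _ => oddsLaw_thin_le ho₀ hκ h0 h1 hκg X W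
        _ = _ := by rw [← Finset.mul_sum, sum_oddsLaw (mul_nonneg ho₀ h0), mul_one])
  rw [sum_thin] at hlog
  have hρ := sum_thin_mul_le h0 h1 hg S.ρ_mono
  unfold target
  rw [Finset.sum_sub_distrib, ← Finset.mul_sum, Finset.sum_sub_distrib, ← Finset.sum_mul, sum_thin,
    ← Finset.mul_sum, ← Finset.mul_sum]
  simp only [zero_div, sub_zero, Finset.sum_const, Nat.card_Ico, nsmul_eq_mul, Nat.cast_zero,
    Nat.sub_zero]
  have e1 := mul_le_mul_of_nonneg_left hρ (Nat.cast_nonneg (α := ℝ) S.J)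
  have e2 := mul_le_mul_of_nonneg_left (mul_le_mul_of_nonneg_left hlog S.a_nonneg)
    (Real.exp_pos (-S.t)).le
  nlinarith

end Levels

end Levels

theorem sum_pi_prod {ι R : Type*} [Fintype ι] [DecidableEq ι] [Fintype R] (f : ι → R → ℝ) :
    ∑ c : ι → R, ∏ x, f x (c x) = ∏ x, ∑ r, f x r := by
  rw [Finset.prod_univ_sum, Fintype.piFinset_univ]

/-! ### Second moment bound for spread weights. -/

section Spread

variable {ι R : Type*} [Fintype ι] [DecidableEq ι] [Fintype R]

/-- If the weights `g` are spread, then two independent sets drawn according to `g` have a small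
intersection. -/
theorem sum_pow_inter_le {g : Finset ι → ℝ} (hg : ∀ W, 0 ≤ g W) {q A : ℝ} (hA : 1 ≤ A)
    (hq : 0 ≤ q)
    (hs : ∀ G : Finset ι, G.Nonempty → ∑ W, (if G ⊆ W then g W else 0) ≤ q ^ #G * ∑ W, g W) :
    ∑ W, ∑ W', g W * g W' * A ^ #(W ∩ W') ≤ (∑ W, g W) * ∑ W, g W * (1 + A * q) ^ #W := by
  have hs' : ∀ G : Finset ι, ∑ W, (if G ⊆ W then g W else 0) ≤ q ^ #G * ∑ W, g W := by
    intro G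
    rcases G.eq_empty_or_nonempty with h | h
    · simp [h]
    · exact hs G h
  -- Expanding `((A - 1) + 1) ^ #(W ∩ W')` over the common subsets `G` brings in the masses of the
  -- sets that contain `G`, which the spread condition controls.
  have hpow : ∀ W W' : Finset ι, A ^ #(W ∩ W') =
      ∑ G ∈ W.powerset, if G ⊆ W' then (A - 1) ^ #G else 0 := by
    intro W W'
    have h := sum_powerset_pow (W ∩ W') (A - 1) 1
    rw [sub_add_cancel] at h
    rw [← h, ← Finset.sum_filter]
    simp only [one_pow, mul_one]
    refine Finset.sum_congr ?_ fun _ _ => rfl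
    ext G
    rw [Finset.mem_powerset, Finset.mem_filter, Finset.mem_powerset, Finset.subset_inter_iff]
  rw [Finset.mul_sum]
  refine Finset.sum_le_sum fun W _ => ?_
  have hA' : 0 ≤ A - 1 := by linarith
  calc ∑ W', g W * g W' * A ^ #(W ∩ W')
      = g W * ∑ G ∈ W.powerset, (A - 1) ^ #G * ∑ W', (if G ⊆ W' then g W' else 0) := by
        simp only [hpow, Finset.mul_sum]
        rw [Finset.sum_comm]
        refine Finset.sum_congr rfl fun G _ => Finset.sum_congr rfl fun W' _ => ?_
        split_ifs <;> ring
    _ ≤ g W * ∑ G ∈ W.powerset, (A - 1) ^ #G * (q ^ #G * ∑ W, g W) := by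
        gcongr with G
        · exact hg W
        · exact hs' G
    _ = g W * ((∑ W, g W) * (1 + (A - 1) * q) ^ #W) := by
        congr 1
        rw [add_comm (1 : ℝ), ← sum_powerset_pow W ((A - 1) * q) 1, Finset.mul_sum]
        refine Finset.sum_congr rfl fun G _ => ?_
        rw [one_pow, mul_pow]; ring
    _ ≤ g W * ((∑ W, g W) * (1 + A * q) ^ #W) := by
        have := Finset.sum_nonneg fun W (_ : W ∈ Finset.univ) => hg W
        have h2 := mul_nonneg hA' hq
        have h3 := hg W
        gcongr
        linarith
    _ = _ := by ring

namespace Channel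

/-- A second moment bound for the Bayes error of a channel under spread weights. -/
theorem spread_le_bayes (K : Channel ι R) (ref : ι → R → ℝ) (href : ∀ x r, 0 < ref x r)
    (hrefs : ∀ x, ∑ r, ref x r = 1) (hrev : ∀ x, ∑ r, K.rev x r = 1)
    (hmem : ∀ b x, ∑ r, K.mem b x r = 1) (hnon : ∀ b x, ∑ r, K.non b x r = 1) {A ε q : ℝ}
    (hA : 1 ≤ A) (hε : 0 ≤ ε) (hq : 0 ≤ q)
    (hmm : ∀ b x, ∑ r, K.mem b x r * K.mem b x r / ref x r ≤ A)
    (hmn : ∀ b x, ∑ r, K.mem b x r * K.non b x r / ref x r ≤ 1)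
    (hnn : ∀ b x, ∑ r, K.non b x r * K.non b x r / ref x r ≤ 1 + ε)
    (T : Finset ι) {g : Finset ι → ℝ} (hg : ∀ W, 0 ≤ g W)
    (hs : ∀ G : Finset ι, G.Nonempty → ∑ W, (if G ⊆ W then g W else 0) ≤ q ^ #G * ∑ W, g W) :
    (∑ W, g W) / 4 - ∑ W, g W * ((1 + ε) ^ Fintype.card ι * (1 + A * q) ^ #W - 1) ≤
      K.bayes T g := by
  set Y := ∑ W, g W with hY
  have hY0 : 0 ≤ Y := Finset.sum_nonneg fun W _ => hg W
  set base : ι → R → ℝ := fun x r => if x ∈ T then K.rev x r else ref x r with hbase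
  have hbase0 : ∀ x r, 0 ≤ base x r := fun x r => by
    simp only [hbase]; split_ifs; exacts [K.rev_nonneg _ _, (href _ _).le]
  set B : (ι → R) → ℝ := fun c => ∏ x, base x (c x) with hB
  have hB0 : ∀ c, 0 ≤ B c := fun c => Finset.prod_nonneg fun x _ => hbase0 _ _
  have hBs : ∑ c, B c = 1 := by
    rw [hB, sum_pi_prod]
    refine Finset.prod_eq_one fun x _ => ?_
    simp only [hbase]; split_ifs; exacts [hrev x, hrefs x]
  have hkers : ∀ W b, ∑ c, K.ker T W b c = 1 := by
    intro W b
    unfold ker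
    rw [sum_pi_prod]
    refine Finset.prod_eq_one fun x _ => ?_
    unfold coord; split_ifs; exacts [hrev x, hmem b x, hnon b x]
  have hlaws : ∀ b, ∑ c, K.law T g b c = Y := by
    intro b
    unfold law
    rw [Finset.sum_comm]
    simp only [← Finset.mul_sum, hkers, mul_one]
    rfl
  -- Where the reference measure vanishes the laws vanish too, so the convention for division by
  -- zero does no harm in the second moment.
  have hzero : ∀ b c, B c = 0 → K.law T g b c = 0 := by
    intro b c h
    obtain ⟨x, _, hx⟩ := Finset.prod_eq_zero_iff.1 h
    have hxT : x ∈ T := by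
      by_contra hxT
      simp only [hbase, hxT, if_false] at hx
      exact (href x (c x)).ne' hx
    simp only [hbase, hxT, if_true] at hx
    refine Finset.sum_eq_zero fun W _ => ?_
    rw [ker, Finset.prod_eq_zero (Finset.mem_univ x), mul_zero]
    simp [coord, hxT, hx]
  have hcoord : ∀ W W' b x, ∑ r, K.coord T W b x r * K.coord T W' b x r / base x r ≤
      (1 + ε) * (if x ∈ W ∩ W' then A else 1) := by
    intro W W' b x
    have hm : A ≤ (1 + ε) * A := by nlinarith
    simp only [coord, hbase, Finset.mem_inter]
    by_cases hxT : x ∈ T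
    · simp only [hxT, if_true]
      have : ∀ r, K.rev x r * K.rev x r / K.rev x r = K.rev x r := fun r => mul_self_div_self _
      simp only [this, hrev]
      split_ifs <;> linarith
    · by_cases h1 : x ∈ W <;> by_cases h2 : x ∈ W' <;> simp only [hxT, h1, h2, if_true, if_false,
        and_true, and_false, mul_one]
      · exact (hmm b x).trans hm
      · exact (hmn b x).trans (by linarith)
      · simp only [mul_comm (K.non b x _)]
        exact (hmn b x).trans (by linarith)
      · exact hnn b x
  have hkk : ∀ W W' b, ∑ c, K.ker T W b c * K.ker T W' b c / B c ≤
      (1 + ε) ^ Fintype.card ι * A ^ #(W ∩ W') := by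
    intro W W' b
    have h1 : ∀ c, K.ker T W b c * K.ker T W' b c / B c =
        ∏ x, K.coord T W b x (c x) * K.coord T W' b x (c x) / base x (c x) := by
      intro c
      rw [Finset.prod_div_distrib, Finset.prod_mul_distrib]; rfl
    simp only [h1]
    rw [sum_pi_prod (fun x r => K.coord T W b x r * K.coord T W' b x r / base x r)]
    refine (Finset.prod_le_prod (fun x _ => Finset.sum_nonneg fun r _ => div_nonneg (mul_nonneg
      (K.coord_nonneg _ _ _ _ _) (K.coord_nonneg _ _ _ _ _)) (hbase0 _ _))
      fun x _ => hcoord W W' b x).trans (le_of_eq ?_)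
    rw [Finset.prod_mul_distrib, Finset.prod_const, Finset.card_univ, Finset.prod_ite_mem,
      Finset.univ_inter, Finset.prod_const]
  have hsq : ∀ b, ∑ c, K.law T g b c ^ 2 / B c ≤
      Y * ∑ W, g W * ((1 + ε) ^ Fintype.card ι * (1 + A * q) ^ #W) := by
    intro b
    calc ∑ c, K.law T g b c ^ 2 / B c
        = ∑ W, ∑ W', g W * g W' * ∑ c, K.ker T W b c * K.ker T W' b c / B c := by
          have h1 : ∀ c, K.law T g b c ^ 2 / B c =
              ∑ W, ∑ W', g W * g W' * (K.ker T W b c * K.ker T W' b c / B c) := by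
            intro c
            rw [law, sq, Finset.sum_mul_sum, Finset.sum_div]
            refine Finset.sum_congr rfl fun W _ => ?_
            rw [Finset.sum_div]
            exact Finset.sum_congr rfl fun W' _ => by ring
          simp only [h1]
          rw [Finset.sum_comm]
          refine Finset.sum_congr rfl fun W _ => ?_
          rw [Finset.sum_comm]
          exact Finset.sum_congr rfl fun W' _ => by rw [Finset.mul_sum]
      _ ≤ ∑ W, ∑ W', g W * g W' * ((1 + ε) ^ Fintype.card ι * A ^ #(W ∩ W')) :=
          Finset.sum_le_sum fun W _ => Finset.sum_le_sum fun W' _ =>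
            mul_le_mul_of_nonneg_left (hkk W W' b) (mul_nonneg (hg W) (hg W'))
      _ = (1 + ε) ^ Fintype.card ι * ∑ W, ∑ W', g W * g W' * A ^ #(W ∩ W') := by
          simp only [Finset.mul_sum]
          refine Finset.sum_congr rfl fun W _ => Finset.sum_congr rfl fun W' _ => ?_
          ring
      _ ≤ (1 + ε) ^ Fintype.card ι * (Y * ∑ W, g W * (1 + A * q) ^ #W) := by
          gcongr
          exact sum_pow_inter_le hg hA hq hs
      _ = _ := by
          simp only [Finset.mul_sum]
          refine Finset.sum_congr rfl fun W _ => ?_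
          ring
  rcases hY0.eq_or_lt with h0 | hYpos
  · have hz : ∀ W, g W = 0 := fun W =>
      (Finset.sum_eq_zero_iff_of_nonneg fun W _ => hg W).1 h0.symm W (Finset.mem_univ W)
    rw [← h0]
    simp only [hz, zero_mul, Finset.sum_const_zero, zero_div, sub_zero]
    exact K.bayes_nonneg T hg
  -- This is the excess `(law - Y * B) ^ 2 / (Y * B)`, and zero where `B` vanishes. By a completed
  -- square each law is at least `3/4 * Y * B - d`, so the Bayes error is at least `3/8 * Y` minus
  -- the mean of the two total excesses.
  set d : Bool → (ι → R) → ℝ := fun b c =>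
    K.law T g b c ^ 2 / B c / Y - 2 * K.law T g b c + Y * B c with hd
  have hpt : ∀ c b, 0 ≤ d b c ∧ 3 / 4 * (Y * B c) - d b c ≤ K.law T g b c := by
    intro c b
    simp only [hd]
    rcases (hB0 c).eq_or_lt with h | h
    · rw [hzero b c h.symm, ← h]; simp
    · have hp : 0 < Y * B c := mul_pos hYpos h
      have e : K.law T g b c ^ 2 / B c / Y = K.law T g b c ^ 2 / (Y * B c) := by
        rw [div_div, mul_comm]
      rw [e]
      constructor
      · have h1 : 2 * K.law T g b c - Y * B c ≤ K.law T g b c ^ 2 / (Y * B c) := by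
          rw [le_div_iff₀ hp]
          nlinarith [sq_nonneg (K.law T g b c - Y * B c)]
        linarith
      · have h1 : K.law T g b c - 1 / 4 * (Y * B c) ≤ K.law T g b c ^ 2 / (Y * B c) := by
          rw [le_div_iff₀ hp]
          nlinarith [sq_nonneg (K.law T g b c - Y * B c / 2)]
        linarith
  have hds : ∀ b, ∑ c, d b c ≤
      ∑ W, g W * ((1 + ε) ^ Fintype.card ι * (1 + A * q) ^ #W - 1) := by
    intro b
    simp only [hd, Finset.sum_add_distrib, Finset.sum_sub_distrib, ← Finset.mul_sum,
      ← Finset.sum_div, hlaws, hBs, mul_sub, mul_one]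
    have h1 := (div_le_iff₀ hYpos).2 ((hsq b).trans_eq (mul_comm _ _))
    linarith
  have hmin : ∀ c, 3 / 8 * (Y * B c) - 1 / 2 * (d true c + d false c) ≤
      min (1 / 2 * K.law T g true c) (1 / 2 * K.law T g false c) := by
    intro c
    have h1 := hpt c true
    have h2 := hpt c false
    refine le_min ?_ ?_ <;> linarith
  have hfin := Finset.sum_le_sum fun c (_ : c ∈ Finset.univ) => hmin c
  rw [Finset.sum_sub_distrib, ← Finset.mul_sum, ← Finset.mul_sum, ← Finset.mul_sum, hBs,
    Finset.sum_add_distrib] at hfin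
  have h1 := hds true
  have h2 := hds false
  unfold bayes
  linarith

end Channel

end Spread

/-! ### Lengths of messages and entropy. -/

section Code

/-- The weight of a bit string in a subprobability measure on all the bit strings. -/
noncomputable def codeWeight (m : List Bool) : ℝ := (1 / 2) ^ (2 * m.length + 1)

theorem codeWeight_pos (m : List Bool) : 0 < codeWeight m := by unfold codeWeight; positivity

theorem neg_log_codeWeight (m : List Bool) :
    -Real.log (codeWeight m) = (2 * m.length + 1) * Real.log 2 := by
  rw [codeWeight, Real.log_pow, one_div, Real.log_inv]; push_cast; ring

/-- The `2 ^ k` strings of length `k` have total weight `2 ^ (-k - 1)`. Doubling the length in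
`codeWeight` thus replaces any prefix condition on the messages. -/
theorem sum_codeWeight_le (F : Finset (List Bool)) : ∑ m ∈ F, codeWeight m ≤ 1 := by
  obtain ⟨n, hn⟩ : ∃ n, ∀ m ∈ F, m.length < n := by
    obtain ⟨n, hn⟩ := (F.image List.length).exists_nat_subset_range
    exact ⟨n, fun m hm => Finset.mem_range.1 (hn (Finset.mem_image_of_mem _ hm))⟩
  rw [← Finset.sum_fiberwise_of_maps_to (t := Finset.range n) (g := List.length)
    (fun m hm => Finset.mem_range.2 (hn m hm))]
  have hcard : ∀ k, #(F.filter fun m => m.length = k) ≤ 2 ^ k := by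
    intro k
    have h : (F.filter fun m => m.length = k) ⊆
        (Finset.univ : Finset (List.Vector Bool k)).image List.Vector.toList := by
      intro m hm
      exact Finset.mem_image.2 ⟨⟨m, (Finset.mem_filter.1 hm).2⟩, Finset.mem_univ _, rfl⟩
    refine (Finset.card_le_card h).trans (Finset.card_image_le.trans ?_)
    rw [Finset.card_univ, card_vector, Fintype.card_bool]
  have hk : ∀ k ∈ Finset.range n, ∑ m ∈ F with m.length = k, codeWeight m ≤
      1 / 2 * (1 / 2 : ℝ) ^ k := by
    intro k _
    calc _ = ∑ m ∈ F with m.length = k, (1 / 2 : ℝ) ^ (2 * k + 1) :=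
          Finset.sum_congr rfl fun m hm => by rw [codeWeight, (Finset.mem_filter.1 hm).2]
      _ = #(F.filter fun m => m.length = k) * (1 / 2 : ℝ) ^ (2 * k + 1) := by
          rw [Finset.sum_const, nsmul_eq_mul]
      _ ≤ (2 : ℝ) ^ k * (1 / 2 : ℝ) ^ (2 * k + 1) := by
          gcongr; exact_mod_cast hcard k
      _ = _ := by
          rw [pow_succ, two_mul, pow_add, ← mul_assoc, ← mul_assoc, ← mul_pow]; norm_num; ring
  refine (Finset.sum_le_sum hk).trans ?_
  rw [← Finset.mul_sum]
  have := mul_neg_geom_sum (1 / 2 : ℝ) n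
  have h2 : (0 : ℝ) ≤ (1 / 2) ^ n := by positivity
  linarith

theorem sum_prod_codeWeight_le {X : Type*} [Fintype X] [DecidableEq X]
    (F : Finset (X → List Bool)) : ∑ m ∈ F, ∏ x, codeWeight (m x) ≤ 1 := by
  have h : F ⊆ Fintype.piFinset fun x => F.image fun m => m x := fun m hm =>
    Fintype.mem_piFinset.2 fun x => Finset.mem_image_of_mem (fun m : X → List Bool => m x) hm
  refine (Finset.sum_le_sum_of_subset_of_nonneg h fun m _ _ =>
    Finset.prod_nonneg fun x _ => (codeWeight_pos _).le).trans ?_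
  rw [← Finset.prod_univ_sum]
  exact Finset.prod_le_one (fun x _ => Finset.sum_nonneg fun m _ => (codeWeight_pos m).le)
    fun x _ => sum_codeWeight_le _

/-- The Gibbs inequality. -/
theorem sum_mul_neg_log_le {α : Type*} (s : Finset α) {y w : α → ℝ} (hy : ∀ i ∈ s, 0 ≤ y i)
    (hw : ∀ i, 0 < w i) (hy1 : ∑ i ∈ s, y i = 1) (hw1 : ∑ i ∈ s, w i ≤ 1) :
    ∑ i ∈ s, y i * Real.log (1 / y i) ≤ ∑ i ∈ s, y i * -Real.log (w i) := by
  have key : ∀ i ∈ s, y i * Real.log (1 / y i) ≤ y i * -Real.log (w i) + (w i - y i) := by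
    intro i hi
    rcases (hy i hi).eq_or_lt with h | h
    · rw [← h]; simpa using (hw i).le
    · have h1 := Real.log_le_sub_one_of_pos (x := w i / y i) (div_pos (hw i) h)
      rw [Real.log_div (hw i).ne' h.ne'] at h1
      have h2 := mul_le_mul_of_nonneg_left h1 h.le
      have h3 : y i * (w i / y i - 1) = w i - y i := by field_simp
      rw [one_div, Real.log_inv]
      linarith
  refine (Finset.sum_le_sum key).trans ?_
  rw [Finset.sum_add_distrib, Finset.sum_sub_distrib, hy1]
  linarith

/-- The entropy of a family of messages is bounded by their expected length. -/
theorem entropy_messages_le {α X : Type*} [Fintype α] [Fintype X] [DecidableEq X] {p : α → ℝ}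
    (hp : ∀ a, 0 ≤ p a) (hp1 : ∑ a, p a = 1) (M : α → X → List Bool) :
    ∑ m ∈ Finset.univ.image M, (∑ a, if M a = m then p a else 0) *
        Real.log (1 / ∑ a, if M a = m then p a else 0) ≤
      Real.log 2 * ∑ a, p a * ∑ x, (2 * ((M a x).length : ℝ) + 1) := by
  have hfib : ∀ φ : (X → List Bool) → ℝ,
      ∑ m ∈ Finset.univ.image M, (∑ a, if M a = m then p a else 0) * φ m =
        ∑ a, p a * φ (M a) := by
    intro φ
    rw [← Finset.sum_fiberwise_of_maps_to (t := Finset.univ.image M) (g := M)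
      (fun a _ => Finset.mem_image_of_mem M (Finset.mem_univ a))]
    refine Finset.sum_congr rfl fun m _ => ?_
    rw [← Finset.sum_filter, Finset.sum_mul]
    exact Finset.sum_congr rfl fun a ha => by rw [(Finset.mem_filter.1 ha).2]
  have h1 := hfib fun _ => 1
  simp only [mul_one, hp1] at h1
  refine (sum_mul_neg_log_le (Finset.univ.image M)
    (fun m _ => Finset.sum_nonneg fun a _ => by split_ifs; exacts [hp a, le_rfl])
    (fun m => Finset.prod_pos fun x _ => codeWeight_pos (m x)) h1
    (sum_prod_codeWeight_le _)).trans (le_of_eq ?_)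
  rw [hfib, Finset.mul_sum]
  refine Finset.sum_congr rfl fun a _ => ?_
  rw [Real.log_prod (fun x _ => (codeWeight_pos _).ne'), ← Finset.sum_neg_distrib]
  simp only [neg_log_codeWeight]
  rw [← Finset.sum_mul]; ring

end Code

/-! ### Guessing many hidden bits with a short common message. -/

section Hidden

variable {σ H O M : Type*} [Fintype σ] [DecidableEq σ] [Fintype H] [DecidableEq O]

/-- The probability that the observation is `a` and that the hidden bit is `b`. -/
noncomputable def jointProb (p : H → ℝ) (y : H → Bool) (o : H → O) (a : O) (b : Bool) : ℝ :=
  ∑ h, if o h = a ∧ y h = b then p h else 0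

/-- The Bayes error of guessing a hidden bit from an observation. -/
noncomputable def bayesError (p : H → ℝ) (y : H → Bool) (o : H → O) : ℝ :=
  ∑ a ∈ Finset.univ.image o, min (jointProb p y o a true) (jointProb p y o a false)

theorem jointProb_nonneg {p : H → ℝ} (hp : ∀ h, 0 ≤ p h) (y : H → Bool) (o : H → O) (a : O)
    (b : Bool) : 0 ≤ jointProb p y o a b :=
  Finset.sum_nonneg fun h _ => by split_ifs; exacts [hp h, le_rfl]

/-- Let `P` be the mass of the observation `a` and `m` the smaller of its two joint probabilities.
Any guess errs with conditional probability at least `m / P`, so the conditional mean of `exp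
(-error)` is at most `1 - c * (m / P) ≤ exp (-c * (m / P))`, where `c = 1 - exp (-1)`. -/
theorem sum_exp_guess_le {p : H → ℝ} (hp : ∀ h, 0 ≤ p h) (y : H → Bool) (o : H → O) (a : O)
    (d : Bool) :
    ∑ h with o h = a, p h * Real.exp ((1 - Real.exp (-1)) *
      (min (jointProb p y o a true) (jointProb p y o a false) / ∑ h with o h = a, p h) -
        if d ≠ y h then 1 else 0) ≤ ∑ h with o h = a, p h := by
  set P := ∑ h with o h = a, p h with hP
  set m := min (jointProb p y o a true) (jointProb p y o a false) with hm
  set c := 1 - Real.exp (-1) with hc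
  have hP0 : 0 ≤ P := Finset.sum_nonneg fun h _ => hp h
  have hc0 : 0 ≤ c := by
    have : Real.exp (-1) ≤ 1 := Real.exp_le_one_iff.2 (by norm_num)
    linarith
  rcases hP0.eq_or_lt with h0 | hpos
  · have hz : ∀ h ∈ Finset.univ.filter (fun h => o h = a), p h = 0 :=
      (Finset.sum_eq_zero_iff_of_nonneg fun h _ => hp h).1 h0.symm
    rw [Finset.sum_eq_zero fun h hh => by rw [hz h hh, zero_mul]]
    exact hP0
  have hPj : P = ∑ h with o h = a, p h := rfl
  have hwrong : m ≤ ∑ h with o h = a, p h * (if d ≠ y h then 1 else 0) := by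
    have : jointProb p y o a (!d) = ∑ h with o h = a, p h * (if d ≠ y h then 1 else 0) := by
      rw [jointProb, Finset.sum_filter]
      refine Finset.sum_congr rfl fun h _ => ?_
      by_cases h1 : o h = a <;> cases hd : d <;> cases hy : y h <;> simp [h1]
    rw [← this]
    cases d
    · exact min_le_left _ _
    · exact min_le_right _ _
  have hterm : ∀ h, p h * Real.exp (c * (m / P) - if d ≠ y h then 1 else 0) =
      Real.exp (c * (m / P)) * (p h - c * (p h * if d ≠ y h then 1 else 0)) := by
    intro h
    rw [Real.exp_sub]
    split_ifs
    · rw [hc, div_eq_mul_inv, ← Real.exp_neg]; ring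
    · rw [Real.exp_zero]; ring
  simp only [hterm]
  rw [← Finset.mul_sum, Finset.sum_sub_distrib, ← Finset.mul_sum, ← hPj]
  have h1 : P - c * ∑ h with o h = a, p h * (if d ≠ y h then 1 else 0) ≤
      P * Real.exp (-(c * (m / P))) := by
    have h2 := Real.add_one_le_exp (-(c * (m / P)))
    have h3 := mul_le_mul_of_nonneg_left h2 hP0
    have h4 : P * (-(c * (m / P)) + 1) = P - c * m := by field_simp; ring
    have h5 := mul_le_mul_of_nonneg_left hwrong hc0
    linarith
  calc _ ≤ Real.exp (c * (m / P)) * (P * Real.exp (-(c * (m / P)))) :=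
        mul_le_mul_of_nonneg_left h1 (Real.exp_pos _).le
    _ = P := by rw [mul_left_comm, ← Real.exp_add, add_neg_cancel, Real.exp_zero, mul_one]

/-- Many hidden bits can be guessed with few errors from separate observations and a common message
only if the message is long. -/
theorem sum_bayesError_le {p : σ → H → ℝ} (hp : ∀ s h, 0 ≤ p s h) (hp1 : ∀ s, ∑ h, p s h = 1)
    (y : H → Bool) (o : σ → H → O) (μ : (σ → H) → M) {w : M → ℝ} (hw : ∀ m, 0 < w m)
    (hw1 : ∀ F : Finset M, ∑ m ∈ F, w m ≤ 1) (e : σ → (σ → H) → Bool)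
    (he : ∀ h h', (∀ s, o s (h s) = o s (h' s)) → μ h = μ h' → ∀ s, e s h = e s h') :
    (1 - Real.exp (-1)) * ∑ s, bayesError (p s) y (o s) ≤
      ∑ h : σ → H, (∏ s, p s (h s)) *
        ((∑ s, if e s h ≠ y (h s) then 1 else 0) - Real.log (w (μ h))) := by
  classical
  set c := 1 - Real.exp (-1) with hc
  set P : σ → O → ℝ := fun s a => ∑ h with o s h = a, p s h with hP
  set m : σ → O → ℝ := fun s a =>
    min (jointProb (p s) y (o s) a true) (jointProb (p s) y (o s) a false) with hm
  obtain ⟨d, hd⟩ : ∃ d : (σ → O) × M → σ → Bool,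
      ∀ h s, e s h = d (fun s => o s (h s), μ h) s := by
    have : Function.FactorsThrough (fun h s => e s h)
        (fun h : σ → H => ((fun s => o s (h s)), μ h)) := by
      intro h h' hh
      have h1 := congrArg Prod.fst hh
      have h2 := congrArg Prod.snd hh
      funext s
      exact he h h' (fun s => congrFun h1 s) h2 s
    obtain ⟨d, hd⟩ := (Function.factorsThrough_iff _).1 this
    exact ⟨d, fun h s => congrFun (congrFun hd h) s⟩
  have hprod0 : ∀ h : σ → H, 0 ≤ ∏ s, p s (h s) := fun h => Finset.prod_nonneg fun s _ => hp s _
  have hprod1 : ∑ h : σ → H, ∏ s, p s (h s) = 1 := by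
    have h := Finset.prod_univ_sum (fun _ : σ => (Finset.univ : Finset H)) p
    rw [Fintype.piFinset_univ] at h
    rw [← h]
    exact Finset.prod_eq_one fun s _ => hp1 s
  set Ψ : (σ → H) → ℝ := fun h => ∑ s, (c * (m s (o s (h s)) / P s (o s (h s))) -
    if e s h ≠ y (h s) then 1 else 0) with hΨ
  -- With the message frozen to `k`, the guesses depend on the observations alone. Given these, the
  -- coordinates are independent and the exponential moment factors.
  have hfix : ∀ k : M, ∑ h : σ → H, (∏ s, p s (h s)) * Real.exp (∑ s, (c * (m s (o s (h s)) /
      P s (o s (h s))) - if d (fun s => o s (h s), k) s ≠ y (h s) then 1 else 0)) ≤ 1 := by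
    intro k
    rw [← Finset.sum_fiberwise_of_maps_to (s := Finset.univ)
      (t := Fintype.piFinset fun s => Finset.univ.image (o s)) (g := fun h s => o s (h s))
      (fun h _ => Fintype.mem_piFinset.2 fun s => Finset.mem_image_of_mem _ (Finset.mem_univ _))]
    have h1 : ∀ a ∈ Fintype.piFinset fun s => Finset.univ.image (o s),
        ∑ h : σ → H with (fun s => o s (h s)) = a, (∏ s, p s (h s)) *
          Real.exp (∑ s, (c * (m s (o s (h s)) / P s (o s (h s))) -
            if d (fun s => o s (h s), k) s ≠ y (h s) then 1 else 0)) ≤ ∏ s, P s (a s) := by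
      intro a _
      have hset : (Finset.univ.filter fun h : σ → H => (fun s => o s (h s)) = a) =
          Fintype.piFinset fun s => Finset.univ.filter fun h => o s h = a s := by
        ext h; simp [funext_iff]
      have h2 : ∀ h ∈ Finset.univ.filter fun h : σ → H => (fun s => o s (h s)) = a,
          (∏ s, p s (h s)) * Real.exp (∑ s, (c * (m s (o s (h s)) / P s (o s (h s))) -
            if d (fun s => o s (h s), k) s ≠ y (h s) then 1 else 0)) =
          ∏ s, p s (h s) * Real.exp (c * (m s (a s) / P s (a s)) -
            if d (a, k) s ≠ y (h s) then 1 else 0) := by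
        intro h hh
        have hh := (Finset.mem_filter.1 hh).2
        have hh' : ∀ s, o s (h s) = a s := fun s => congrFun hh s
        rw [Real.exp_sum, ← Finset.prod_mul_distrib, hh]
        simp only [hh']
      rw [Finset.sum_congr rfl h2, hset, ← Finset.prod_univ_sum
        (fun s => Finset.univ.filter fun h => o s h = a s)
        (fun s h => p s h * Real.exp (c * (m s (a s) / P s (a s)) -
            if d (a, k) s ≠ y h then 1 else 0))]
      exact Finset.prod_le_prod (fun s _ => Finset.sum_nonneg fun h _ =>
        mul_nonneg (hp s h) (Real.exp_pos _).le) fun s _ => sum_exp_guess_le (hp s) y (o s) (a s) _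
    refine (Finset.sum_le_sum h1).trans (le_of_eq ?_)
    rw [← Finset.prod_univ_sum]
    refine Finset.prod_eq_one fun s _ => ?_
    rw [← hp1 s]
    exact Finset.sum_fiberwise_of_maps_to
      (fun h _ => Finset.mem_image_of_mem (o s) (Finset.mem_univ h)) _
  -- The actual message is one of the `k`; the weights `w`, of sum at most one, pay for the union
  -- over all of them.
  have hexp : ∑ h : σ → H, (∏ s, p s (h s)) * Real.exp (Ψ h + Real.log (w (μ h))) ≤ 1 := by
    calc _ = ∑ h : σ → H, w (μ h) * ((∏ s, p s (h s)) * Real.exp (∑ s, (c * (m s (o s (h s)) /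
      P s (o s (h s))) - if d (fun s => o s (h s), μ h) s ≠ y (h s) then 1 else 0))) := by
          refine Finset.sum_congr rfl fun h _ => ?_
          rw [Real.exp_add, Real.exp_log (hw _)]
          simp only [hΨ, hd]
          ring
      _ ≤ ∑ h : σ → H, ∑ k ∈ Finset.univ.image μ, w k * ((∏ s, p s (h s)) *
          Real.exp (∑ s, (c * (m s (o s (h s)) / P s (o s (h s))) -
            if d (fun s => o s (h s), k) s ≠ y (h s) then 1 else 0))) := by
          refine Finset.sum_le_sum fun h _ => ?_
          exact Finset.single_le_sum (f := fun k => w k * ((∏ s, p s (h s)) *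
            Real.exp (∑ s, (c * (m s (o s (h s)) / P s (o s (h s))) -
              if d (fun s => o s (h s), k) s ≠ y (h s) then 1 else 0))))
            (fun k _ => mul_nonneg (hw k).le (mul_nonneg (hprod0 h) (Real.exp_pos _).le))
            (Finset.mem_image_of_mem μ (Finset.mem_univ h))
      _ = ∑ k ∈ Finset.univ.image μ, w k * ∑ h : σ → H, (∏ s, p s (h s)) *
          Real.exp (∑ s, (c * (m s (o s (h s)) / P s (o s (h s))) -
            if d (fun s => o s (h s), k) s ≠ y (h s) then 1 else 0)) := by
          rw [Finset.sum_comm]; simp only [Finset.mul_sum]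
      _ ≤ ∑ k ∈ Finset.univ.image μ, w k * 1 :=
          Finset.sum_le_sum fun k _ => mul_le_mul_of_nonneg_left (hfix k) (hw k).le
      _ ≤ 1 := by simpa using hw1 _
  -- Jensen's inequality, through `x + 1 ≤ exp x`.
  have hjens : ∑ h : σ → H, (∏ s, p s (h s)) * (Ψ h + Real.log (w (μ h))) ≤ 0 := by
    have : ∀ h : σ → H, (∏ s, p s (h s)) * (Ψ h + Real.log (w (μ h))) ≤
        (∏ s, p s (h s)) * Real.exp (Ψ h + Real.log (w (μ h))) - ∏ s, p s (h s) := by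
      intro h
      have := mul_le_mul_of_nonneg_left (Real.add_one_le_exp (Ψ h + Real.log (w (μ h)))) (hprod0 h)
      linarith
    refine (Finset.sum_le_sum fun h _ => this h).trans ?_
    rw [Finset.sum_sub_distrib, hprod1]
    linarith
  have hmean : ∑ h : σ → H, (∏ s, p s (h s)) * ∑ s, c * (m s (o s (h s)) / P s (o s (h s))) =
      c * ∑ s, bayesError (p s) y (o s) := by
    have h1 : ∀ s, ∑ h : σ → H, (∏ s, p s (h s)) * (c * (m s (o s (h s)) / P s (o s (h s)))) =
        c * bayesError (p s) y (o s) := by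
      intro s
      have h2 : ∀ h : σ → H, (∏ s, p s (h s)) * (c * (m s (o s (h s)) / P s (o s (h s)))) =
          ∏ t, p t (h t) * if t = s then c * (m t (o t (h t)) / P t (o t (h t))) else 1 := by
        intro h
        rw [Finset.prod_mul_distrib, Finset.prod_ite_eq' Finset.univ s]
        simp
      simp only [h2]
      have h3 := Finset.prod_univ_sum (fun _ : σ => (Finset.univ : Finset H))
        (fun t h => p t h * if t = s then c * (m t (o t h) / P t (o t h)) else 1)
      rw [Fintype.piFinset_univ] at h3
      rw [← h3, Finset.prod_eq_single s]
      · simp only [if_true]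
        rw [← Finset.sum_fiberwise_of_maps_to (t := Finset.univ.image (o s)) (g := o s)
          (fun h _ => Finset.mem_image_of_mem _ (Finset.mem_univ _)), bayesError, Finset.mul_sum]
        refine Finset.sum_congr rfl fun a _ => ?_
        have h4 : ∀ h ∈ Finset.univ.filter (fun h => o s h = a),
            p s h * (c * (m s (o s h) / P s (o s h))) = p s h * (c * (m s a / P s a)) :=
          fun h hh => by rw [(Finset.mem_filter.1 hh).2]
        rw [Finset.sum_congr rfl h4, ← Finset.sum_mul]
        change P s a * _ = c * m s a
        have hm0 : 0 ≤ m s a := le_min (jointProb_nonneg (hp s) _ _ _ _)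
          (jointProb_nonneg (hp s) _ _ _ _)
        have hP0 : 0 ≤ P s a := Finset.sum_nonneg fun h _ => hp s h
        rcases hP0.eq_or_lt with h0 | h0
        · have hmP : m s a ≤ P s a := by
            refine (min_le_left _ _).trans ?_
            simp only [jointProb, hP, Finset.sum_filter]
            refine Finset.sum_le_sum fun h _ => ?_
            by_cases h1 : o s h = a <;> by_cases h2 : y h = true <;> simp [h1, h2, hp s h]
          have : m s a = 0 := by linarith
          rw [← h0, this]; simp
        · field_simp
      · intro t _ ht
        simp only [ht, if_false, mul_one, hp1]
      · simp
    simp only [Finset.mul_sum] at h1 ⊢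
    rw [Finset.sum_comm]
    exact Finset.sum_congr rfl fun s _ => h1 s
  have hsplit : ∑ h : σ → H, (∏ s, p s (h s)) * (Ψ h + Real.log (w (μ h))) =
      c * ∑ s, bayesError (p s) y (o s) - ∑ h : σ → H, (∏ s, p s (h s)) *
        ((∑ s, if e s h ≠ y (h s) then 1 else 0) - Real.log (w (μ h))) := by
    rw [← hmean, ← Finset.sum_sub_distrib]
    refine Finset.sum_congr rfl fun h _ => ?_
    simp only [hΨ, Finset.sum_sub_distrib]
    ring
  linarith

end Hidden

/-! ### Product laws and random sets. -/

section Products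

variable {ι A B : Type*} [Fintype ι] [DecidableEq ι] [Fintype A] [Fintype B] [DecidableEq B]

theorem sum_pi_prod_eq_one {p : ι → A → ℝ} (hp : ∀ i, ∑ a, p i a = 1) :
    ∑ z : ι → A, ∏ i, p i (z i) = 1 := by
  rw [sum_pi_prod]; exact Finset.prod_eq_one fun i _ => hp i

theorem sum_pi_prod_mul {p : ι → A → ℝ} (hp : ∀ i, ∑ a, p i a = 1) (i₀ : ι) (F : A → ℝ) :
    ∑ z : ι → A, (∏ i, p i (z i)) * F (z i₀) = ∑ a, p i₀ a * F a := by
  have h : ∀ z : ι → A, (∏ i, p i (z i)) * F (z i₀) =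
      ∏ i, p i (z i) * if i = i₀ then F (z i) else 1 := by
    intro z
    rw [Finset.prod_mul_distrib, Finset.prod_ite_eq' Finset.univ i₀]; simp
  simp only [h]
  rw [sum_pi_prod (fun i a => p i a * if i = i₀ then F a else 1), Finset.prod_eq_single i₀]
  · simp
  · intro i _ hi; simp [hi, hp]
  · simp

theorem sum_pi_prod_map (p : ι → A → ℝ) (f : ι → A → B) (F : (ι → B) → ℝ) :
    ∑ z : ι → A, (∏ i, p i (z i)) * F (fun i => f i (z i)) =
      ∑ v : ι → B, (∏ i, ∑ a, if f i a = v i then p i a else 0) * F v := by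
  classical
  rw [← Finset.sum_fiberwise_of_maps_to (s := Finset.univ) (t := (Finset.univ : Finset (ι → B)))
    (g := fun z i => f i (z i)) (fun z _ => Finset.mem_univ _)]
  refine Finset.sum_congr rfl fun v _ => ?_
  rw [← sum_pi_prod (fun i a => if f i a = v i then p i a else 0), Finset.sum_mul,
    Finset.sum_filter]
  refine Finset.sum_congr rfl fun z _ => ?_
  split_ifs with h
  · have h' : ∀ i, f i (z i) = v i := fun i => congrFun h i
    simp only [h', if_true]
  · obtain ⟨i, hi⟩ := Function.ne_iff.1 h
    rw [Finset.prod_eq_zero (Finset.mem_univ i), zero_mul]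
    exact if_neg hi

theorem sum_set_prod (f g : ι → ℝ) :
    ∑ S : Finset ι, ∏ x, (if x ∈ S then f x else g x) = ∏ x, (f x + g x) := by
  rw [Finset.prod_add, Finset.powerset_univ]
  refine Finset.sum_congr rfl fun S _ => ?_
  rw [Finset.prod_ite]
  congr 2 <;> ext x <;> simp

/-- The law of a random set that contains each `x` independently with probability `θ x`. -/
noncomputable def setLaw (θ : ι → ℝ) (S : Finset ι) : ℝ := ∏ x, if x ∈ S then θ x else 1 - θ x

theorem setLaw_nonneg {θ : ι → ℝ} (h0 : ∀ x, 0 ≤ θ x) (h1 : ∀ x, θ x ≤ 1) (S : Finset ι) :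
    0 ≤ setLaw θ S := Finset.prod_nonneg fun x _ => by
  split_ifs; exacts [h0 x, sub_nonneg.2 (h1 x)]

theorem sum_setLaw (θ : ι → ℝ) : ∑ S, setLaw θ S = 1 := by
  unfold setLaw
  rw [sum_set_prod]
  exact Finset.prod_eq_one fun x _ => by ring

theorem sum_setLaw_ite (θ : ι → ℝ) (x₀ : ι) (a b : ℝ) :
    ∑ S, setLaw θ S * (if x₀ ∈ S then a else b) = θ x₀ * a + (1 - θ x₀) * b := by
  have h : ∀ S : Finset ι, setLaw θ S * (if x₀ ∈ S then a else b) =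
      ∏ x, if x ∈ S then θ x * (if x = x₀ then a else 1) else
        (1 - θ x) * (if x = x₀ then b else 1) := by
    intro S
    have h1 : (if x₀ ∈ S then a else b) =
        ∏ x, if x = x₀ then (if x ∈ S then a else b) else 1 := by
      rw [Finset.prod_ite_eq' Finset.univ x₀]; simp
    rw [setLaw, h1, ← Finset.prod_mul_distrib]
    refine Finset.prod_congr rfl fun x _ => ?_
    split_ifs <;> rfl
  simp only [h]
  rw [sum_set_prod, Finset.prod_eq_single x₀]
  · simp
  · intro x _ hx; simp [hx]
  · simp

theorem setLaw_const {q : ℝ} (hq : q < 1) (S : Finset ι) :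
    setLaw (fun _ => q) S = oddsLaw (q / (1 - q)) ∅ S := by
  have h1 : 1 - q ≠ 0 := by linarith
  rw [setLaw, Finset.prod_ite, Finset.prod_const, Finset.prod_const, oddsLaw,
    if_pos (Finset.disjoint_empty_left S)]
  have e1 : (Finset.univ.filter fun x => x ∈ S) = S := by ext x; simp
  have e2 : (Finset.univ.filter fun x => x ∉ S) = Sᶜ := by ext x; simp
  have e3 : 1 + q / (1 - q) = (1 - q)⁻¹ := by field_simp; ring
  rw [e1, e2, e3, Finset.compl_empty, Finset.card_univ, ← Finset.card_add_card_compl S, pow_add,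
    div_pow, inv_pow, inv_pow]
  field_simp

theorem prod_mem_pow (T : Finset ι) (a : ℝ) : ∏ x, (if x ∈ T then a else 1) = a ^ #T := by
  rw [Finset.prod_ite_mem, Finset.univ_inter, Finset.prod_const]

end Products

/-! ### Roles of the columns and the channel of a key set. -/

section Roles

/-- The columns of the grid, in two halves. -/
abbrev Column (u : ℕ) := Bool × Fin u

/-- The possible roles of a column: a line and a side. -/
abbrev Role (N : ℕ) := Fin (N + 1) × Bool

variable {N u : ℕ}

/-- The law of the role of a column. -/
noncomputable def roleWeight (φ : ℝ) (l : Fin (N + 1)) (r : Role N) : ℝ :=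
  (if r.1 = l then φ else 1) / (2 * (N + φ))

/-- The probability that a column belongs to the `i`-th key set, given its role. -/
noncomputable def memProb (q φ : ℝ) (l : Fin (N + 1)) (i : Fin N) (b η : Bool) (r : Role N) : ℝ :=
  -- The factor `N + φ` undoes the probability of the line, so a column is in the set with
  -- probability `(1 - φ) * q` through the own line of the key and `φ * q` through `l`, in all `q`
  -- for either value of the bit. The factor `2` makes up for the single admissible side of `l`.
  if r.1 = l.succAbove i then (1 - φ) * (q * (N + φ)) else
    if r = (l, b ^^ η) then 2 * (q * (N + φ)) else 0

/-- The conditions on the density `q` of the random sets and on the rate `φ`. -/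
structure Admissible (N : ℕ) (q φ : ℝ) : Prop where
  one_le : 1 ≤ N
  q_pos : 0 < q
  φ_pos : 0 < φ
  φ_le : φ ≤ 1
  small : 2 * (q * (N + φ)) ≤ 1

namespace Admissible

variable {q φ : ℝ} (h : Admissible N q φ)
include h

theorem one_le_cast : (1 : ℝ) ≤ N := by exact_mod_cast h.one_le

theorem den_pos : 0 < (N : ℝ) + φ := by have := h.one_le_cast; have := h.φ_pos; linarith

theorem q_le : q ≤ 1 / 2 := by
  have := h.one_le_cast; have := h.φ_pos; have := h.q_pos; have := h.small; nlinarith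

theorem roleWeight_pos (l : Fin (N + 1)) (r : Role N) : 0 < roleWeight φ l r := by
  have := h.den_pos
  have := h.φ_pos
  unfold roleWeight; split_ifs <;> positivity

theorem memProb_nonneg (l : Fin (N + 1)) (i : Fin N) (b η : Bool) (r : Role N) :
    0 ≤ memProb q φ l i b η r := by
  have := h.den_pos
  have := h.q_pos
  have : 0 ≤ 1 - φ := sub_nonneg.2 h.φ_le
  unfold memProb; split_ifs <;> positivity

theorem memProb_le (l : Fin (N + 1)) (i : Fin N) (b η : Bool) (r : Role N) :
    memProb q φ l i b η r ≤ 1 := by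
  have h1 := h.small
  have h2 : 0 ≤ q * (N + φ) := (mul_pos h.q_pos h.den_pos).le
  have h3 := h.φ_pos
  unfold memProb; split_ifs
  · nlinarith
  · exact h1
  · norm_num

theorem sum_line (l : Fin (N + 1)) (f : Role N → ℝ) :
    ∑ r, roleWeight φ l r * f r = (φ / (2 * (N + φ))) * (f (l, true) + f (l, false)) +
      ∑ i : Fin N, 1 / (2 * (N + φ)) * (f (l.succAbove i, true) + f (l.succAbove i, false)) := by
  rw [Fintype.sum_prod_type, Fin.sum_univ_succAbove _ l]
  simp only [Fintype.sum_bool, roleWeight, if_true, Fin.succAbove_ne, if_false]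
  congr 1
  · ring
  · exact Finset.sum_congr rfl fun i _ => by ring

theorem sum_roleWeight (l : Fin (N + 1)) : ∑ r, roleWeight φ l r = 1 := by
  have h1 := h.sum_line l fun _ => 1
  simp only [mul_one, Finset.sum_const, Finset.card_univ, Fintype.card_fin, nsmul_eq_mul] at h1
  rw [h1]
  have := h.den_pos
  field_simp
  ring

theorem sum_roleWeight_key (l : Fin (N + 1)) (i : Fin N) :
    ∑ r : Role N, roleWeight φ l r * (if r.1 = l.succAbove i then (1 - φ) * (q * (N + φ)) else 0) =
      (1 - φ) * q := by
  rw [h.sum_line l, Finset.sum_eq_single i]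
  · simp only [if_true, (Fin.succAbove_ne l i).symm, if_false]
    have := h.den_pos
    field_simp
    ring
  · intro j _ hj
    simp [hj]
  · simp

theorem sum_roleWeight_line (l : Fin (N + 1)) (b : Bool) :
    ∑ r : Role N, roleWeight φ l r * (if r = (l, b) then 2 * (q * (N + φ)) else 0) = φ * q := by
  simp only [mul_ite, mul_zero, Finset.sum_ite_eq', Finset.mem_univ, if_true, roleWeight]
  have := h.den_pos
  field_simp

theorem memProb_eq (l : Fin (N + 1)) (i : Fin N) (b η : Bool) (r : Role N) :
    memProb q φ l i b η r = (if r.1 = l.succAbove i then (1 - φ) * (q * (N + φ)) else 0) +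
      (if r = (l, b ^^ η) then 2 * (q * (N + φ)) else 0) := by
  unfold memProb
  by_cases h1 : r.1 = l.succAbove i
  · have : r ≠ (l, b ^^ η) := by
      rintro rfl
      exact Fin.succAbove_ne l i h1.symm
    simp [h1, this]
  · simp [h1]

theorem sum_memProb (l : Fin (N + 1)) (i : Fin N) (b η : Bool) :
    ∑ r, roleWeight φ l r * memProb q φ l i b η r = q := by
  have h1 : ∀ r, roleWeight φ l r * memProb q φ l i b η r = roleWeight φ l r *
      (if r.1 = l.succAbove i then (1 - φ) * (q * (N + φ)) else 0) +
      roleWeight φ l r * (if r = (l, b ^^ η) then 2 * (q * (N + φ)) else 0) := fun r => by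
    rw [h.memProb_eq, mul_add]
  simp only [h1, Finset.sum_add_distrib]
  rw [h.sum_roleWeight_key, h.sum_roleWeight_line]; ring

theorem sum_plain (l : Fin (N + 1)) (i : Fin N) :
    ∑ r : Role N, roleWeight φ l r * (if r.1 = l.succAbove i then q * (N + φ) else 0) = q := by
  rw [h.sum_line l, Finset.sum_eq_single i]
  · simp only [if_true, (Fin.succAbove_ne l i).symm, if_false]
    have := h.den_pos
    field_simp
    ring
  · intro j _ hj
    simp [hj]
  · simp

/-- The channel through which the roles of the columns tell something about a key set. -/
noncomputable def channel (l : Fin (N + 1)) (i : Fin N) : Channel (Column u) (Role N) where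
  rev _ r := if r.1 = l.succAbove i then 1 / 2 else 0
  mem b x r := if r = (l, b ^^ x.1) then 1 else 0
  -- By Bayes' formula, this is the law of the role given that the column is not in the set, an
  -- event of probability `1 - q`.
  non b x r := roleWeight φ l r * (1 - memProb q φ l i b x.1 r) / (1 - q)
  rev_nonneg _ _ := by split_ifs <;> norm_num
  mem_nonneg _ _ _ := by split_ifs <;> norm_num
  non_nonneg b x r := by
    have := h.q_le
    have := h.memProb_le l i b x.1 r
    exact div_nonneg (mul_nonneg (h.roleWeight_pos l r).le (by linarith)) (by linarith)

theorem sum_rev (l : Fin (N + 1)) (i : Fin N) (x : Column u) :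
    ∑ r, (h.channel l i).rev x r = 1 := by
  simp only [channel]
  rw [Fintype.sum_prod_type, Finset.sum_eq_single (l.succAbove i)] <;> simp +contextual

theorem sum_mem (l : Fin (N + 1)) (i : Fin N) (b : Bool) (x : Column u) :
    ∑ r, (h.channel l i).mem b x r = 1 := by
  simp [channel]

theorem sum_non (l : Fin (N + 1)) (i : Fin N) (b : Bool) (x : Column u) :
    ∑ r, (h.channel l i).non b x r = 1 := by
  have h1 := h.q_le
  have h2 : 1 - q ≠ 0 := by linarith
  simp only [channel]
  rw [← Finset.sum_div]
  simp only [mul_sub, mul_one, Finset.sum_sub_distrib]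
  rw [h.sum_roleWeight, h.sum_memProb, div_self h2]

/-- The law of the role of a nonmember, averaged over the hidden bit. -/
noncomputable def refLaw (l : Fin (N + 1)) (i : Fin N) (x : Column u) (r : Role N) : ℝ :=
  1 / 2 * ((h.channel (u := u) l i).non true x r + (h.channel (u := u) l i).non false x r)

theorem refLaw_line (l : Fin (N + 1)) (i : Fin N) (x : Column u) (β : Bool) :
    h.refLaw l i x (l, β) = φ / (2 * (N + φ)) * (1 - q * (N + φ)) / (1 - q) := by
  unfold refLaw channel memProb
  simp only [roleWeight, (Fin.succAbove_ne l i).symm, if_true, if_false]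
  cases hβ : β <;> cases hx : x.1 <;> simp <;> ring

theorem non_line (l : Fin (N + 1)) (i : Fin N) (b : Bool) (x : Column u) (β : Bool) :
    (h.channel (u := u) l i).non b x (l, β) = φ / (2 * (N + φ)) *
      (1 - if β = (b ^^ x.1) then 2 * (q * (N + φ)) else 0) / (1 - q) := by
  unfold channel memProb
  simp only [roleWeight, (Fin.succAbove_ne l i).symm, if_true, if_false, Prod.mk.injEq, true_and]

/-- Off the line `l` the role of a nonmember carries no information about the bit, so only the two
roles on `l` contribute to the second moment excess. -/
theorem non_key (l : Fin (N + 1)) (i j : Fin N) (b : Bool) (x : Column u) (β : Bool) :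
    (h.channel (u := u) l i).non b x (l.succAbove j, β) = h.refLaw l i x (l.succAbove j, β) := by
  unfold refLaw channel memProb
  simp only [Prod.mk.injEq, Fin.succAbove_ne, false_and, if_false]
  ring

theorem refLaw_pos (l : Fin (N + 1)) (i : Fin N) (x : Column u) (r : Role N) :
    0 < h.refLaw l i x r := by
  have h1 := h.q_le
  have h2 := h.small
  have h3 := h.q_pos
  have h4 := h.den_pos
  have h5 := h.φ_pos
  obtain ⟨a, β⟩ := r
  rcases Fin.eq_self_or_eq_succAbove l a with rfl | ⟨j, rfl⟩
  · rw [h.refLaw_line]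
    have : 0 < 1 - q := by linarith
    have : 0 < 1 - q * (N + φ) := by linarith
    positivity
  · rw [← h.non_key l i j true]
    have h6 := h.roleWeight_pos l (l.succAbove j, β)
    have h7 : memProb q φ l i true x.1 (l.succAbove j, β) < 1 := by
      unfold memProb
      simp only [Prod.mk.injEq, Fin.succAbove_ne, false_and, if_false]
      have : 0 < q * (N + φ) := by positivity
      split_ifs <;> nlinarith
    unfold channel
    exact div_pos (mul_pos h6 (by linarith)) (by linarith)

theorem refLaw_line_ge (l : Fin (N + 1)) (i : Fin N) (x : Column u) (β : Bool) :
    φ / (4 * (N + 1)) ≤ h.refLaw l i x (l, β) := by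
  have h1 := h.q_le
  have h2 := h.small
  have h3 := h.q_pos
  have h4 := h.den_pos
  have h5 := h.φ_pos
  have h6 := h.φ_le
  have h7 := h.one_le_cast
  rw [h.refLaw_line, div_mul_eq_mul_div, div_div, div_le_div_iff₀ (by positivity)
    (mul_pos (by positivity) (by linarith))]
  have e : φ * (1 - q * (N + φ)) * (4 * (N + 1)) - φ * (2 * (N + φ) * (1 - q)) =
    2 * φ * ((1 - 2 * (q * (N + φ))) * (N + 1) + (N + 1) - (N + φ) + (N + φ) * q) := by ring
  have : 0 ≤ (1 - 2 * (q * (N + φ))) * (N + 1) := mul_nonneg (by linarith) (by linarith)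
  have : 0 ≤ (N + φ) * q := by positivity
  have : 0 ≤ 2 * φ * ((1 - 2 * (q * (N + φ))) * (N + 1) + (N + 1) - (N + φ) + (N + φ) * q) :=
    mul_nonneg (by linarith) (by linarith)
  linarith

/-- The channel of a key set satisfies the second moment conditions. -/
theorem spread_le_bayes (l : Fin (N + 1)) (i : Fin N) {φ₀ q' : ℝ} (hφ₀ : 0 < φ₀) (hφ : φ₀ ≤ φ)
    (hq' : 0 ≤ q') (T : Finset (Column u)) {g : Finset (Column u) → ℝ} (hg : ∀ W, 0 ≤ g W)
    (hs : ∀ G : Finset (Column u), G.Nonempty →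
      ∑ W, (if G ⊆ W then g W else 0) ≤ q' ^ #G * ∑ W, g W) :
    (∑ W, g W) / 4 - ∑ W, g W * ((1 + 4 * q ^ 2 * (N + 1)) ^ Fintype.card (Column u) *
      (1 + 4 * (N + 1) / φ₀ * q') ^ #W - 1) ≤ (h.channel l i).bayes T g := by
  have h1 := h.q_le
  have h2 := h.small
  have h3 := h.q_pos
  have h4 := h.den_pos
  have h5 := h.φ_pos
  have h6 := h.φ_le
  have h7 := h.one_le_cast
  have hq1 : 0 < 1 - q := by linarith
  refine (h.channel l i).spread_le_bayes (h.refLaw l i) (h.refLaw_pos l i) (fun x => ?_)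
    (h.sum_rev l i) (h.sum_mem l i) (h.sum_non l i) ?_ (by positivity) hq' (fun b x => ?_)
    (fun b x => ?_) (fun b x => ?_) T hg hs
  · simp only [refLaw]
    rw [← Finset.mul_sum, Finset.sum_add_distrib, h.sum_non, h.sum_non]; norm_num
  · rw [le_div_iff₀ hφ₀]; linarith
  · have h8 := h.refLaw_line_ge l i x (b ^^ x.1)
    have h9 := h.refLaw_pos l i x (l, b ^^ x.1)
    have : ∑ r, (h.channel l i).mem b x r * (h.channel l i).mem b x r / h.refLaw l i x r =
        1 / h.refLaw l i x (l, b ^^ x.1) := by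
      simp [channel, ite_div]
    rw [this, div_le_div_iff₀ h9 hφ₀, one_mul]
    calc φ₀ ≤ φ := hφ
      _ = 4 * (N + 1) * (φ / (4 * (N + 1))) := by field_simp
      _ ≤ _ := by gcongr
  -- Nonmembers are less likely than in the reference to take the role of the members, so the mixed
  -- terms cost nothing.
  · have h9 := h.refLaw_pos l i x (l, b ^^ x.1)
    have : ∑ r, (h.channel l i).mem b x r * (h.channel l i).non b x r / h.refLaw l i x r =
        (h.channel l i).non b x (l, b ^^ x.1) / h.refLaw l i x (l, b ^^ x.1) := by
      rw [Finset.sum_eq_single (l, b ^^ x.1)]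
      · simp [channel]
      · intro r _ hr; simp [channel, hr]
      · simp
    rw [this, div_le_one h9, h.non_line, h.refLaw_line, if_pos rfl]
    have h10 : 0 < q * (N + φ) := by positivity
    have h11 : 1 - 2 * (q * (N + φ)) ≤ 1 - q * (N + φ) := by linarith
    gcongr
  -- The excess over `1` is the χ² distance from `refLaw`. It comes from the line `l` alone and is
  -- quadratic in `q`, which allows for as many columns as there are.
  · have hid : ∀ r, (h.channel l i).non b x r * (h.channel l i).non b x r / h.refLaw l i x r =
        2 * (h.channel l i).non b x r - h.refLaw l i x r +
          ((h.channel l i).non b x r - h.refLaw l i x r) ^ 2 / h.refLaw l i x r := by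
      intro r
      have := (h.refLaw_pos l i x r).ne'
      field_simp
      ring
    simp only [hid, Finset.sum_add_distrib, Finset.sum_sub_distrib, ← Finset.mul_sum, h.sum_non]
    have hr : ∑ r, h.refLaw l i x r = 1 := by
      simp only [refLaw]
      rw [← Finset.mul_sum, Finset.sum_add_distrib, h.sum_non, h.sum_non]; norm_num
    rw [hr, Fintype.sum_prod_type, Fin.sum_univ_succAbove _ l]
    simp only [h.non_key, sub_self, zero_pow two_ne_zero, zero_div, Finset.sum_const_zero,
      add_zero, Fintype.sum_bool, h.non_line, h.refLaw_line]
    have hqc : 0 < 1 - q * (N + φ) := by linarith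
    set D := φ / (2 * (N + φ)) * (1 - q * (N + φ)) / (1 - q) with hD
    have hDpos : 0 < D := by positivity
    have hsq : ∀ β : Bool, (φ / (2 * (N + φ)) *
        (1 - if β = (b ^^ x.1) then 2 * (q * (N + φ)) else 0) / (1 - q) - D) ^ 2 / D =
        φ * q ^ 2 * (N + φ) / (2 * (1 - q) * (1 - q * (N + φ))) := by
      intro β
      have : (φ / (2 * (N + φ)) *
        (1 - if β = (b ^^ x.1) then 2 * (q * (N + φ)) else 0) / (1 - q) - D) ^ 2 =
          (φ * q / (2 * (1 - q))) ^ 2 := by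
        rw [hD]
        split_ifs <;> field_simp <;> ring
      rw [this, hD]
      field_simp
      try ring
    rw [hsq, hsq]
    have h8 : φ * q ^ 2 * (N + φ) / (2 * (1 - q) * (1 - q * (N + φ))) ≤
        2 * q ^ 2 * (N + 1) := by
      rw [div_le_iff₀ (by positivity)]
      have e1 : 1 ≤ 4 * ((1 - q) * (1 - q * (N + φ))) := by nlinarith
      have e2 : φ * q ^ 2 * (N + φ) ≤ 1 * q ^ 2 * (N + 1) := by gcongr
      have e3 : 0 ≤ q ^ 2 * (N + 1) := by positivity
      nlinarith
    linarith

end Admissible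

end Roles

theorem prob_ne_zero_of_setLaw {ι : Type*} [Fintype ι] [DecidableEq ι] {θ : ι → ℝ} {S : Finset ι}
    (h : setLaw θ S ≠ 0) {x : ι} (hx : x ∈ S) : θ x ≠ 0 := by
  have := Finset.prod_ne_zero_iff.1 h x (Finset.mem_univ x)
  rwa [if_pos hx] at this

/-! ### Joint law of the roles and the key sets. -/

section Link

variable {N u : ℕ}

/-- The members of a set whose role is the line of the `i`-th key. -/
def keyPart (l : Fin (N + 1)) (i : Fin N) (c : Column u → Role N) (S : Finset (Column u)) :
    Finset (Column u) := S.filter fun x => (c x).1 = l.succAbove i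

/-- The members of a set whose role is the line of the keys, on the side given by the hidden
bit. -/
def linePart (l : Fin (N + 1)) (c : Column u → Role N) (b : Bool) (S : Finset (Column u)) :
    Finset (Column u) := S.filter fun x => c x = (l, b ^^ x.1)

/-- The law of the `i`-th hidden bit and the `i`-th key set, given the roles of the columns. -/
noncomputable def hiddenWeight (q φ : ℝ) (l : Fin (N + 1)) (i : Fin N) (c : Column u → Role N)
    (h : Bool × Finset (Column u)) : ℝ :=
  1 / 2 * setLaw (fun x => memProb q φ l i h.1 x.1 (c x)) h.2

namespace Admissible

variable {q φ : ℝ} (h : Admissible N q φ)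
include h

theorem hiddenWeight_nonneg (l : Fin (N + 1)) (i : Fin N) (c : Column u → Role N)
    (k : Bool × Finset (Column u)) : 0 ≤ hiddenWeight q φ l i c k :=
  mul_nonneg (by norm_num) (setLaw_nonneg (fun _ => h.memProb_nonneg _ _ _ _ _)
    (fun _ => h.memProb_le _ _ _ _ _) _)

theorem sum_hiddenWeight (l : Fin (N + 1)) (i : Fin N) (c : Column u → Role N) :
    ∑ k, hiddenWeight q φ l i c k = 1 := by
  rw [Fintype.sum_prod_type]
  simp only [hiddenWeight, ← Finset.mul_sum, sum_setLaw]
  norm_num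

theorem setLaw_nonneg_const (S : Finset (Column u)) : 0 ≤ setLaw (fun _ => q) S :=
  setLaw_nonneg (fun _ => h.q_pos.le) (fun _ => by have := h.q_le; linarith) S

/-- Bayes' formula, column by column. Both sides vanish unless `T` lies on the own line of the key
and `W` lies on `l`, on the side given by the bit; otherwise they are products over the columns with
equal factors. -/
theorem roles_mul_setLaw (l : Fin (N + 1)) (i : Fin N) (b : Bool) (c : Column u → Role N)
    {T W : Finset (Column u)} (hd : Disjoint T W)
    (F : Finset (Column u) → Finset (Column u) → ℝ) :
    (∏ x, roleWeight φ l (c x)) * (setLaw (fun x => memProb q φ l i b x.1 (c x)) (W ∪ T) *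
      (if keyPart l i c (W ∪ T) = T then F T (linePart l c b (W ∪ T)) else 0)) =
    setLaw (fun _ => q) (W ∪ T) * (1 - φ) ^ #T * φ ^ #W * (h.channel l i).ker T W b c * F T W := by
  have hdis : ∀ x ∈ W, x ∉ T := fun x hx hxT => Finset.disjoint_left.1 hd hxT hx
  by_cases hT : ∀ x ∈ T, (c x).1 = l.succAbove i
  swap
  · push Not at hT
    obtain ⟨x, hx, hxc⟩ := hT
    have h1 : keyPart l i c (W ∪ T) ≠ T := by
      intro h1
      rw [← h1] at hx
      exact hxc (Finset.mem_filter.1 hx).2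
    have h2 : (h.channel l i).ker T W b c = 0 := by
      refine Finset.prod_eq_zero (Finset.mem_univ x) ?_
      simp [Channel.coord, hx, channel, hxc]
    rw [if_neg h1, h2]; ring
  by_cases hW : ∀ x ∈ W, c x = (l, b ^^ x.1)
  swap
  · push Not at hW
    obtain ⟨x, hx, hxc⟩ := hW
    have h2 : (h.channel l i).ker T W b c = 0 := by
      refine Finset.prod_eq_zero (Finset.mem_univ x) ?_
      simp [Channel.coord, hx, hdis x hx, channel, hxc]
    rw [h2]
    simp only [mul_zero, zero_mul, mul_eq_zero]
    right
    by_cases hk : (c x).1 = l.succAbove i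
    · right
      rw [if_neg]
      intro h1
      refine hdis x hx ?_
      rw [← h1]
      exact Finset.mem_filter.2 ⟨Finset.mem_union_left _ hx, hk⟩
    · left
      by_contra h0
      refine prob_ne_zero_of_setLaw h0 (Finset.mem_union_left T hx) ?_
      simp [memProb, hk, hxc]
  have h1 : keyPart l i c (W ∪ T) = T := by
    ext x
    simp only [keyPart, Finset.mem_filter, Finset.mem_union]
    refine ⟨fun hx => hx.1.resolve_left fun hxW => ?_, fun hx => ⟨Or.inr hx, hT x hx⟩⟩
    rw [hW x hxW] at hx
    exact Fin.succAbove_ne l i hx.2.symm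
  have h2 : linePart l c b (W ∪ T) = W := by
    ext x
    simp only [linePart, Finset.mem_filter, Finset.mem_union]
    refine ⟨fun hx => hx.1.resolve_right fun hxT => ?_, fun hx => ⟨Or.inl hx, hW x hx⟩⟩
    have := hT x hxT
    rw [hx.2] at this
    exact Fin.succAbove_ne l i this.symm
  rw [if_pos h1, h2, ← mul_assoc]
  congr 1
  rw [← prod_mem_pow T, ← prod_mem_pow W, setLaw, setLaw, Channel.ker, ← Finset.prod_mul_distrib,
    ← Finset.prod_mul_distrib, ← Finset.prod_mul_distrib, ← Finset.prod_mul_distrib]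
  refine Finset.prod_congr rfl fun x _ => ?_
  have hden := h.den_pos
  have hq := h.q_le
  by_cases hxT : x ∈ T
  · have hxW : x ∉ W := fun hxW => hdis x hxW hxT
    have h3 := hT x hxT
    simp only [Channel.coord, channel, hxT, hxW, or_true, Finset.mem_union, if_true, if_false, memProb,
      h3, roleWeight, Fin.succAbove_ne]
    field_simp
  · by_cases hxW : x ∈ W
    · have h3 := hW x hxW
      simp only [Channel.coord, channel, hxT, hxW, true_or, Finset.mem_union, if_true, if_false,
        memProb, h3, roleWeight, (Fin.succAbove_ne l i).symm]
      field_simp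
    · have : 1 - q ≠ 0 := by linarith
      simp only [Channel.coord, channel, hxT, hxW, or_self, Finset.mem_union, if_false]
      field_simp

/-- The joint law of the roles of the columns and the two parts of a key set. -/
theorem roles_mul_sum (l : Fin (N + 1)) (i : Fin N) (b : Bool) (c : Column u → Role N)
    (F : Finset (Column u) → Finset (Column u) → ℝ) :
    (∏ x, roleWeight φ l (c x)) * ∑ S, setLaw (fun x => memProb q φ l i b x.1 (c x)) S *
      F (keyPart l i c S) (linePart l c b S) =
    ∑ T, ∑ W, thin φ (setLaw fun _ => q) T W * (h.channel l i).ker T W b c * F T W := by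
  have h1 := sum_disjoint_pairs (ι := Column u) (fun T W => setLaw (fun _ => q) (W ∪ T) *
    (1 - φ) ^ #T * φ ^ #W * (h.channel l i).ker T W b c * F T W)
  simp only [thin, ite_mul, zero_mul]
  rw [h1, Finset.mul_sum]
  refine Finset.sum_congr rfl fun Z _ => ?_
  have h2 : ∀ X ∈ Z.powerset, setLaw (fun _ => q) (Z \ X ∪ X) * (1 - φ) ^ #X * φ ^ #(Z \ X) *
      (h.channel l i).ker X (Z \ X) b c * F X (Z \ X) = if keyPart l i c Z = X then
        (∏ x, roleWeight φ l (c x)) * (setLaw (fun x => memProb q φ l i b x.1 (c x)) Z *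
          F (keyPart l i c Z) (linePart l c b Z)) else 0 := by
    intro X hX
    have hX := Finset.mem_powerset.1 hX
    rw [← h.roles_mul_setLaw l i b c Finset.disjoint_sdiff F, Finset.sdiff_union_of_subset hX]
    split_ifs with h3
    · rw [h3]
    · ring
  rw [Finset.sum_congr rfl h2, Finset.sum_ite_eq, if_pos]
  exact Finset.mem_powerset.2 (Finset.filter_subset _ _)

/-- What the referee learns at least about the `i`-th hidden bit and key set: everything if the
set is degenerate, and otherwise the part on the line of the key, and a message about the set. -/
def observe {M : Type*} (flag : Finset (Column u) → Finset (Column u) → Prop)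
    [∀ T W, Decidable (flag T W)] (msg : Finset (Column u) → M) (l : Fin (N + 1)) (i : Fin N)
    (c : Column u → Role N) (k : Bool × Finset (Column u)) :
    (Finset (Column u) × M) ⊕ (Bool × Finset (Column u)) :=
  if flag (keyPart l i c k.2) (linePart l c k.1 k.2) then Sum.inr k else
    Sum.inl (keyPart l i c k.2, msg (linePart l c k.1 k.2 ∪ keyPart l i c k.2))

omit h in
theorem observe_eq_inl {M : Type*} (flag : Finset (Column u) → Finset (Column u) → Prop)
    [∀ T W, Decidable (flag T W)] (msg : Finset (Column u) → M) (l : Fin (N + 1)) (i : Fin N)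
    (c : Column u → Role N) (k : Bool × Finset (Column u)) (T : Finset (Column u)) (m : M) :
    observe flag msg l i c k = Sum.inl (T, m) ↔
      ¬ flag (keyPart l i c k.2) (linePart l c k.1 k.2) ∧ keyPart l i c k.2 = T ∧
        msg (linePart l c k.1 k.2 ∪ keyPart l i c k.2) = m := by
  unfold observe
  split_ifs with h1 <;> simp [h1]

variable {M : Type*} [DecidableEq M]

/-- The average Bayes error of the observation of a key set is at least the thinned Bayes error of
the channel, up to the probability of degenerate sets. -/
theorem sum_thinBayes_le (flag : Finset (Column u) → Finset (Column u) → Prop)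
    [∀ T W, Decidable (flag T W)] (msg : Finset (Column u) → M) (l : Fin (N + 1)) (i : Fin N) :
    ∑ m ∈ Finset.univ.image msg, (h.channel l i).thinBayes φ ∅
        (fun S => if msg S = m then setLaw (fun _ => q) S else 0) -
      ∑ c : Column u → Role N, (∏ x, roleWeight φ l (c x)) * ∑ k, hiddenWeight q φ l i c k *
        (if flag (keyPart l i c k.2) (linePart l c k.1 k.2) then 1 else 0) ≤
      ∑ c : Column u → Role N, (∏ x, roleWeight φ l (c x)) *
        bayesError (hiddenWeight q φ l i c) Prod.fst (observe flag msg l i c) := by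
  classical
  set good : Finset (Column u) → M → Bool → (Column u → Role N) → Finset (Column u) → ℝ :=
    fun T m b c S => if keyPart l i c S = T ∧ msg (linePart l c b S ∪ keyPart l i c S) = m
      then 1 else 0 with hgood
  set fl : Bool → (Column u → Role N) → Finset (Column u) → ℝ := fun b c S =>
    if flag (keyPart l i c S) (linePart l c b S) then 1 else 0 with hfl
  set μ : Bool → (Column u → Role N) → Finset (Column u) → ℝ := fun b c S =>
    setLaw (fun x => memProb q φ l i b x.1 (c x)) S with hμ
  have hμ0 : ∀ b c S, 0 ≤ μ b c S := fun b c S => setLaw_nonneg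
    (fun _ => h.memProb_nonneg _ _ _ _ _) (fun _ => h.memProb_le _ _ _ _ _) _
  have hfl0 : ∀ b c S, 0 ≤ fl b c S := fun b c S => by simp only [hfl]; split_ifs <;> norm_num
  have hgood0 : ∀ T m b c S, 0 ≤ good T m b c S := fun T m b c S => by
    simp only [hgood]; split_ifs <;> norm_num
  have hw0 : ∀ c : Column u → Role N, 0 ≤ ∏ x, roleWeight φ l (c x) := fun c =>
    Finset.prod_nonneg fun x _ => (h.roleWeight_pos l _).le
  have hjoint : ∀ c T m b, 1 / 2 * ∑ S, μ b c S * good T m b c S -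
      1 / 2 * ∑ S, μ b c S * (fl b c S * good T m b c S) ≤
      jointProb (hiddenWeight q φ l i c) Prod.fst (observe flag msg l i c) (Sum.inl (T, m)) b := by
    intro c T m b
    unfold jointProb
    rw [Fintype.sum_prod_type, Finset.sum_eq_single b]
    · rw [← mul_sub, ← Finset.sum_sub_distrib, Finset.mul_sum]
      refine Finset.sum_le_sum fun S _ => le_of_eq ?_
      simp only [observe_eq_inl, hiddenWeight, hgood, hfl, and_true]
      have key : ∀ (P Q : Prop) [Decidable P] [Decidable Q] (y : ℝ),
          1 / 2 * (y * (if Q then 1 else 0) - y * ((if P then 1 else 0) * if Q then 1 else 0)) =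
            if ¬ P ∧ Q then 1 / 2 * y else 0 := by
        intro P Q _ _ y
        by_cases hP : P <;> by_cases hQ : Q <;> simp [hP, hQ]
      exact key _ _ _
    · intro b' _ hb'
      refine Finset.sum_eq_zero fun S _ => ?_
      rw [if_neg]
      rintro ⟨_, h2⟩
      exact hb' h2
    · simp
  -- Degenerate outcomes are missing from these joint probabilities, which lowers the minimum by at
  -- most their mass.
  have hmin : ∀ c T m, min (1 / 2 * ∑ S, μ true c S * good T m true c S)
        (1 / 2 * ∑ S, μ false c S * good T m false c S) -
      ∑ b, 1 / 2 * ∑ S, μ b c S * (fl b c S * good T m b c S) ≤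
      min (jointProb (hiddenWeight q φ l i c) Prod.fst (observe flag msg l i c)
          (Sum.inl (T, m)) true)
        (jointProb (hiddenWeight q φ l i c) Prod.fst (observe flag msg l i c)
          (Sum.inl (T, m)) false) := by
    intro c T m
    have h1 := hjoint c T m true
    have h2 := hjoint c T m false
    have h3 : ∀ b, 0 ≤ 1 / 2 * ∑ S, μ b c S * (fl b c S * good T m b c S) := fun b =>
      mul_nonneg (by norm_num) (Finset.sum_nonneg fun S _ => mul_nonneg (hμ0 _ _ _)
        (mul_nonneg (hfl0 _ _ _) (hgood0 _ _ _ _ _)))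
    have h4 := h3 true
    have h5 := h3 false
    rw [Fintype.sum_bool]
    refine le_min ?_ ?_
    · linarith [min_le_left (1 / 2 * ∑ S, μ true c S * good T m true c S)
        (1 / 2 * ∑ S, μ false c S * good T m false c S)]
    · linarith [min_le_right (1 / 2 * ∑ S, μ true c S * good T m true c S)
        (1 / 2 * ∑ S, μ false c S * good T m false c S)]
  have hbayes : ∀ c, ∑ T, ∑ m ∈ Finset.univ.image msg,
      min (jointProb (hiddenWeight q φ l i c) Prod.fst (observe flag msg l i c)
          (Sum.inl (T, m)) true)
        (jointProb (hiddenWeight q φ l i c) Prod.fst (observe flag msg l i c)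
          (Sum.inl (T, m)) false) ≤
      bayesError (hiddenWeight q φ l i c) Prod.fst (observe flag msg l i c) := by
    intro c
    set f : (Finset (Column u) × M) ⊕ (Bool × Finset (Column u)) → ℝ := fun a =>
      min (jointProb (hiddenWeight q φ l i c) Prod.fst (observe flag msg l i c) a true)
        (jointProb (hiddenWeight q φ l i c) Prod.fst (observe flag msg l i c) a false) with hf
    have hf0 : ∀ a, 0 ≤ f a := fun a => le_min (jointProb_nonneg (h.hiddenWeight_nonneg l i c) _ _ _ _)
      (jointProb_nonneg (h.hiddenWeight_nonneg l i c) _ _ _ _)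
    have hfz : ∀ a, f a ≠ 0 → a ∈ Finset.univ.image (observe flag msg l i c) := by
      intro a ha
      by_contra hn
      refine ha ?_
      have : ∀ b, jointProb (hiddenWeight q φ l i c) Prod.fst (observe flag msg l i c) a b = 0 := by
        intro b
        refine Finset.sum_eq_zero fun k _ => if_neg ?_
        rintro ⟨h1, _⟩
        exact hn (h1 ▸ Finset.mem_image_of_mem _ (Finset.mem_univ k))
      simp [hf, this]
    rw [← Finset.sum_product']
    change ∑ x ∈ Finset.univ ×ˢ Finset.univ.image msg, f (Function.Embedding.inl x) ≤ _
    rw [← Finset.sum_map (Finset.univ ×ˢ Finset.univ.image msg) Function.Embedding.inl f,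
      ← Finset.sum_filter_of_ne (p := fun a => a ∈ Finset.univ.image (observe flag msg l i c))
      fun a _ ha => hfz a ha]
    refine Finset.sum_le_sum_of_subset_of_nonneg (fun a ha => ?_) fun a _ _ => hf0 a
    exact (Finset.mem_filter.1 ha).2
  -- Weighted by the roles, the joint probabilities become the laws of the thinned channel.
  have hlaw : ∀ T m b c, (∏ x, roleWeight φ l (c x)) * ∑ S, μ b c S * good T m b c S =
      (h.channel l i).law (∅ ∪ T)
        (thin φ (fun S => if msg S = m then setLaw (fun _ => q) S else 0) T) b c := by
    intro T m b c
    simp only [hμ, hgood]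
    rw [h.roles_mul_sum l i b c (fun T' W' => if T' = T ∧ msg (W' ∪ T') = m then 1 else 0),
      Finset.sum_eq_single T]
    · rw [Finset.empty_union, Channel.law]
      refine Finset.sum_congr rfl fun W _ => ?_
      simp only [thin, true_and]
      by_cases h1 : Disjoint T W <;> by_cases h2 : msg (W ∪ T) = m <;> simp [h1, h2]
    · intro T' _ hT'
      simp [hT']
    · simp
  have hsumgood : ∀ b c S, ∑ T, ∑ m ∈ Finset.univ.image msg, good T m b c S = 1 := by
    intro b c S
    simp only [hgood]
    rw [Finset.sum_eq_single (keyPart l i c S)]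
    · simp
    · intro T _ hT; simp [hT.symm]
    · simp
  have hflag : ∀ c, ∑ T, ∑ m ∈ Finset.univ.image msg,
      ∑ b, 1 / 2 * ∑ S, μ b c S * (fl b c S * good T m b c S) =
      ∑ k, hiddenWeight q φ l i c k *
        (if flag (keyPart l i c k.2) (linePart l c k.1 k.2) then 1 else 0) := by
    intro c
    rw [Fintype.sum_prod_type]
    calc _ = ∑ b, ∑ S, 1 / 2 * (μ b c S * (fl b c S *
          ∑ T, ∑ m ∈ Finset.univ.image msg, good T m b c S)) := by
          simp only [Finset.mul_sum]
          rw [Finset.sum_congr rfl fun T _ => Finset.sum_comm, Finset.sum_comm]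
          refine Finset.sum_congr rfl fun b _ => ?_
          rw [Finset.sum_congr rfl fun T _ => Finset.sum_comm, Finset.sum_comm]
      _ = _ := by
          simp only [hsumgood, mul_one, hiddenWeight, hμ, hfl]
          refine Finset.sum_congr rfl fun b _ => Finset.sum_congr rfl fun S _ => ?_
          ring
  calc _ = ∑ c : Column u → Role N, (∏ x, roleWeight φ l (c x)) *
      (∑ T, ∑ m ∈ Finset.univ.image msg,
        (min (1 / 2 * ∑ S, μ true c S * good T m true c S)
          (1 / 2 * ∑ S, μ false c S * good T m false c S) -
        ∑ b, 1 / 2 * ∑ S, μ b c S * (fl b c S * good T m b c S))) := by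
        simp only [Finset.sum_sub_distrib, hflag, mul_sub]
        congr 1
        simp only [Channel.thinBayes, Channel.bayes, Finset.mul_sum]
        rw [Finset.sum_comm, Finset.sum_comm (s := (Finset.univ : Finset (Column u → Role N)))]
        refine Finset.sum_congr rfl fun T _ => ?_
        rw [Finset.sum_comm (s := (Finset.univ : Finset (Column u → Role N)))]
        refine Finset.sum_congr rfl fun m _ => Finset.sum_congr rfl fun c _ => ?_
        rw [← hlaw, ← hlaw, mul_min_of_nonneg _ _ (hw0 c)]
        simp only [Finset.mul_sum]
        congr 1 <;> refine Finset.sum_congr rfl fun S _ => by ring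
    _ ≤ _ := by
        refine Finset.sum_le_sum fun c _ => mul_le_mul_of_nonneg_left ?_ (hw0 c)
        exact (Finset.sum_le_sum fun T _ => Finset.sum_le_sum fun m _ => hmin c T m).trans
          (hbayes c)

omit [DecidableEq M] in
/-- The probability that a random set avoids all the columns with a given property. -/
theorem sum_avoid (l : Fin (N + 1)) (θ : Column u → Role N → ℝ)
    (Q : Column u → Role N → Prop) [∀ x r, Decidable (Q x r)] :
    ∑ c : Column u → Role N, (∏ x, roleWeight φ l (c x)) *
      ∑ S, setLaw (fun x => θ x (c x)) S * (if ∀ x ∈ S, ¬ Q x (c x) then 1 else 0) =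
    ∏ x, (1 - ∑ r, roleWeight φ l r * (if Q x r then θ x r else 0)) := by
  have h1 : ∀ (c : Column u → Role N) (S : Finset (Column u)), (∏ x, roleWeight φ l (c x)) *
      (setLaw (fun x => θ x (c x)) S * (if ∀ x ∈ S, ¬ Q x (c x) then 1 else 0)) =
      ∏ x, if x ∈ S then roleWeight φ l (c x) * (if Q x (c x) then 0 else θ x (c x)) else
        roleWeight φ l (c x) * (1 - θ x (c x)) := by
    intro c S
    by_cases h2 : ∀ x ∈ S, ¬ Q x (c x)
    · rw [if_pos h2, mul_one, setLaw, ← Finset.prod_mul_distrib]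
      refine Finset.prod_congr rfl fun x _ => ?_
      split_ifs with h3 h4
      · exact absurd h4 (h2 x h3)
      · rfl
      · rfl
    · rw [if_neg h2, mul_zero, mul_zero]
      push Not at h2
      obtain ⟨x, hx, hQ⟩ := h2
      rw [Finset.prod_eq_zero (Finset.mem_univ x)]
      simp [hx, hQ]
  simp only [Finset.mul_sum, h1]
  have h3 : ∀ c : Column u → Role N, ∑ S : Finset (Column u), (∏ x, if x ∈ S then
      roleWeight φ l (c x) * (if Q x (c x) then 0 else θ x (c x)) else
        roleWeight φ l (c x) * (1 - θ x (c x))) =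
      ∏ x, (roleWeight φ l (c x) - roleWeight φ l (c x) * (if Q x (c x) then θ x (c x) else 0)) := by
    intro c
    rw [sum_set_prod]
    refine Finset.prod_congr rfl fun x _ => ?_
    split_ifs <;> ring
  simp only [h3]
  rw [sum_pi_prod (fun x r => roleWeight φ l r - roleWeight φ l r * (if Q x r then θ x r else 0))]
  refine Finset.prod_congr rfl fun x _ => ?_
  rw [Finset.sum_sub_distrib, h.sum_roleWeight]

end Admissible

/-- A pair of sets is degenerate if one of them misses one half of the columns. -/
def Degenerate (T W : Finset (Column u)) : Prop :=
  ∃ η : Bool, (∀ x ∈ T, x.1 ≠ η) ∨ ∀ x ∈ W, x.1 ≠ η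

namespace Admissible

variable {q φ : ℝ} (h : Admissible N q φ)
include h

theorem sum_avoid_key (l : Fin (N + 1)) (i : Fin N) (b η : Bool) :
    ∑ c : Column u → Role N, (∏ x, roleWeight φ l (c x)) *
      ∑ S, setLaw (fun x => memProb q φ l i b x.1 (c x)) S *
        (if ∀ x ∈ keyPart l i c S, x.1 ≠ η then 1 else 0) = (1 - (1 - φ) * q) ^ u := by
  have h1 := h.sum_avoid l (fun (x : Column u) r => memProb q φ l i b x.1 r)
    (fun x r => r.1 = l.succAbove i ∧ x.1 = η)
  have e : ∀ (c : Column u → Role N) (S : Finset (Column u)),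
      (∀ x ∈ keyPart l i c S, x.1 ≠ η) ↔
        ∀ x ∈ S, ¬ ((c x).1 = l.succAbove i ∧ x.1 = η) := by
    intro c S
    simp only [keyPart, Finset.mem_filter]
    exact ⟨fun h1 x hx h2 => h1 x ⟨hx, h2.1⟩ h2.2, fun h1 x hx h2 => h1 x hx.1 ⟨hx.2, h2⟩⟩
  simp only [e]
  rw [h1]
  have h2 : ∀ η' : Bool, (∑ r : Role N, roleWeight φ l r *
      (if r.1 = l.succAbove i ∧ η' = η then memProb q φ l i b η' r else 0)) =
      if η' = η then (1 - φ) * q else 0 := by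
    intro η'
    split_ifs with hη
    · rw [← h.sum_roleWeight_key l i]
      refine Finset.sum_congr rfl fun r _ => ?_
      by_cases hr : r.1 = l.succAbove i <;> simp [hr, hη, memProb]
    · simp [hη]
  simp only [h2]
  rw [Fintype.prod_prod_type]
  cases η <;> simp

theorem sum_avoid_line (l : Fin (N + 1)) (i : Fin N) (b η : Bool) :
    ∑ c : Column u → Role N, (∏ x, roleWeight φ l (c x)) *
      ∑ S, setLaw (fun x => memProb q φ l i b x.1 (c x)) S *
        (if ∀ x ∈ linePart l c b S, x.1 ≠ η then 1 else 0) = (1 - φ * q) ^ u := by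
  have h1 := h.sum_avoid l (fun (x : Column u) r => memProb q φ l i b x.1 r)
    (fun x r => r = (l, b ^^ x.1) ∧ x.1 = η)
  have e : ∀ (c : Column u → Role N) (S : Finset (Column u)),
      (∀ x ∈ linePart l c b S, x.1 ≠ η) ↔
        ∀ x ∈ S, ¬ (c x = (l, b ^^ x.1) ∧ x.1 = η) := by
    intro c S
    simp only [linePart, Finset.mem_filter]
    exact ⟨fun h1 x hx h2 => h1 x ⟨hx, h2.1⟩ h2.2, fun h1 x hx h2 => h1 x hx.1 ⟨hx.2, h2⟩⟩
  simp only [e]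
  rw [h1]
  have h2 : ∀ η' : Bool, (∑ r : Role N, roleWeight φ l r *
      (if r = (l, b ^^ η') ∧ η' = η then memProb q φ l i b η' r else 0)) =
      if η' = η then φ * q else 0 := by
    intro η'
    split_ifs with hη
    · rw [← h.sum_roleWeight_line l (b ^^ η')]
      refine Finset.sum_congr rfl fun r _ => ?_
      by_cases hr : r = (l, b ^^ η')
      · subst hr; simp [hη, memProb, (Fin.succAbove_ne l i).symm]
      · simp [hr]
    · simp [hη]
  simp only [h2]
  rw [Fintype.prod_prod_type]
  cases η <;> simp

open Classical in
-- A union bound over the two halves and the two parts of the set: each half has `u` columns, each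
-- of them in the part with probability `(1 - φ) * q` or `φ * q`.
theorem sum_degenerate_le (l : Fin (N + 1)) (i : Fin N) :
    ∑ c : Column u → Role N, (∏ x, roleWeight φ l (c x)) * ∑ k, hiddenWeight q φ l i c k *
      (if Degenerate (keyPart l i c k.2) (linePart l c k.1 k.2) then 1 else 0) ≤
    2 * (1 - (1 - φ) * q) ^ u + 2 * (1 - φ * q) ^ u := by
  have hw0 : ∀ c : Column u → Role N, 0 ≤ ∏ x, roleWeight φ l (c x) := fun c =>
    Finset.prod_nonneg fun x _ => (h.roleWeight_pos l _).le
  have h1 : ∀ (T W : Finset (Column u)), (if Degenerate T W then (1 : ℝ) else 0) ≤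
      ∑ η : Bool, ((if ∀ x ∈ T, x.1 ≠ η then 1 else 0) + if ∀ x ∈ W, x.1 ≠ η then 1 else 0) := by
    intro T W
    have h0 : ∀ η : Bool, (0 : ℝ) ≤
        (if ∀ x ∈ T, x.1 ≠ η then 1 else 0) + if ∀ x ∈ W, x.1 ≠ η then 1 else 0 := fun η => by
      positivity
    split_ifs with hd
    · obtain ⟨η, hη⟩ := hd
      refine le_trans ?_ (Finset.single_le_sum (fun η _ => h0 η) (Finset.mem_univ η))
      rcases hη with hη | hη
      · rw [if_pos hη]; have : (0 : ℝ) ≤ if ∀ x ∈ W, x.1 ≠ η then 1 else 0 := by positivity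
        linarith
      · rw [if_pos hη]; have : (0 : ℝ) ≤ if ∀ x ∈ T, x.1 ≠ η then 1 else 0 := by positivity
        linarith
    · exact Finset.sum_nonneg fun η _ => h0 η
  calc _ ≤ ∑ c : Column u → Role N, (∏ x, roleWeight φ l (c x)) *
        ∑ k : Bool × Finset (Column u), hiddenWeight q φ l i c k *
          ∑ η : Bool, ((if ∀ x ∈ keyPart l i c k.2, x.1 ≠ η then 1 else 0) +
            if ∀ x ∈ linePart l c k.1 k.2, x.1 ≠ η then 1 else 0) :=
        Finset.sum_le_sum fun c _ => mul_le_mul_of_nonneg_left (Finset.sum_le_sum fun k _ =>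
          mul_le_mul_of_nonneg_left (h1 _ _) (h.hiddenWeight_nonneg l i c k)) (hw0 c)
    _ = ∑ b : Bool, ∑ η : Bool, 1 / 2 * ((∑ c : Column u → Role N, (∏ x, roleWeight φ l (c x)) *
          ∑ S, setLaw (fun x => memProb q φ l i b x.1 (c x)) S *
            (if ∀ x ∈ keyPart l i c S, x.1 ≠ η then 1 else 0)) +
        ∑ c : Column u → Role N, (∏ x, roleWeight φ l (c x)) *
          ∑ S, setLaw (fun x => memProb q φ l i b x.1 (c x)) S *
            (if ∀ x ∈ linePart l c b S, x.1 ≠ η then 1 else 0)) := by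
        simp only [Fintype.sum_prod_type, hiddenWeight, Finset.mul_sum, ← Finset.sum_add_distrib]
        rw [Finset.sum_comm]
        refine Finset.sum_congr rfl fun b _ => ?_
        rw [Finset.sum_congr rfl fun c _ => Finset.sum_comm, Finset.sum_comm]
        refine Finset.sum_congr rfl fun η _ => ?_
        refine Finset.sum_congr rfl fun c _ => Finset.sum_congr rfl fun S _ => ?_
        ring
    _ = _ := by
        simp only [h.sum_avoid_key, h.sum_avoid_line]
        simp only [Fintype.sum_bool]
        ring

/-- The law of a plain set, averaged over the roles of the columns. -/
theorem sum_plainLaw (l : Fin (N + 1)) (i : Fin N) (F : Finset (Column u) → ℝ) :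
    ∑ c : Column u → Role N, (∏ x, roleWeight φ l (c x)) *
      ∑ S, setLaw (fun x => if (c x).1 = l.succAbove i then q * (N + φ) else 0) S * F S =
    ∑ S, setLaw (fun _ => q) S * F S := by
  simp only [Finset.mul_sum]
  rw [Finset.sum_comm]
  refine Finset.sum_congr rfl fun S _ => ?_
  simp only [← mul_assoc]
  rw [← Finset.sum_mul]
  congr 1
  simp only [setLaw, ← Finset.prod_mul_distrib]
  rw [sum_pi_prod (fun (x : Column u) r => roleWeight φ l r * if x ∈ S then
    (if r.1 = l.succAbove i then q * (N + φ) else 0) else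
      1 - (if r.1 = l.succAbove i then q * (N + φ) else 0))]
  refine Finset.prod_congr rfl fun x _ => ?_
  split_ifs
  · exact h.sum_plain l i
  · simp only [mul_sub, mul_one, Finset.sum_sub_distrib]
    rw [h.sum_roleWeight, h.sum_plain]

end Admissible

end Link

/-! ### The grid blocks. -/

/-- A graph with a proper invariant two-coloring by components is a block. -/
theorem isBlock_of_color {V : Type*} {G : SimpleGraph V} (color : V → Bool) (s t : Bool → V)
    (hadj : ∀ v w, G.Adj v w → color v = color w) (hreach : ∀ v, G.Reachable v (t (color v)))
    (ht : ∀ β, color (t β) = β) (hs : color (s true) = !color (s false))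
    (hst : ∀ a b, s a ≠ t b) :
    IsBlock G (s false) (s true) (t true) (t false) ∧
      ∀ β, G.Reachable (s false) (t β) ↔ color (s false) = β := by
  have hcol : ∀ v w, G.Reachable v w → color v = color w := by
    rintro v w ⟨p⟩
    induction p with
    | nil => rfl
    | cons h _ ih => exact (hadj _ _ h).trans ih
  have hiff : ∀ v β, G.Reachable v (t β) ↔ color v = β := fun v β =>
    ⟨fun h => by rw [hcol _ _ h, ht], fun h => h ▸ hreach v⟩
  have hss : s false ≠ s true := fun h => by rw [← h] at hs; simp at hs
  have htt : t true ≠ t false := fun h => by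
    have := congrArg color h; rw [ht, ht] at this; simp at this
  refine ⟨⟨?_, ?_, fun h => ?_, ?_⟩, fun β => hiff _ β⟩
  · simp [hss, htt, hst]
  · let e : G.ConnectedComponent ≃ Bool :=
      { toFun := fun C => C.lift color fun v w p _ => hcol v w ⟨p⟩
        invFun := fun β => G.connectedComponentMk (t β)
        left_inv := fun C => by
          induction C using SimpleGraph.ConnectedComponent.ind with
          | h v => exact (SimpleGraph.ConnectedComponent.eq.2 (hreach v)).symm
        right_inv := fun β => ht β }
    rw [Nat.card_congr e]; simp
  · have := hcol _ _ h
    rw [hs] at this; simp at this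
  · rw [hiff, hiff, hiff, hiff, hs]
    cases color (s false) <;> simp

/-- The vertices of the grid blocks. -/
inductive Vertex (N u X : ℕ)
  | source (η : Bool)
  | sink (β : Bool)
  | hub (η : Bool) (a : Fin (N + 1)) (β : Bool)
  | col (x : Column u)
  | row (η : Bool) (a : Fin (N + 1)) (i : Fin N)
  | extra (i : Fin X)

namespace Vertex

variable {N u X : ℕ}

/-- The vertices as a sum of finite types. -/
def equivSum : Vertex N u X ≃ (Bool ⊕ Bool ⊕ (Bool × Fin (N + 1) × Bool) ⊕ Column u ⊕
    (Bool × Fin (N + 1) × Fin N) ⊕ Fin X) where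
  toFun
    | source η => .inl η
    | sink β => .inr (.inl β)
    | hub η a β => .inr (.inr (.inl (η, a, β)))
    | col x => .inr (.inr (.inr (.inl x)))
    | row η a i => .inr (.inr (.inr (.inr (.inl (η, a, i)))))
    | extra i => .inr (.inr (.inr (.inr (.inr i))))
  invFun
    | .inl η => source η
    | .inr (.inl β) => sink β
    | .inr (.inr (.inl (η, a, β))) => hub η a β
    | .inr (.inr (.inr (.inl x))) => col x
    | .inr (.inr (.inr (.inr (.inl (η, a, i))))) => row η a i
    | .inr (.inr (.inr (.inr (.inr i)))) => extra i
  left_inv v := by cases v <;> rfl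
  right_inv v := by rcases v with _ | _ | ⟨_, _, _⟩ | _ | ⟨_, _, _⟩ | _ <;> rfl

instance : Fintype (Vertex N u X) := Fintype.ofEquiv _ equivSum.symm

theorem card_eq : Fintype.card (Vertex N u X) =
    4 + 4 * (N + 1) + 2 * u + 2 * ((N + 1) * N) + X := by
  rw [Fintype.card_congr equivSum]
  simp only [Fintype.card_sum, Fintype.card_prod, Fintype.card_bool, Fintype.card_fin]
  ring

/-- The sum of a function over the vertices is at least its sum over the columns and the rows. -/
theorem sum_col_add_sum_row_le {f : Vertex N u X → ℝ} (hf : ∀ v, 0 ≤ f v) :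
    ∑ x, f (col x) + ∑ a, ∑ i, ∑ η, f (row η a i) ≤ ∑ v, f v := by
  rw [← Equiv.sum_comp equivSum.symm f]
  simp only [Fintype.sum_sum_type]
  have h1 : ∑ y : Bool × Fin (N + 1) × Fin N, f (equivSum.symm (.inr (.inr (.inr (.inr (.inl y)))))) =
      ∑ a, ∑ i, ∑ η, f (row η a i) := by
    rw [Fintype.sum_prod_type]
    simp only [Fintype.sum_prod_type]
    rw [Finset.sum_comm]
    refine Finset.sum_congr rfl fun a _ => ?_
    rw [Finset.sum_comm]
    rfl
  rw [h1]
  have h2 : ∑ x : Column u, f (equivSum.symm (.inr (.inr (.inr (.inl x))))) = ∑ x, f (col x) := rfl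
  rw [h2]
  have h3 := Finset.sum_nonneg fun η (_ : η ∈ (Finset.univ : Finset Bool)) =>
    hf (equivSum.symm (.inl η))
  have h4 := Finset.sum_nonneg fun β (_ : β ∈ (Finset.univ : Finset Bool)) =>
    hf (equivSum.symm (.inr (.inl β)))
  have h5 := Finset.sum_nonneg fun y (_ : y ∈ (Finset.univ : Finset (Bool × Fin (N + 1) × Bool))) =>
    hf (equivSum.symm (.inr (.inr (.inl y))))
  have h6 := Finset.sum_nonneg fun y (_ : y ∈ (Finset.univ : Finset (Fin X))) =>
    hf (equivSum.symm (.inr (.inr (.inr (.inr (.inr y))))))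
  linarith

end Vertex

open Vertex

section Grid

variable {N u X : ℕ} (l : Fin (N + 1)) (k : Fin N) (c : Column u → Role N)
  (z : Fin (N + 1) → Fin N → Finset (Column u)) (h : Fin N → Bool × Finset (Column u))

/-- The part of the `i`-th key set on its own line. -/
abbrev ownPart (i : Fin N) : Finset (Column u) := keyPart l i c (h i).2

/-- The part of the `i`-th key set on the line of the keys. -/
abbrev commonPart (i : Fin N) : Finset (Column u) := linePart l c (h i).1 (h i).2

/-- The columns adjacent to the rows `row η a i`. -/
def rowSet (a : Fin (N + 1)) (i : Fin N) : Finset (Column u) :=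
  if a = l then commonPart l c h i ∪ ownPart l c h i else (z a i).filter fun x => (c x).1 = a

/-- The orientation of the edges of a grid block. -/
def Link : Vertex N u X → Vertex N u X → Prop
  | source η, hub η' a β => η' = η ∧ a = l.succAbove k ∧ β = false
  -- The two sides of a line are joined, except on `l`, where they lead to different sinks.
  | hub η a β, hub η' a' β' => η' = η ∧ a' = a ∧ a ≠ l ∧ β = false ∧ β' = true
  | sink β, hub _ a β' => a = l ∧ β' = β
  | col x, hub η a β => η = x.1 ∧ c x = (a, β)
  | row η a i, col x => x.1 = η ∧ x ∈ rowSet l c z h a i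
  -- Spare edges: a row whose set, or one of the two parts of it for a key, misses the half `η`
  -- would lose a connection. It is joined directly to a hub that the missing columns would have led
  -- to.
  | row η a i, hub η' a' β => η' = η ∧
      ((a ≠ l ∧ a' = a ∧ β = false ∧ ∀ x ∈ rowSet l c z h a i, x.1 ≠ η) ∨
        (a = l ∧ a' = l.succAbove i ∧ β = false ∧ ∀ x ∈ ownPart l c h i, x.1 ≠ η) ∨
          (a = l ∧ a' = l ∧ β = ((h i).1 ^^ η) ∧ ∀ x ∈ commonPart l c h i, x.1 ≠ η))
  | extra _, source η => η = false
  | _, _ => False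

/-- The grid block. -/
def gridGraph : SimpleGraph (Vertex N u X) := SimpleGraph.fromRel (Link l k c z h)

/-- The hidden bit that belongs to a line. -/
def lineBit : Fin (N + 1) → Bool := Fin.insertNth (α := fun _ => Bool) l false fun i => (h i).1

@[simp] theorem lineBit_succAbove (i : Fin N) : lineBit l h (l.succAbove i) = (h i).1 := by
  simp [lineBit]

/-- The side of the grid block on which a vertex lies. -/
def gridColor : Vertex N u X → Bool
  | source η => (h k).1 ^^ η
  | sink β => β
  -- Here and below `lineBit` is used only off `l`, so its value `false` at `l` is a mere default.
  | hub η a β => if a = l then β else lineBit l h a ^^ η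
  | col x => if (c x).1 = l then (c x).2 else lineBit l h (c x).1 ^^ x.1
  | row η a i => if a = l then (h i).1 ^^ η else lineBit l h a ^^ η
  | extra _ => (h k).1

variable {l k c z h}

theorem Link.color_eq {v w : Vertex N u X} (hvw : Link l k c z h v w) :
    gridColor l k c h v = gridColor l k c h w := by
  cases v <;> cases w <;> simp only [Link] at hvw
  · obtain ⟨rfl, rfl, rfl⟩ := hvw
    simp [gridColor]
  · obtain ⟨rfl, rfl⟩ := hvw
    simp [gridColor]
  · obtain ⟨rfl, rfl, h1, rfl, rfl⟩ := hvw
    simp [gridColor, h1]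
  · obtain ⟨rfl, h1⟩ := hvw
    simp [gridColor, h1]
  · obtain ⟨rfl, ⟨h1, rfl, rfl, _⟩ | ⟨rfl, rfl, rfl, _⟩ | ⟨rfl, rfl, rfl, _⟩⟩ := hvw <;>
      simp [gridColor, *]
  · rename_i η a i x
    obtain ⟨rfl, h1⟩ := hvw
    unfold rowSet at h1
    split_ifs at h1 with h2
    · subst h2
      rcases Finset.mem_union.1 h1 with h3 | h3
      · have h4 := (Finset.mem_filter.1 h3).2
        simp [gridColor, h4]
      · have h4 := (Finset.mem_filter.1 h3).2
        simp [gridColor, h4]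
    · have h4 := (Finset.mem_filter.1 h1).2
      simp [gridColor, h4, h2]
  · subst hvw
    simp [gridColor]

theorem Link.ne {v w : Vertex N u X} (hvw : Link l k c z h v w) : v ≠ w := by
  rintro rfl
  cases v <;> simp [Link] at hvw

theorem Link.adj {v w : Vertex N u X} (hvw : Link l k c z h v w) :
    (gridGraph l k c z h).Adj v w :=
  (SimpleGraph.fromRel_adj _ _ _).2 ⟨hvw.ne, Or.inl hvw⟩

theorem gridGraph_adj {v w : Vertex N u X} :
    (gridGraph l k c z h).Adj v w ↔ Link l k c z h v w ∨ Link l k c z h w v := by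
  refine ⟨fun h1 => ((SimpleGraph.fromRel_adj _ _ _).1 h1).2, fun h1 => ?_⟩
  rcases h1 with h1 | h1
  exacts [h1.adj, h1.adj.symm]

/-- The colour is constant along edges, so `R` passes along every edge in both directions. It
spreads from the sinks to the hubs and columns of `l`, then to the keys, to the hubs of the other
lines, and on to all the rest. A spare edge replaces the passage through a column whenever there is
none. -/
theorem gridGraph_reachable (v : Vertex N u X) :
    (gridGraph l k c z h).Reachable v (sink (gridColor l k c h v)) := by
  set R : Vertex N u X → Prop := fun v =>
    (gridGraph l k c z h).Reachable v (sink (gridColor l k c h v)) with hR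
  have step : ∀ v w : Vertex N u X, Link l k c z h v w → (R v ↔ R w) := by
    intro v w hvw
    simp only [hR, hvw.color_eq]
    exact ⟨fun h1 => hvw.adj.symm.reachable.trans h1, fun h1 => hvw.adj.reachable.trans h1⟩
  have hsink : ∀ β, R (sink β) := fun β => SimpleGraph.Reachable.refl _
  have hhub : ∀ η β, R (hub η l β) := fun η β => (step (sink β) (hub η l β) ⟨rfl, rfl⟩).1 (hsink β)
  have hcol : ∀ x, (c x).1 = l → R (col x) := fun x hx =>
    (step (col x) (hub x.1 l (c x).2) ⟨rfl, by rw [← hx]⟩).2 (hhub _ _)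
  have hkey : ∀ η i, R (row η l i) := by
    intro η i
    by_cases h1 : ∀ x ∈ commonPart l c h i, x.1 ≠ η
    · exact (step (row η l i) (hub η l ((h i).1 ^^ η)) ⟨rfl, Or.inr (Or.inr ⟨rfl, rfl, rfl, h1⟩)⟩).2
        (hhub _ _)
    · push Not at h1
      obtain ⟨x, hx, hη⟩ := h1
      have hxc := (Finset.mem_filter.1 hx).2
      refine (step (row η l i) (col x) ⟨hη, ?_⟩).2 (hcol x (by rw [hxc]))
      rw [rowSet, if_pos rfl]
      exact Finset.mem_union_left _ hx
  have hpair : ∀ η i, R (hub η (l.succAbove i) false) ↔ R (hub η (l.succAbove i) true) :=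
    fun η i => step (hub η (l.succAbove i) false) (hub η (l.succAbove i) true) ⟨rfl, rfl, Fin.succAbove_ne l i, rfl, rfl⟩
  have hhub' : ∀ η i β, R (hub η (l.succAbove i) β) := by
    intro η i
    suffices h0 : R (hub η (l.succAbove i) false) by
      rintro (_ | _)
      exacts [h0, (hpair η i).1 h0]
    by_cases h1 : ∀ x ∈ ownPart l c h i, x.1 ≠ η
    · exact (step (row η l i) (hub η (l.succAbove i) false) ⟨rfl, Or.inr (Or.inl ⟨rfl, rfl, rfl, h1⟩)⟩).1 (hkey η i)
    · push Not at h1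
      obtain ⟨x, hx, hη⟩ := h1
      have hxc := (Finset.mem_filter.1 hx).2
      have h2 : R (col x) := by
        refine (step (row η l i) (col x) ⟨hη, ?_⟩).1 (hkey η i)
        rw [rowSet, if_pos rfl]
        exact Finset.mem_union_right _ hx
      have h3 : R (hub η (l.succAbove i) (c x).2) :=
        (step (col x) (hub η (l.succAbove i) (c x).2) ⟨hη.symm, by rw [← hxc]⟩).1 h2
      cases hb : (c x).2 <;> rw [hb] at h3
      exacts [h3, (hpair η i).2 h3]
  have hhub'' : ∀ η a β, R (hub η a β) := by
    intro η a β
    rcases Fin.eq_self_or_eq_succAbove l a with rfl | ⟨i, rfl⟩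
    exacts [hhub η β, hhub' η i β]
  have hcol' : ∀ x, R (col x) := fun x => (step (col x) (hub x.1 (c x).1 (c x).2) ⟨rfl, rfl⟩).2
    (hhub'' _ _ _)
  have hsource : ∀ η, R (source η) := fun η =>
    (step (source η) (hub η (l.succAbove k) false) ⟨rfl, rfl, rfl⟩).2 (hhub'' _ _ _)
  cases v with
  | source η => exact hsource η
  | sink β => exact hsink β
  | hub η a β => exact hhub'' η a β
  | col x => exact hcol' x
  | extra i => exact (step (extra i) (source false) rfl).2 (hsource false)
  | row η a i =>
    rcases eq_or_ne a l with rfl | ha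
    · exact hkey η i
    · by_cases h1 : ∀ x ∈ rowSet l c z h a i, x.1 ≠ η
      · exact (step (row η a i) (hub η a false) ⟨rfl, Or.inl ⟨ha, rfl, rfl, h1⟩⟩).2 (hhub'' _ _ _)
      · push Not at h1
        obtain ⟨x, hx, hη⟩ := h1
        exact (step (row η a i) (col x) ⟨hη, hx⟩).2 (hcol' x)

theorem gridGraph_isBlock : IsBlock (gridGraph (X := X) l k c z h)
      (source false) (source true) (sink true) (sink false) ∧
    ∀ β, (gridGraph (X := X) l k c z h).Reachable (source false) (sink β) ↔ (h k).1 = β := by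
  have h1 := isBlock_of_color (G := gridGraph (X := X) l k c z h) (gridColor l k c h) source sink
    (fun v w hvw => by
      rcases gridGraph_adj.1 hvw with h1 | h1
      exacts [h1.color_eq, h1.color_eq.symm])
    gridGraph_reachable (fun β => rfl) (by simp [gridColor]) (fun a b => by simp)
  simpa [gridColor] using h1

/-- The neighbors of a row, if its set is `A`. -/
def rowNeighbors (η : Bool) (a : Fin (N + 1)) (A : Finset (Column u)) : Set (Vertex N u X) :=
  {w | (∃ x ∈ A, x.1 = η ∧ w = col x) ∨ ((∀ x ∈ A, x.1 ≠ η) ∧ w = hub η a false)}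

/-- The neighbors of a column with the role `r`, if it belongs to the `i`-th set of its line
whenever `v i = true`. -/
def colNeighbors (x : Column u) (r : Role N) (v : Fin N → Bool) : Set (Vertex N u X) :=
  {w | w = hub x.1 r.1 r.2 ∨ ∃ i, v i = true ∧ w = row x.1 r.1 i}

theorem neighborSet_plain_row {η : Bool} {a : Fin (N + 1)} (ha : a ≠ l) (i : Fin N) :
    (gridGraph (X := X) l k c z h).neighborSet (row η a i) =
      rowNeighbors η a ((z a i).filter fun x => (c x).1 = a) := by
  ext w
  rw [SimpleGraph.mem_neighborSet, gridGraph_adj]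
  cases w <;> simp only [Link, rowNeighbors, rowSet, if_neg ha, Set.mem_ofPred_eq, reduceCtorEq,
    and_false, exists_false, or_false, false_or, Vertex.col.injEq, Vertex.hub.injEq]
  · grind
  · grind

/-- A nondegenerate key uses no spare edge, so its neighborhood depends on its set in the same way
as that of a plain row: the player cannot tell a key from a plain row. -/
theorem neighborSet_key_row {η : Bool} {i : Fin N}
    (hi : ¬ Degenerate (ownPart l c h i) (commonPart l c h i)) :
    (gridGraph (X := X) l k c z h).neighborSet (row η l i) =
      rowNeighbors η l (commonPart l c h i ∪ ownPart l c h i) := by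
  have h1 : ¬ ∀ x ∈ ownPart l c h i, x.1 ≠ η := fun h1 => hi ⟨η, Or.inl h1⟩
  have h2 : ¬ ∀ x ∈ commonPart l c h i, x.1 ≠ η := fun h1 => hi ⟨η, Or.inr h1⟩
  have h3 : ¬ ∀ x ∈ commonPart l c h i ∪ ownPart l c h i, x.1 ≠ η := fun h3 =>
    h1 fun x hx => h3 x (Finset.mem_union_right _ hx)
  ext w
  rw [SimpleGraph.mem_neighborSet, gridGraph_adj]
  simp only [rowNeighbors, Set.mem_ofPred_eq, h3, false_and, or_false]
  cases w <;> simp only [Link, h1, h2, and_false, or_false, reduceCtorEq,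
    not_true_eq_false, ne_eq, false_and, exists_false, rowSet, if_true,
    Vertex.col.injEq]
  · grind

theorem neighborSet_line_col {x : Column u} (hx : (c x).1 = l) :
    (gridGraph (X := X) l k c z h).neighborSet (col x) =
      colNeighbors x (c x) fun i => decide (x ∈ commonPart l c h i) := by
  ext w
  rw [SimpleGraph.mem_neighborSet, gridGraph_adj]
  cases w <;> simp [Link, colNeighbors]
  · grind
  · rename_i η a i
    have h1 : x ∉ ownPart l c h i := fun h1 => by
      have := (Finset.mem_filter.1 h1).2
      rw [hx] at this
      exact Fin.succAbove_ne l i this.symm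
    unfold rowSet
    split_ifs with ha
    · simp only [Finset.mem_union, h1, or_false, ha, hx]
      grind
    · simp only [Finset.mem_filter, hx]
      grind

/-- Outside the key set that belongs to its line, a column sees only rows of its own line, just as a
column of `l` does in `neighborSet_line_col`. -/
theorem neighborSet_plain_col {x : Column u} {i : Fin N} (hx : (c x).1 = l.succAbove i)
    (hi : x ∉ (h i).2) :
    (gridGraph (X := X) l k c z h).neighborSet (col x) =
      colNeighbors x (c x) fun j => decide (x ∈ z (l.succAbove i) j) := by
  ext w
  rw [SimpleGraph.mem_neighborSet, gridGraph_adj]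
  cases w <;> simp [Link, colNeighbors]
  · grind
  · rename_i η a j
    unfold rowSet
    split_ifs with ha
    · have h1 : x ∉ commonPart l c h j := fun h1 => by
        have := (Finset.mem_filter.1 h1).2
        rw [this] at hx
        exact Fin.succAbove_ne l i hx.symm
      have h2 : x ∉ ownPart l c h j := fun h2 => by
        have h3 := Finset.mem_filter.1 h2
        rw [hx] at h3
        have := Fin.succAbove_right_injective h3.2
        subst this
        exact hi h3.1
      have h4 : a ≠ l.succAbove i := fun h4 => Fin.succAbove_ne l i (h4 ▸ ha)
      simp [h1, h2, hx, h4]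
    · simp only [Finset.mem_filter, hx]
      grind

/-- The edges of the grid block, except for the ones between the keys and the columns on their line,
depend only on partial information about the hidden data. -/
theorem link_congr {h' : Fin N → Bool × Finset (Column u)}
    (hh : ∀ i, h i = h' i ∨ (¬ Degenerate (ownPart l c h i) (commonPart l c h i) ∧
      ¬ Degenerate (ownPart l c h' i) (commonPart l c h' i) ∧ ownPart l c h i = ownPart l c h' i))
    (v w : Vertex N u X)
    (hvw : ∀ η i x, v = row η l i → w = col x → (c x).1 ≠ l) :
    Link l k c z h v w → Link l k c z h' v w := by
  have hown : ∀ i, ownPart l c h i = ownPart l c h' i := by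
    intro i
    rcases hh i with h1 | h1
    · simp only [ownPart, h1]
    · exact h1.2.2
  have hmem : ∀ i x, (c x).1 ≠ l → x ∉ commonPart l c h i := fun i x hx h1 => by
    have := (Finset.mem_filter.1 h1).2
    rw [this] at hx
    exact hx rfl
  cases v <;> cases w <;> simp only [Link, imp_self]
  · rename_i η a i η' a' β
    rintro ⟨rfl, ⟨h1, h2, h3, h4⟩ | ⟨h1, h2, h3, h4⟩ | ⟨h1, h2, h3, h4⟩⟩
    · refine ⟨rfl, Or.inl ⟨h1, h2, h3, ?_⟩⟩
      rw [rowSet, if_neg h1] at h4 ⊢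
      exact h4
    · refine ⟨rfl, Or.inr (Or.inl ⟨h1, h2, h3, ?_⟩)⟩
      rw [← hown]
      exact h4
    · rcases hh i with h5 | h5
      · refine ⟨rfl, Or.inr (Or.inr ⟨h1, h2, ?_, ?_⟩)⟩
        · rw [← h5]; exact h3
        · simp only [commonPart, ← h5]; exact h4
      · exact absurd ⟨_, Or.inr h4⟩ h5.1
  · rename_i η a i x
    rintro ⟨h1, h2⟩
    refine ⟨h1, ?_⟩
    unfold rowSet at h2 ⊢
    split_ifs at h2 ⊢ with ha
    · have h3 := hvw η i x (by rw [ha]) rfl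
      rcases Finset.mem_union.1 h2 with h4 | h4
      · exact absurd h4 (hmem i x h3)
      · exact Finset.mem_union_right _ (hown i ▸ h4)
    · exact h2

/-- The messages of a sketching protocol depend only on the observations of the hidden data and on
the messages of the columns on the line of the keys. -/
theorem messages_eq {h' : Fin N → Bool × Finset (Column u)}
    (sk : Vertex N u X → Set (Vertex N u X) → List Bool)
    [∀ T W : Finset (Column u), Decidable (Degenerate T W)]
    (hobs : ∀ i, Admissible.observe Degenerate (fun S η => sk (row η l i) (rowNeighbors η l S)) l i c
      (h i) = Admissible.observe Degenerate (fun S η => sk (row η l i) (rowNeighbors η l S)) l i c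
      (h' i))
    (hcol : ∀ x, (c x).1 = l → sk (col x) ((gridGraph l k c z h).neighborSet (col x)) =
      sk (col x) ((gridGraph l k c z h').neighborSet (col x))) (v : Vertex N u X) :
    sk v ((gridGraph l k c z h).neighborSet v) = sk v ((gridGraph l k c z h').neighborSet v) := by
  have hobs' : ∀ i, h i = h' i ∨ (¬ Degenerate (ownPart l c h i) (commonPart l c h i) ∧
      ¬ Degenerate (ownPart l c h' i) (commonPart l c h' i) ∧
      ownPart l c h i = ownPart l c h' i ∧ ∀ η,
      sk (row η l i) (rowNeighbors η l (commonPart l c h i ∪ ownPart l c h i)) =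
      sk (row η l i) (rowNeighbors η l (commonPart l c h' i ∪ ownPart l c h' i))) := by
    intro i
    have h1 := hobs i
    unfold Admissible.observe at h1
    split_ifs at h1 with h2 h3 h3
    · exact Or.inl (Sum.inr.inj h1)
    · right
      have h4 := Prod.mk.inj (Sum.inl.inj h1)
      exact ⟨h2, h3, h4.1, fun η => congrFun h4.2 η⟩
  have hh : ∀ i, h i = h' i ∨ (¬ Degenerate (ownPart l c h i) (commonPart l c h i) ∧
      ¬ Degenerate (ownPart l c h' i) (commonPart l c h' i) ∧
      ownPart l c h i = ownPart l c h' i) := fun i =>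
    (hobs' i).imp id fun h1 => ⟨h1.1, h1.2.1, h1.2.2.1⟩
  have hh' : ∀ i, h' i = h i ∨ (¬ Degenerate (ownPart l c h' i) (commonPart l c h' i) ∧
      ¬ Degenerate (ownPart l c h i) (commonPart l c h i) ∧
      ownPart l c h' i = ownPart l c h i) := fun i =>
    (hh i).imp Eq.symm fun h1 => ⟨h1.2.1, h1.1, h1.2.2.symm⟩
  have hgen : (∀ η i, v ≠ row η l i) → (∀ x, (c x).1 = l → v ≠ col x) →
      (gridGraph l k c z h).neighborSet v = (gridGraph l k c z h').neighborSet v := by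
    intro h1 h2
    ext w
    rw [SimpleGraph.mem_neighborSet, SimpleGraph.mem_neighborSet, gridGraph_adj, gridGraph_adj]
    have h3 : ∀ η i x, v = row η l i → w = col x → (c x).1 ≠ l := fun η i x h3 => absurd h3 (h1 η i)
    have h4 : ∀ η i x, w = row η l i → v = col x → (c x).1 ≠ l := fun η i x _ h5 h6 => h2 x h6 h5
    exact or_congr ⟨link_congr hh v w h3, link_congr hh' v w h3⟩
      ⟨link_congr hh w v h4, link_congr hh' w v h4⟩
  by_cases hc : ∃ x, (c x).1 = l ∧ v = col x
  · obtain ⟨x, hx, rfl⟩ := hc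
    exact hcol x hx
  by_cases hr : ∃ η i, v = row η l i
  · obtain ⟨η, i, rfl⟩ := hr
    rcases hobs' i with h1 | h1
    · congr 1
      ext w
      rw [SimpleGraph.mem_neighborSet, SimpleGraph.mem_neighborSet, gridGraph_adj, gridGraph_adj]
      cases w <;> simp only [Link, rowSet, ownPart, commonPart, h1]
    · rw [neighborSet_key_row h1.1, neighborSet_key_row h1.2.1]
      exact h1.2.2.2 η
  push Not at hc hr
  rw [hgen hr hc]

end Grid

open Vertex

/-! ### Mean lengths of the messages. -/

section Mean

variable {N u X : ℕ}

/-- The random data of a grid block with a given line of keys: the roles of the columns, the plain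
sets, and the hidden bits and key sets. -/
abbrev GridData (N u : ℕ) := (Column u → Role N) × (Fin (N + 1) → Fin N → Finset (Column u)) ×
  (Fin N → Bool × Finset (Column u))

/-- The law of a plain set, given the roles of the columns. -/
noncomputable def plainWeight (q φ : ℝ) (c : Column u → Role N) (a : Fin (N + 1))
    (S : Finset (Column u)) : ℝ := setLaw (fun x => if (c x).1 = a then q * (N + φ) else 0) S

/-- The law of the data of a grid block. -/
noncomputable def gridWeight (q φ : ℝ) (l : Fin (N + 1)) (t : GridData N u) : ℝ :=
  -- The plain sets for `a = l` are drawn as well, but no edge depends on them.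
  (∏ x, roleWeight φ l (t.1 x)) * ((∏ a, ∏ i, plainWeight q φ t.1 a (t.2.1 a i)) *
    ∏ i, hiddenWeight q φ l i t.1 (t.2.2 i))

theorem sum_gridWeight_mul (q φ : ℝ) (l : Fin (N + 1)) (F : GridData N u → ℝ) :
    ∑ t, gridWeight q φ l t * F t = ∑ c : Column u → Role N, (∏ x, roleWeight φ l (c x)) *
      ∑ z : Fin (N + 1) → Fin N → Finset (Column u), (∏ a, ∏ i, plainWeight q φ c a (z a i)) *
        ∑ h : Fin N → Bool × Finset (Column u), (∏ i, hiddenWeight q φ l i c (h i)) *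
          F (c, z, h) := by
  rw [Fintype.sum_prod_type]
  refine Finset.sum_congr rfl fun c _ => ?_
  rw [Fintype.sum_prod_type, Finset.mul_sum]
  refine Finset.sum_congr rfl fun z _ => ?_
  rw [Finset.mul_sum, Finset.mul_sum]
  refine Finset.sum_congr rfl fun h _ => ?_
  simp only [gridWeight]
  ring

/-- The mean of a function of the membership of a column in the sets of its line. -/
noncomputable def colMean (q φ : ℝ) (F : (Fin N → Bool) → ℝ) : ℝ :=
  ∑ v : Fin N → Bool, (∏ i, if v i = true then q * (N + φ) else 1 - q * (N + φ)) * F v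

namespace Admissible

variable {q φ : ℝ} (h : Admissible N q φ)
include h

theorem roles_nonneg (l : Fin (N + 1)) (c : Column u → Role N) :
    0 ≤ ∏ x, roleWeight φ l (c x) := Finset.prod_nonneg fun _ _ => (h.roleWeight_pos l _).le

theorem plainWeight_nonneg (c : Column u → Role N) (a : Fin (N + 1)) (S : Finset (Column u)) :
    0 ≤ plainWeight q φ c a S := by
  have h1 := mul_pos h.q_pos h.den_pos
  have h2 := h.small
  refine setLaw_nonneg (fun _ => ?_) (fun _ => ?_) S <;> split_ifs <;> linarith

theorem sum_plainWeight (c : Column u → Role N) (a : Fin (N + 1)) :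
    ∑ S, plainWeight q φ c a S = 1 := sum_setLaw _

theorem sum_plainWeights (c : Column u → Role N) :
    ∑ z : Fin (N + 1) → Fin N → Finset (Column u), ∏ a, ∏ i, plainWeight q φ c a (z a i) = 1 :=
  sum_pi_prod_eq_one (p := fun a (y : Fin N → Finset (Column u)) => ∏ i, plainWeight q φ c a (y i))
    fun a => sum_pi_prod_eq_one fun _ => h.sum_plainWeight c a

theorem sum_hiddenWeights (l : Fin (N + 1)) (c : Column u → Role N) :
    ∑ k : Fin N → Bool × Finset (Column u), ∏ i, hiddenWeight q φ l i c (k i) = 1 :=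
  sum_pi_prod_eq_one fun _ => h.sum_hiddenWeight l _ c

theorem sum_roles (l : Fin (N + 1)) :
    ∑ c : Column u → Role N, ∏ x, roleWeight φ l (c x) = 1 :=
  sum_pi_prod_eq_one fun _ => h.sum_roleWeight l

theorem gridWeight_nonneg (l : Fin (N + 1)) (t : GridData N u) : 0 ≤ gridWeight q φ l t :=
  mul_nonneg (h.roles_nonneg l _) (mul_nonneg
    (Finset.prod_nonneg fun a _ => Finset.prod_nonneg fun _ _ => h.plainWeight_nonneg _ a _)
    (Finset.prod_nonneg fun i _ => h.hiddenWeight_nonneg l i _ _))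

theorem sum_gridWeight (l : Fin (N + 1)) : ∑ t : GridData N u, gridWeight q φ l t = 1 := by
  have h1 := sum_gridWeight_mul q φ l fun _ : GridData N u => 1
  simpa only [mul_one, h.sum_hiddenWeights, h.sum_plainWeights, h.sum_roles] using h1

theorem sum_plainWeights_mul (c : Column u → Role N) (a : Fin (N + 1))
    (F : (Fin N → Finset (Column u)) → ℝ) :
    ∑ z : Fin (N + 1) → Fin N → Finset (Column u), (∏ a, ∏ i, plainWeight q φ c a (z a i)) *
      F (z a) = ∑ y : Fin N → Finset (Column u), (∏ i, plainWeight q φ c a (y i)) * F y :=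
  sum_pi_prod_mul
    (p := fun a (y : Fin N → Finset (Column u)) => ∏ i, plainWeight q φ c a (y i))
    (fun a => sum_pi_prod_eq_one fun _ => h.sum_plainWeight c a) a F

theorem colMean_nonneg {F : (Fin N → Bool) → ℝ} (hF : ∀ v, 0 ≤ F v) : 0 ≤ colMean q φ F := by
  have h1 := mul_pos h.q_pos h.den_pos
  have h2 := h.small
  refine Finset.sum_nonneg fun v _ => mul_nonneg (Finset.prod_nonneg fun _ _ => ?_) (hF v)
  split_ifs <;> linarith

/-- The columns on the line of the keys belong to the key sets independently. -/
theorem sum_hiddenWeights_line (l : Fin (N + 1)) {c : Column u → Role N} {x : Column u}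
    (hx : (c x).1 = l) (F : (Fin N → Bool) → ℝ) :
    ∑ k : Fin N → Bool × Finset (Column u), (∏ i, hiddenWeight q φ l i c (k i)) *
      F (fun i => decide (x ∈ commonPart l c k i)) = colMean q φ F := by
  rw [sum_pi_prod_map (fun i => hiddenWeight q φ l i c)
    (fun _ k => decide (x ∈ linePart l c k.1 k.2)) F, colMean]
  refine Finset.sum_congr rfl fun v _ => ?_
  congr 1
  refine Finset.prod_congr rfl fun i _ => ?_
  rw [Fintype.sum_prod_type]
  have h1 : ∀ b, ∑ S, (if decide (x ∈ linePart l c b S) = v i then hiddenWeight q φ l i c (b, S)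
      else 0) = 1 / 2 * if c x = (l, b ^^ x.1) then
        (if v i = true then 2 * (q * (N + φ)) else 1 - 2 * (q * (N + φ)))
        else if v i = true then 0 else 1 := by
    intro b
    by_cases hb : c x = (l, b ^^ x.1)
    · have h2 := sum_setLaw_ite (fun x => memProb q φ l i b x.1 (c x)) x
        (if v i = true then 1 else 0) (if v i = true then 0 else 1)
      have h3 : memProb q φ l i b x.1 (c x) = 2 * (q * (N + φ)) := by
        simp [memProb, hb, (Fin.succAbove_ne l i).symm]
      rw [h3] at h2
      rw [if_pos hb]
      calc _ = 1 / 2 * ∑ S, setLaw (fun x => memProb q φ l i b x.1 (c x)) S *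
            (if x ∈ S then (if v i = true then 1 else 0) else if v i = true then 0 else 1) := by
            rw [Finset.mul_sum]
            refine Finset.sum_congr rfl fun S _ => ?_
            simp only [linePart, Finset.mem_filter, hb, and_true, hiddenWeight]
            by_cases h4 : x ∈ S <;> cases v i <;> simp [h4]
        _ = _ := by
            rw [h2]; cases v i <;> simp
    · rw [if_neg hb]
      calc _ = 1 / 2 * ∑ S, setLaw (fun x => memProb q φ l i b x.1 (c x)) S *
            (if v i = true then 0 else 1) := by
            rw [Finset.mul_sum]
            refine Finset.sum_congr rfl fun S _ => ?_
            simp only [linePart, Finset.mem_filter, hb, and_false, hiddenWeight]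
            cases v i <;> simp
        _ = _ := by rw [← Finset.sum_mul, sum_setLaw, one_mul]
  -- Exactly one value of the bit admits the side of `x`, with membership probability `2 * (q * (N +
  -- φ))`; averaging over the bit leaves `q * (N + φ)`.
  simp only [h1]
  obtain ⟨β, hβ⟩ : ∃ β, c x = (l, β) := ⟨(c x).2, by rw [← hx]⟩
  rw [Fintype.sum_bool, hβ]
  simp only [Prod.mk.injEq, true_and]
  cases β <;> cases x.1 <;> cases v i <;> simp <;> ring

theorem sum_hiddenWeights_notMem (l : Fin (N + 1)) {c : Column u → Role N} {x : Column u}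
    {i : Fin N} (hx : (c x).1 = l.succAbove i) :
    1 / 2 ≤ ∑ k : Fin N → Bool × Finset (Column u), (∏ i, hiddenWeight q φ l i c (k i)) *
      (if x ∈ (k i).2 then 0 else 1) := by
  rw [sum_pi_prod_mul (fun i => h.sum_hiddenWeight l i c) i
    (fun k : Bool × Finset (Column u) => if x ∈ k.2 then (0 : ℝ) else 1), Fintype.sum_prod_type]
  have h1 : ∀ b, ∑ S, hiddenWeight q φ l i c (b, S) * (if x ∈ S then (0 : ℝ) else 1) =
      1 / 2 * (1 - (1 - φ) * (q * (N + φ))) := by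
    intro b
    have h2 := sum_setLaw_ite (fun x => memProb q φ l i b x.1 (c x)) x 0 1
    have h3 : memProb q φ l i b x.1 (c x) = (1 - φ) * (q * (N + φ)) := by
      simp [memProb, hx]
    rw [h3] at h2
    simp only [hiddenWeight, mul_assoc, ← Finset.mul_sum]
    rw [h2]; ring
  simp only [h1, Fintype.sum_bool]
  have h4 := mul_pos h.q_pos h.den_pos
  have h5 := h.small
  have h6 := h.φ_pos
  nlinarith

theorem sum_plainWeights_col (l : Fin (N + 1)) {c : Column u → Role N} {x : Column u} {i : Fin N}
    (hx : (c x).1 = l.succAbove i) (F : (Fin N → Bool) → ℝ) :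
    ∑ z : Fin (N + 1) → Fin N → Finset (Column u), (∏ a, ∏ i, plainWeight q φ c a (z a i)) *
      F (fun j => decide (x ∈ z (l.succAbove i) j)) = colMean q φ F := by
  rw [h.sum_plainWeights_mul c (l.succAbove i) fun y => F fun j => decide (x ∈ y j),
    sum_pi_prod_map (fun _ => plainWeight q φ c (l.succAbove i)) (fun _ S => decide (x ∈ S)) F,
    colMean]
  refine Finset.sum_congr rfl fun v _ => ?_
  congr 1
  refine Finset.prod_congr rfl fun j _ => ?_
  have h2 := sum_setLaw_ite (fun x => if (c x).1 = l.succAbove i then q * (N + φ) else 0) x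
    (if v j = true then 1 else 0) (if v j = true then 0 else 1)
  simp only [hx, if_true] at h2
  calc _ = ∑ S, setLaw (fun x => if (c x).1 = l.succAbove i then q * (N + φ) else 0) S *
        (if x ∈ S then (if v j = true then 1 else 0) else if v j = true then 0 else 1) := by
        refine Finset.sum_congr rfl fun S _ => ?_
        simp only [plainWeight]
        by_cases h4 : x ∈ S <;> cases v j <;> simp [h4]
    _ = _ := by rw [h2]; cases v j <;> simp

variable (sk : Vertex N u X → Set (Vertex N u X) → List Bool)

/-- The length of the message of a vertex. -/
abbrev msgLength (l : Fin (N + 1)) (k : Fin N) (t : GridData N u) (v : Vertex N u X) : ℝ :=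
  ((sk v ((gridGraph l k t.1 t.2.1 t.2.2).neighborSet v)).length : ℝ)

/-- The mean length of the messages of a row, for a random set of density `q`. -/
noncomputable def rowMean (q : ℝ) (a : Fin (N + 1)) (i : Fin N) : ℝ :=
  ∑ S : Finset (Column u), setLaw (fun _ => q) S *
    ∑ η, ((sk (row η a i) (rowNeighbors η a S)).length : ℝ)

/-- The mean length of the message of a column with a given role. -/
noncomputable def roleMean (q φ : ℝ) (x : Column u) (r : Role N) : ℝ :=
  colMean q φ fun v => ((sk (col x) (colNeighbors x r v)).length : ℝ)

theorem roleMean_nonneg (x : Column u) (r : Role N) : 0 ≤ roleMean sk q φ x r :=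
  h.colMean_nonneg fun _ => Nat.cast_nonneg _

theorem rowMean_nonneg (a : Fin (N + 1)) (i : Fin N) : 0 ≤ rowMean sk q a i :=
  Finset.sum_nonneg fun S _ => mul_nonneg (h.setLaw_nonneg_const S)
    (Finset.sum_nonneg fun _ _ => Nat.cast_nonneg _)

/-- Averaged over the roles, a plain set has density `q`. So plain rows pay, in message length, for
the information that the rows would give away if they were keys. -/
theorem sum_row_length (l : Fin (N + 1)) (k j i : Fin N) :
    ∑ t : GridData N u, gridWeight q φ l t * ∑ η, msgLength sk l k t (row η (l.succAbove j) i) =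
      rowMean sk q (l.succAbove j) i := by
  rw [sum_gridWeight_mul]
  have h1 : ∀ (c : Column u → Role N) (z : Fin (N + 1) → Fin N → Finset (Column u)),
      ∑ k' : Fin N → Bool × Finset (Column u), (∏ i, hiddenWeight q φ l i c (k' i)) *
        ∑ η, msgLength sk l k (c, z, k') (row η (l.succAbove j) i) =
      ∑ η, ((sk (row η (l.succAbove j) i) (rowNeighbors η (l.succAbove j)
        ((z (l.succAbove j) i).filter fun x => (c x).1 = l.succAbove j))).length : ℝ) := by
    intro c z
    simp only [msgLength, neighborSet_plain_row (Fin.succAbove_ne l j)]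
    rw [← Finset.sum_mul, h.sum_hiddenWeights, one_mul]
  simp only [h1]
  have h2 : ∀ c : Column u → Role N,
      ∑ z : Fin (N + 1) → Fin N → Finset (Column u), (∏ a, ∏ i, plainWeight q φ c a (z a i)) *
        ∑ η, ((sk (row η (l.succAbove j) i) (rowNeighbors η (l.succAbove j)
          ((z (l.succAbove j) i).filter fun x => (c x).1 = l.succAbove j))).length : ℝ) =
      ∑ S, plainWeight q φ c (l.succAbove j) S *
        ∑ η, ((sk (row η (l.succAbove j) i) (rowNeighbors η (l.succAbove j) S)).length : ℝ) := by
    intro c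
    rw [h.sum_plainWeights_mul c (l.succAbove j) fun y =>
      ∑ η, ((sk (row η (l.succAbove j) i) (rowNeighbors η (l.succAbove j)
          ((y i).filter fun x => (c x).1 = l.succAbove j))).length : ℝ)]
    rw [sum_pi_prod_mul (fun _ => h.sum_plainWeight c (l.succAbove j)) i fun S =>
      ∑ η, ((sk (row η (l.succAbove j) i) (rowNeighbors η (l.succAbove j)
          (S.filter fun x => (c x).1 = l.succAbove j))).length : ℝ)]
    refine Finset.sum_congr rfl fun S _ => ?_
    by_cases h0 : plainWeight q φ c (l.succAbove j) S = 0
    · rw [h0, zero_mul, zero_mul]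
    · have : S.filter (fun x => (c x).1 = l.succAbove j) = S := by
        refine Finset.filter_true_of_mem fun x hx => ?_
        by_contra hc
        exact prob_ne_zero_of_setLaw h0 hx (if_neg hc)
      rw [this]
  simp only [h2]
  exact h.sum_plainLaw l j _

theorem sum_line_col_length (l : Fin (N + 1)) (k : Fin N) (x : Column u) :
    ∑ t : GridData N u, gridWeight q φ l t *
      (if (t.1 x).1 = l then msgLength sk l k t (col x) else 0) =
    φ / (2 * (N + φ)) * (roleMean sk q φ x (l, true) + roleMean sk q φ x (l, false)) := by
  rw [sum_gridWeight_mul]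
  have h1 : ∀ (c : Column u → Role N),
      ∑ z : Fin (N + 1) → Fin N → Finset (Column u), (∏ a, ∏ i, plainWeight q φ c a (z a i)) *
      ∑ k' : Fin N → Bool × Finset (Column u), (∏ i, hiddenWeight q φ l i c (k' i)) *
        (if (c x).1 = l then msgLength sk l k (c, z, k') (col x) else 0) =
      if (c x).1 = l then roleMean sk q φ x (c x) else 0 := by
    intro c
    split_ifs with hx
    · simp only [msgLength, neighborSet_line_col hx]
      have := fun z : Fin (N + 1) → Fin N → Finset (Column u) => h.sum_hiddenWeights_line l hx
        fun v => ((sk (col x) (colNeighbors x (c x) v)).length : ℝ)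
      rw [Finset.sum_congr rfl fun z _ => by rw [this z], ← Finset.sum_mul, h.sum_plainWeights,
        one_mul]
      rfl
    · simp
  simp only [h1]
  rw [sum_pi_prod_mul (fun _ => h.sum_roleWeight l) x
    fun r => if r.1 = l then roleMean sk q φ x r else 0, h.sum_line]
  simp [Fin.succAbove_ne]

/-- Only the event that `x` is outside the key set of its line is counted. It has probability at
least `1 / 2` and is independent of the plain sets, hence `4 * (N + φ)` where the law of the roles
has `2 * (N + φ)`. -/
theorem sum_plain_col_length (l : Fin (N + 1)) (k : Fin N) (x : Column u) :
    ∑ i, 1 / (4 * (N + φ)) * (roleMean sk q φ x (l.succAbove i, true) +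
        roleMean sk q φ x (l.succAbove i, false)) ≤
    ∑ t : GridData N u, gridWeight q φ l t * msgLength sk l k t (col x) := by
  rw [sum_gridWeight_mul]
  have hinner : ∀ (c : Column u → Role N) (z : Fin (N + 1) → Fin N → Finset (Column u)),
      0 ≤ ∏ a, ∏ i, plainWeight q φ c a (z a i) := fun c z =>
    Finset.prod_nonneg fun a _ => Finset.prod_nonneg fun i _ => h.plainWeight_nonneg _ a _
  have hhid : ∀ (c : Column u → Role N) (k' : Fin N → Bool × Finset (Column u)),
      0 ≤ ∏ i, hiddenWeight q φ l i c (k' i) := fun c k' =>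
    Finset.prod_nonneg fun i _ => h.hiddenWeight_nonneg l i _ _
  have h1 : ∀ c : Column u → Role N,
      (if (c x).1 = l then 0 else 1 / 2 * roleMean sk q φ x (c x)) ≤
      ∑ z : Fin (N + 1) → Fin N → Finset (Column u), (∏ a, ∏ i, plainWeight q φ c a (z a i)) *
      ∑ k' : Fin N → Bool × Finset (Column u), (∏ i, hiddenWeight q φ l i c (k' i)) *
        msgLength sk l k (c, z, k') (col x) := by
    intro c
    split_ifs with hx
    · exact Finset.sum_nonneg fun z _ => mul_nonneg (hinner c z)
        (Finset.sum_nonneg fun k' _ => mul_nonneg (hhid c k') (Nat.cast_nonneg _))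
    · obtain ⟨i, hi⟩ := Fin.exists_succAbove_eq hx
      rw [roleMean, ← h.sum_plainWeights_col l hi.symm, Finset.mul_sum]
      refine Finset.sum_le_sum fun z _ => ?_
      rw [mul_left_comm]
      refine mul_le_mul_of_nonneg_left ?_ (hinner c z)
      calc _ ≤ (∑ k' : Fin N → Bool × Finset (Column u), (∏ i, hiddenWeight q φ l i c (k' i)) *
              (if x ∈ (k' i).2 then 0 else 1)) *
            ((sk (col x) (colNeighbors x (c x) fun j =>
              decide (x ∈ z (l.succAbove i) j))).length : ℝ) :=
            mul_le_mul_of_nonneg_right (h.sum_hiddenWeights_notMem l hi.symm) (Nat.cast_nonneg _)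
        _ ≤ _ := by
            rw [Finset.sum_mul]
            refine Finset.sum_le_sum fun k' _ => ?_
            rw [mul_assoc]
            refine mul_le_mul_of_nonneg_left ?_ (hhid c k')
            split_ifs with h2
            · rw [zero_mul]; exact Nat.cast_nonneg _
            · rw [one_mul, msgLength, neighborSet_plain_col hi.symm h2]
  refine le_trans (le_of_eq ?_) (Finset.sum_le_sum fun c _ =>
    mul_le_mul_of_nonneg_left (h1 c) (h.roles_nonneg l c))
  rw [sum_pi_prod_mul (fun _ => h.sum_roleWeight l) x
    fun r => if r.1 = l then 0 else 1 / 2 * roleMean sk q φ x r, h.sum_line]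
  simp only [if_true, Fin.succAbove_ne, if_false, add_zero, mul_zero, zero_add]
  have := h.den_pos
  refine Finset.sum_congr rfl fun i _ => ?_
  field_simp
  ring

theorem sum_line_col (l : Fin (N + 1)) (x : Column u) :
    ∑ t : GridData N u, gridWeight q φ l t * (if (t.1 x).1 = l then 1 else 0) = φ / (N + φ) := by
  rw [sum_gridWeight_mul]
  have h1 : ∀ (c : Column u → Role N) (y : ℝ),
      ∑ z : Fin (N + 1) → Fin N → Finset (Column u), (∏ a, ∏ i, plainWeight q φ c a (z a i)) *
        ∑ k' : Fin N → Bool × Finset (Column u), (∏ i, hiddenWeight q φ l i c (k' i)) * y = y := by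
    intro c y
    rw [← Finset.sum_mul, ← Finset.sum_mul, h.sum_hiddenWeights, h.sum_plainWeights, one_mul,
      one_mul]
  refine (Finset.sum_congr rfl fun c _ => congrArg _
    (h1 c (if (c x).1 = l then 1 else 0))).trans ?_
  rw [sum_pi_prod_mul (fun _ => h.sum_roleWeight l) x fun r => if r.1 = l then (1 : ℝ) else 0,
    h.sum_line]
  simp only [if_true, Fin.succAbove_ne, if_false]
  have := h.den_pos
  simp only [Finset.sum_const_zero, mul_zero, add_zero]
  field_simp
  norm_num

end Admissible

end Mean

open Vertex

/-! ### Errors and lengths at one level. -/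

section Level

theorem sum_succAbove {N : ℕ} (f : Fin (N + 1) → ℝ) :
    ∑ l : Fin (N + 1), ∑ i : Fin N, f (l.succAbove i) = N * ∑ a, f a := by
  have h1 : ∀ l : Fin (N + 1), ∑ i : Fin N, f (l.succAbove i) = ∑ a, f a - f l := fun l => by
    rw [Fin.sum_univ_succAbove f l]; ring
  simp only [h1]
  rw [Finset.sum_sub_distrib, Finset.sum_const, Finset.card_univ, Fintype.card_fin, nsmul_eq_mul]
  push_cast
  ring

variable {N u X : ℕ} (sk : Vertex N u X → Set (Vertex N u X) → List Bool)
  (ref : (Vertex N u X → List Bool) → Bool)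

/-- The answer of the referee on a grid block. -/
def gridAnswer (l : Fin (N + 1)) (k : Fin N) (t : GridData N u) : Bool :=
  ref fun v => sk v ((gridGraph l k t.1 t.2.1 t.2.2).neighborSet v)

/-- The messages of the two rows of a key, as a function of their set of columns. -/
def rowMessages (a : Fin (N + 1)) (i : Fin N) (S : Finset (Column u)) (η : Bool) : List Bool :=
  sk (row η a i) (rowNeighbors η a S)

open Classical in
/-- The weights of the sets for which the rows of a key send a given pair of messages. -/
noncomputable def messageWeight (q : ℝ) (a : Fin (N + 1)) (i : Fin N) (m : Bool → List Bool)
    (S : Finset (Column u)) : ℝ :=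
  if rowMessages sk a i S = m then setLaw (fun _ => q) S else 0

/-- A bound on the probability that a key set is degenerate. -/
noncomputable def degenerateBound (q φ : ℝ) (u : ℕ) : ℝ :=
  2 * (1 - (1 - φ) * q) ^ u + 2 * (1 - φ * q) ^ u

namespace Admissible

variable {q φ : ℝ} (h : Admissible N q φ)
include h

open Classical in
-- Here `sum_bayesError_le` is applied to the `N` keys, given the roles and the plain sets. The
-- common message consists of the messages of the columns on `l`, whose neighborhoods do not depend
-- on the key at the source, so they can be read off with any `k₀`. By `messages_eq` these and the
-- observations determine the answers for all the keys.
theorem sum_bayesError_le_wrong (l : Fin (N + 1)) (k₀ : Fin N) (c : Column u → Role N)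
    (z : Fin (N + 1) → Fin N → Finset (Column u)) :
    (1 - Real.exp (-1)) * ∑ i, bayesError (hiddenWeight q φ l i c) Prod.fst
        (observe Degenerate (rowMessages sk l i) l i c) ≤
      ∑ k' : Fin N → Bool × Finset (Column u), (∏ i, hiddenWeight q φ l i c (k' i)) *
        ((∑ i, if gridAnswer sk ref l i (c, z, k') ≠ (k' i).1 then 1 else 0) +
          Real.log 2 * ∑ x, if (c x).1 = l then
            2 * msgLength sk l k₀ (c, z, k') (col x) + 1 else 0) := by
  set μ : (Fin N → Bool × Finset (Column u)) → {x // (c x).1 = l} → List Bool := fun k' x =>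
    sk (col x) (colNeighbors x (c x) fun i => decide (x.1 ∈ commonPart l c k' i)) with hμ
  have hμ' : ∀ k' k (x : {x // (c x).1 = l}),
      sk (col x) ((gridGraph l k c z k').neighborSet (col x)) = μ k' x := fun k' k x => by
    rw [neighborSet_line_col x.2]
  refine (sum_bayesError_le (p := fun i => hiddenWeight q φ l i c)
    (fun i => h.hiddenWeight_nonneg l i c) (fun i => h.sum_hiddenWeight l i c) Prod.fst
    (fun i => observe Degenerate (rowMessages sk l i) l i c) μ
    (w := fun m => ∏ x, codeWeight (m x))
    (fun m => Finset.prod_pos fun x _ => codeWeight_pos _) sum_prod_codeWeight_le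
    (fun i k' => gridAnswer sk ref l i (c, z, k')) ?_).trans (le_of_eq ?_)
  · intro k' k'' hobs hcol i
    unfold gridAnswer
    congr 1
    funext v
    refine messages_eq sk hobs (fun x hx => ?_) v
    rw [hμ' k' i ⟨x, hx⟩, hμ' k'' i ⟨x, hx⟩, hcol]
  · refine Finset.sum_congr rfl fun k' _ => ?_
    rw [sub_eq_add_neg]
    congr 2
    rw [Real.log_prod (fun x _ => (codeWeight_pos _).ne'), ← Finset.sum_neg_distrib,
      ← Finset.sum_filter, Finset.mul_sum, Finset.sum_subtype (Finset.univ.filter fun x => (c x).1 = l)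
        (p := fun x => (c x).1 = l) (by simp)]
    refine Finset.sum_congr rfl fun x _ => ?_
    rw [neg_log_codeWeight, msgLength, hμ' k' k₀ x]
    ring

open Classical in
/-- The errors on the blocks with a given line of keys, compared with the Bayes errors of the
channels and the lengths of the messages of the columns on this line. -/
theorem sum_thinBayes_le_wrong (l : Fin (N + 1)) (k₀ : Fin N) :
    (1 - Real.exp (-1)) * ∑ i, (∑ m ∈ Finset.univ.image (rowMessages sk l i),
        (h.channel l i).thinBayes φ ∅ (messageWeight sk q l i m) - degenerateBound q φ u) ≤
      ∑ t : GridData N u, gridWeight q φ l t *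
        ((∑ i, if gridAnswer sk ref l i t ≠ (t.2.2 i).1 then 1 else 0) +
          Real.log 2 * ∑ x, if (t.1 x).1 = l then 2 * msgLength sk l k₀ t (col x) + 1 else 0) := by
  have hc0 : 0 ≤ 1 - Real.exp (-1) := by
    have : Real.exp (-1) ≤ 1 := Real.exp_le_one_iff.2 (by norm_num)
    linarith
  rw [sum_gridWeight_mul]
  have h1 : ∀ c : Column u → Role N,
      (1 - Real.exp (-1)) * ∑ i, bayesError (hiddenWeight q φ l i c) Prod.fst
        (observe Degenerate (rowMessages sk l i) l i c) ≤
      ∑ z : Fin (N + 1) → Fin N → Finset (Column u), (∏ a, ∏ i, plainWeight q φ c a (z a i)) *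
        ∑ k' : Fin N → Bool × Finset (Column u), (∏ i, hiddenWeight q φ l i c (k' i)) *
        ((∑ i, if gridAnswer sk ref l i (c, z, k') ≠ (k' i).1 then 1 else 0) +
          Real.log 2 * ∑ x, if (c x).1 = l then
            2 * msgLength sk l k₀ (c, z, k') (col x) + 1 else 0) := by
    intro c
    refine le_trans (le_of_eq ?_) (Finset.sum_le_sum fun z _ => mul_le_mul_of_nonneg_left
      (h.sum_bayesError_le_wrong sk ref l k₀ c z)
      (Finset.prod_nonneg fun a _ => Finset.prod_nonneg fun i _ => h.plainWeight_nonneg _ a _))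
    rw [← Finset.sum_mul, h.sum_plainWeights, one_mul]
  refine le_trans ?_ (Finset.sum_le_sum fun c _ => mul_le_mul_of_nonneg_left (h1 c)
    (h.roles_nonneg l c))
  have h2 : ∑ c : Column u → Role N, (∏ x, roleWeight φ l (c x)) * ((1 - Real.exp (-1)) *
      ∑ i, bayesError (hiddenWeight q φ l i c) Prod.fst
        (observe Degenerate (rowMessages sk l i) l i c)) =
      (1 - Real.exp (-1)) * ∑ i, ∑ c : Column u → Role N, (∏ x, roleWeight φ l (c x)) *
        bayesError (hiddenWeight q φ l i c) Prod.fst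
          (observe Degenerate (rowMessages sk l i) l i c) := by
    rw [Finset.sum_comm, Finset.mul_sum]
    refine Finset.sum_congr rfl fun c _ => ?_
    rw [← Finset.mul_sum]; ring
  rw [h2]
  refine mul_le_mul_of_nonneg_left (Finset.sum_le_sum fun i _ => ?_) hc0
  refine le_trans ?_ (h.sum_thinBayes_le Degenerate (rowMessages sk l i) l i)
  exact sub_le_sub (le_of_eq (Finset.sum_congr rfl fun m _ => rfl)) (h.sum_degenerate_le l i)

/-- The columns on the line of the keys send only a small part of all the messages. -/
theorem sum_line_length_le (k : Fin (N + 1) → Fin N) :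
    ∑ l, ∑ t : GridData N u, gridWeight q φ l t *
      ∑ x, (if (t.1 x).1 = l then 2 * msgLength sk l (k l) t (col x) + 1 else 0) ≤
    4 * φ / N * ∑ l, ∑ t : GridData N u, gridWeight q φ l t * ∑ x, msgLength sk l (k l) t (col x) +
      (N + 1) * (2 * u) * (φ / N) := by
  have hden := h.den_pos
  have hφ := h.φ_pos
  have hN := h.one_le_cast
  -- Summed over `l`, the columns on the line `l` send `φ / (2 * (N + φ)) * L` bits, and all the
  -- columns send at least `N / (4 * (N + φ)) * L`.
  set L : ℝ := ∑ a, ∑ x, (roleMean sk q φ x (a, true) + roleMean sk q φ x (a, false)) with hL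
  have hL0 : 0 ≤ L := Finset.sum_nonneg fun a _ => Finset.sum_nonneg fun x _ =>
    add_nonneg (h.roleMean_nonneg sk _ _) (h.roleMean_nonneg sk _ _)
  have h1 : ∀ l : Fin (N + 1), ∑ t : GridData N u, gridWeight q φ l t *
      ∑ x, (if (t.1 x).1 = l then 2 * msgLength sk l (k l) t (col x) + 1 else 0) =
      φ / (N + φ) * ∑ x, (roleMean sk q φ x (l, true) + roleMean sk q φ x (l, false)) +
        2 * u * (φ / (N + φ)) := by
    intro l
    have h2 : ∀ t : GridData N u, gridWeight q φ l t *
      ∑ x, (if (t.1 x).1 = l then 2 * msgLength sk l (k l) t (col x) + 1 else 0) =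
      ∑ x, (2 * (gridWeight q φ l t * (if (t.1 x).1 = l then msgLength sk l (k l) t (col x) else 0))
        + gridWeight q φ l t * (if (t.1 x).1 = l then 1 else 0)) := by
      intro t
      rw [Finset.mul_sum]
      refine Finset.sum_congr rfl fun x _ => ?_
      split_ifs <;> ring
    simp only [h2]
    rw [Finset.sum_comm]
    simp only [Finset.sum_add_distrib, ← Finset.mul_sum, h.sum_line_col_length, h.sum_line_col]
    rw [Finset.sum_const, Finset.card_univ, Fintype.card_prod, Fintype.card_bool, Fintype.card_fin,
      nsmul_eq_mul]
    push_cast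
    field_simp
  have h3 : N * (1 / (4 * (N + φ)) * L) ≤ ∑ l, ∑ t : GridData N u, gridWeight q φ l t *
      ∑ x, msgLength sk l (k l) t (col x) := by
    have h4 : ∀ l : Fin (N + 1), ∑ i, 1 / (4 * (N + φ)) * ∑ x,
        (roleMean sk q φ x (l.succAbove i, true) + roleMean sk q φ x (l.succAbove i, false)) ≤
        ∑ t : GridData N u, gridWeight q φ l t * ∑ x, msgLength sk l (k l) t (col x) := by
      intro l
      simp only [Finset.mul_sum]
      rw [Finset.sum_comm, Finset.sum_comm (s := (Finset.univ : Finset (GridData N u)))]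
      exact Finset.sum_le_sum fun x _ => h.sum_plain_col_length sk l (k l) x
    refine le_trans (le_of_eq ?_) (Finset.sum_le_sum fun l _ => h4 l)
    rw [sum_succAbove fun a => 1 / (4 * (N + φ)) * ∑ x,
        (roleMean sk q φ x (a, true) + roleMean sk q φ x (a, false)), ← Finset.mul_sum]
  simp only [h1]
  rw [Finset.sum_add_distrib, ← Finset.mul_sum, Finset.sum_const, Finset.card_univ,
    Fintype.card_fin, nsmul_eq_mul]
  have h5 := mul_le_mul_of_nonneg_left h3 (by positivity : 0 ≤ 4 * φ / N)
  have h6 : 4 * φ / N * (N * (1 / (4 * (N + φ)) * L)) = φ / (N + φ) * L := by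
    field_simp
  have h7 : φ / (N + φ) ≤ φ / N := by gcongr; linarith
  have h8 : ((N + 1 : ℕ) : ℝ) * (2 * u * (φ / (N + φ))) ≤ (N + 1) * (2 * u) * (φ / N) := by
    push_cast
    rw [← mul_assoc]
    gcongr
  linarith

/-- The rows send messages of at least their mean lengths. -/
theorem sum_rowMean_le (k : Fin (N + 1) → Fin N) :
    N * ∑ a, ∑ i, rowMean sk q a i ≤ ∑ l, ∑ t : GridData N u, gridWeight q φ l t *
      ∑ a, ∑ i, ∑ η, msgLength sk l (k l) t (row η a i) := by
  rw [← sum_succAbove fun a => ∑ i, rowMean sk q a i]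
  refine Finset.sum_le_sum fun l _ => ?_
  calc ∑ j, ∑ i, rowMean sk q (l.succAbove j) i
      = ∑ t : GridData N u, gridWeight q φ l t *
        ∑ j, ∑ i, ∑ η, msgLength sk l (k l) t (row η (l.succAbove j) i) := by
        simp only [← h.sum_row_length sk l (k l)]
        rw [Finset.sum_congr rfl fun j _ => Finset.sum_comm, Finset.sum_comm]
        refine Finset.sum_congr rfl fun t _ => ?_
        simp only [Finset.mul_sum]
    _ ≤ _ := by
        refine Finset.sum_le_sum fun t _ => mul_le_mul_of_nonneg_left ?_ (h.gridWeight_nonneg l t)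
        rw [Fin.sum_univ_succAbove _ l]
        have : 0 ≤ ∑ i, ∑ η, msgLength sk l (k l) t (row η l i) :=
          Finset.sum_nonneg fun i _ => Finset.sum_nonneg fun η _ => Nat.cast_nonneg _
        linarith

end Admissible

end Level

open Vertex

/-! ### Combination of all the levels. -/

section Rates

variable {N u X : ℕ}

/-- The parameters of the distribution on grid blocks: the density `q`, the rates `φ₀ * r ^ j` of
the levels `j < J`, and the constants of the main inequality. -/
structure Rates (N : ℕ) where
  q : ℝ
  φ₀ : ℝ
  φ₁ : ℝ
  r : ℝ
  t : ℝ
  a : ℝ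
  C : ℝ
  q' : ℝ
  J : ℕ
  adm : ∀ j : ℕ, Admissible N q (φ₀ * r ^ j)
  r_pos : 0 < r
  r_lt : r < 1
  t_pos : 0 < t
  a_nonneg : 0 ≤ a
  C_nonneg : 0 ≤ C
  sum_log : ∀ D : ℕ, ∑ d ∈ Finset.range D, -Real.log (1 - r ^ (d + 1)) ≤ C * t
  φ₁_pos : 0 < φ₁
  φ₁_le : ∀ j < J, φ₁ ≤ φ₀ * r ^ j
  q'_pos : 0 < q'
  one_le_log : 1 ≤ Real.log (q' / (q / (1 - q) * φ₀))
  gain : (1 + C) / 4 ≤ a * (Real.log (q' / (q / (1 - q) * φ₀)) - 1)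

namespace Rates

variable (R : Rates N)

theorem adm₀ : Admissible N R.q R.φ₀ := by simpa using R.adm 0

theorem q_lt_one : R.q < 1 := by have := R.adm₀.q_le; linarith

/-- The rate of a level. -/
noncomputable def φ (j : ℕ) : ℝ := R.φ₀ * R.r ^ j

/-- The loss in the Bayes error for spread weights on sets with `k` elements. -/
noncomputable def loss (u k : ℕ) : ℝ :=
  (1 + 4 * R.q ^ 2 * (N + 1)) ^ Fintype.card (Column u) * (1 + 4 * (N + 1) / R.φ₁ * R.q') ^ k - 1

/-- The mean loss in the Bayes error. -/
noncomputable def meanLoss (u : ℕ) : ℝ :=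
  (1 + 4 * R.q ^ 2 * (N + 1)) ^ (2 * u) * (1 + R.q * (4 * (N + 1) / R.φ₁ * R.q')) ^ (2 * u) - 1

theorem loss_mono (u : ℕ) : Monotone (R.loss u) := by
  intro k k' hk
  have h1 := R.φ₁_pos
  have h2 := R.q'_pos
  have h3 : 1 ≤ 1 + 4 * ((N : ℝ) + 1) / R.φ₁ * R.q' := by
    have : 0 < 4 * ((N : ℝ) + 1) / R.φ₁ * R.q' := by positivity
    linarith
  unfold loss
  gcongr

theorem loss_nonneg (u k : ℕ) : 0 ≤ R.loss u k := by
  refine le_trans ?_ (R.loss_mono u (Nat.zero_le k))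
  have : (1 : ℝ) ≤ (1 + 4 * R.q ^ 2 * (N + 1)) ^ Fintype.card (Column u) :=
    one_le_pow₀ (by have : 0 ≤ 4 * R.q ^ 2 * ((N : ℝ) + 1) := by positivity
                    linarith)
  simp only [loss, pow_zero, mul_one]
  linarith

theorem sum_setLaw_loss :
    ∑ S : Finset (Column u), setLaw (fun _ => R.q) S * R.loss u #S = R.meanLoss u := by
  have h1 : ∀ S : Finset (Column u), setLaw (fun _ => R.q) S * R.loss u #S =
      (1 + 4 * R.q ^ 2 * (N + 1)) ^ Fintype.card (Column u) *
        (∏ x, if x ∈ S then R.q * (1 + 4 * (N + 1) / R.φ₁ * R.q') else 1 - R.q) -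
      setLaw (fun _ => R.q) S := by
    intro S
    rw [loss, ← prod_mem_pow S (1 + 4 * (N + 1) / R.φ₁ * R.q'), mul_sub, mul_one, mul_left_comm,
      setLaw, ← Finset.prod_mul_distrib]
    congr 2
    refine Finset.prod_congr rfl fun x _ => ?_
    split_ifs <;> ring
  simp only [h1]
  rw [Finset.sum_sub_distrib, ← Finset.mul_sum, sum_set_prod, sum_setLaw, Finset.prod_const,
    Finset.card_univ, meanLoss, Fintype.card_prod, Fintype.card_bool, Fintype.card_fin]
  congr 3
  ring

/-- The channels of a key set at the different levels. -/
noncomputable def levels (l : Fin (N + 1)) (i : Fin N) : Levels (Column u) (Role N) where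
  K j := (R.adm j).channel l i
  J := R.J
  r := R.r
  t := R.t
  a := R.a
  -- Density `q` means odds `q / (1 - q)`, and the initial thinning multiplies them by `φ₀`.
  o := R.q / (1 - R.q) * R.φ₀
  q := R.q'
  C := R.C
  ρ W := R.loss u #W
  r_pos := R.r_pos
  r_lt := R.r_lt
  t_pos := R.t_pos
  a_nonneg := R.a_nonneg
  o_pos := mul_pos (div_pos R.adm₀.q_pos (sub_pos.2 R.q_lt_one)) R.adm₀.φ_pos
  q_pos := R.q'_pos
  C_nonneg := R.C_nonneg
  sum_log := R.sum_log
  one_le_log := R.one_le_log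
  gain := R.gain
  ρ_nonneg W := R.loss_nonneg u #W
  ρ_mono _ _ h := R.loss_mono u (Finset.card_le_card h)
  spread j hj T _ hg _ hs :=
    (R.adm j).spread_le_bayes l i R.φ₁_pos (R.φ₁_le j hj) R.q'_pos.le T hg hs

variable (sk : Vertex N u X → Set (Vertex N u X) → List Bool)

theorem sum_messageWeight (l : Fin (N + 1)) (i : Fin N) (F : Finset (Column u) → ℝ) :
    ∑ m ∈ Finset.univ.image (rowMessages sk l i), ∑ S, messageWeight sk R.q l i m S * F S =
      ∑ S, setLaw (fun _ => R.q) S * F S := by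
  classical
  rw [Finset.sum_comm]
  refine Finset.sum_congr rfl fun S _ => ?_
  rw [← Finset.sum_mul]
  congr 1
  unfold messageWeight
  rw [Finset.sum_ite_eq, if_pos (Finset.mem_image_of_mem _ (Finset.mem_univ S))]

/-- The Bayes errors of a key set, summed over the levels. -/
theorem le_sum_thinBayes (l : Fin (N + 1)) (i : Fin N) :
    Real.exp (-R.t) * (R.J / 4 - R.a * (Real.log 2 * (2 * Admissible.rowMean sk R.q l i + 2))) -
        R.J * R.meanLoss u ≤
      ∑ j ∈ Finset.range R.J, ∑ m ∈ Finset.univ.image (rowMessages sk l i),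
        ((R.adm j).channel l i).thinBayes (R.φ j) ∅ (messageWeight sk R.q l i m) := by
  classical
  have hq := R.q_lt_one
  have hqpos := R.adm₀.q_pos
  have h0 : ∀ m S, 0 ≤ messageWeight sk R.q l i m S := fun m S => by
    unfold messageWeight; split_ifs
    exacts [R.adm₀.setLaw_nonneg_const S, le_rfl]
  -- For each message `m`, the weights of the sets that lead to `m` are dominated by the law of the
  -- set itself, so `κ = 1`. Summed over `m`, the entropy terms give the entropy of the message.
  have h1 : ∀ m ∈ Finset.univ.image (rowMessages sk l i), _ := fun m _ =>
    (R.levels (u := u) l i).le_sum_thinBayes (φ := R.φ₀) (κ := 1) R.adm₀.φ_pos.le R.adm₀.φ_le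
      (o₀ := R.q / (1 - R.q)) (div_nonneg hqpos.le (by linarith)) rfl (h0 m) zero_le_one
      (fun W => by
        rw [one_mul, ← setLaw_const hq]
        unfold messageWeight; split_ifs
        exacts [le_rfl, R.adm₀.setLaw_nonneg_const W])
  have h2 := Finset.sum_le_sum h1
  rw [Finset.sum_comm (s := Finset.univ.image (rowMessages sk l i))] at h2
  refine le_trans ?_ h2
  have hmass := R.sum_messageWeight sk l i fun _ => 1
  simp only [mul_one, sum_setLaw] at hmass
  have hloss := R.sum_messageWeight sk l i fun S => R.loss u #S
  rw [R.sum_setLaw_loss] at hloss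
  have hent := entropy_messages_le (fun S : Finset (Column u) => R.adm₀.setLaw_nonneg_const S)
    (sum_setLaw _) (rowMessages sk l i)
  have hlen : ∑ S : Finset (Column u), setLaw (fun _ => R.q) S *
      ∑ η, (2 * ((rowMessages sk l i S η).length : ℝ) + 1) = 2 * Admissible.rowMean sk R.q l i + 2 := by
    have : ∀ S : Finset (Column u), setLaw (fun _ => R.q) S *
        ∑ η, (2 * ((rowMessages sk l i S η).length : ℝ) + 1) =
        2 * (setLaw (fun _ => R.q) S *
          ∑ η, ((sk (row η l i) (rowNeighbors η l S)).length : ℝ)) +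
            2 * setLaw (fun _ => R.q) S := by
      intro S
      simp only [Fintype.sum_bool, rowMessages]
      ring
    simp only [this]
    rw [Finset.sum_add_distrib, ← Finset.mul_sum, ← Finset.mul_sum, sum_setLaw, Admissible.rowMean]
    ring
  rw [hlen] at hent
  have hent' : ∑ m ∈ Finset.univ.image (rowMessages sk l i),
      (∑ S, messageWeight sk R.q l i m S) * Real.log (1 / ∑ S, messageWeight sk R.q l i m S) ≤
      Real.log 2 * (2 * Admissible.rowMean sk R.q l i + 2) := by
    refine le_trans (le_of_eq (Finset.sum_congr rfl fun m _ => ?_)) hent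
    unfold messageWeight
    congr!
  rw [Finset.sum_sub_distrib, ← Finset.mul_sum, Finset.sum_sub_distrib, ← Finset.sum_mul,
    ← Finset.mul_sum, ← Finset.mul_sum]
  change _ ≤ Real.exp (-R.t) * ((∑ m ∈ _, ∑ S, messageWeight sk R.q l i m S) * (R.J / 4) -
    R.a * _) - R.J * ∑ m ∈ _, ∑ S, messageWeight sk R.q l i m S * R.loss u #S
  rw [hmass, hloss, one_mul]
  have h3 := mul_le_mul_of_nonneg_left hent' R.a_nonneg
  have h4 := (Real.exp_pos (-R.t)).le
  gcongr

variable (ref : (Vertex N u X → List Bool) → Bool)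

/-- The mean over the grid blocks of a level and the lines and keys, before normalization. -/
noncomputable def levelSum (j : ℕ) (F : Fin (N + 1) → Fin N → GridData N u → ℝ) : ℝ :=
  ∑ l, ∑ k, ∑ t : GridData N u, gridWeight R.q (R.φ j) l t * F l k t

open Classical in
/-- The indicator of a wrong answer. -/
noncomputable def wrong (l : Fin (N + 1)) (k : Fin N) (t : GridData N u) : ℝ :=
  if gridAnswer sk ref l k t ≠ (t.2.2 k).1 then 1 else 0

/-- The total length of the messages. -/
noncomputable def totalLength (l : Fin (N + 1)) (k : Fin N) (t : GridData N u) : ℝ :=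
  ∑ v, Admissible.msgLength sk l k t v

theorem φ_le_φ₀ (j : ℕ) : R.φ j ≤ R.φ₀ :=
  mul_le_of_le_one_right R.adm₀.φ_pos.le (pow_le_one₀ R.r_pos.le R.r_lt.le)

theorem admφ (j : ℕ) : Admissible N R.q (R.φ j) := R.adm j

/-- The errors at one level. -/
theorem level_bound (j : ℕ) :
    (1 - Real.exp (-1)) * ∑ l, ∑ i, (∑ m ∈ Finset.univ.image (rowMessages sk l i),
        ((R.adm j).channel l i).thinBayes (R.φ j) ∅ (messageWeight sk R.q l i m) -
          degenerateBound R.q (R.φ j) u) ≤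
      R.levelSum j (wrong sk ref) + 4 * R.φ₀ / N ^ 2 * R.levelSum j (totalLength sk) +
        (N + 1) * (2 * u) * (R.φ₀ / N) := by
  have h := R.admφ j
  have hN := h.one_le_cast
  have hφ := h.φ_pos
  have hφle := R.φ_le_φ₀ j
  have hlog : Real.log 2 ≤ 1 := by
    have := Real.log_two_lt_d9; linarith
  have hlog0 : 0 ≤ Real.log 2 := Real.log_nonneg (by norm_num)
  set B := (1 - Real.exp (-1)) * ∑ l, ∑ i, (∑ m ∈ Finset.univ.image (rowMessages sk l i),
        ((R.adm j).channel l i).thinBayes (R.φ j) ∅ (messageWeight sk R.q l i m) -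
          degenerateBound R.q (R.φ j) u) with hB
  set W := R.levelSum j (wrong sk ref) with hW
  set colLen : Fin N → ℝ := fun k => ∑ l, ∑ t : GridData N u, gridWeight R.q (R.φ j) l t *
    ∑ x, Admissible.msgLength sk l k t (col x) with hcolLen
  have hcol0 : ∀ k, 0 ≤ colLen k := fun k => Finset.sum_nonneg fun l _ => Finset.sum_nonneg
    fun t _ => mul_nonneg (h.gridWeight_nonneg l t) (Finset.sum_nonneg fun x _ => Nat.cast_nonneg _)
  -- The left side does not involve `k`. Averaging over `k` makes the column lengths part of
  -- `levelSum`, which runs over the keys as well.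
  have h1 : ∀ k, B ≤ W + 4 * R.φ₀ / N * colLen k + (N + 1) * (2 * u) * (R.φ₀ / N) := by
    intro k
    have h2 := Finset.sum_le_sum fun l (_ : l ∈ Finset.univ) =>
      h.sum_thinBayes_le_wrong sk ref l k
    rw [← Finset.mul_sum] at h2
    refine h2.trans ?_
    have h3 : ∀ l, ∑ t : GridData N u, gridWeight R.q (R.φ j) l t *
        ((∑ i, if gridAnswer sk ref l i t ≠ (t.2.2 i).1 then 1 else 0) +
          Real.log 2 * ∑ x, if (t.1 x).1 = l then 2 * Admissible.msgLength sk l k t (col x) + 1 else 0) =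
        ∑ k, ∑ t : GridData N u, gridWeight R.q (R.φ j) l t * wrong sk ref l k t +
        Real.log 2 * ∑ t : GridData N u, gridWeight R.q (R.φ j) l t *
          ∑ x, if (t.1 x).1 = l then 2 * Admissible.msgLength sk l k t (col x) + 1 else 0 := by
      intro l
      rw [Finset.sum_comm, Finset.mul_sum, ← Finset.sum_add_distrib]
      refine Finset.sum_congr rfl fun t _ => ?_
      rw [← Finset.mul_sum, mul_add]
      unfold wrong
      ring
    simp only [h3]
    rw [Finset.sum_add_distrib, ← Finset.mul_sum]
    have h4 := h.sum_line_length_le sk fun _ => k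
    have h5 : 4 * R.φ j / N * colLen k + (N + 1) * (2 * u) * (R.φ j / N) ≤
        4 * R.φ₀ / N * colLen k + (N + 1) * (2 * u) * (R.φ₀ / N) := by
      have := hcol0 k
      gcongr
    have h6 : 0 ≤ 4 * R.φ₀ / N * colLen k + (N + 1) * (2 * u) * (R.φ₀ / N) := by
      have := hcol0 k
      have := R.adm₀.φ_pos
      positivity
    have h7 := mul_le_mul_of_nonneg_left (h4.trans h5) hlog0
    have h8 := mul_le_mul_of_nonneg_right hlog h6
    change W + _ ≤ _
    linarith
  have h2 := Finset.sum_le_sum fun k (_ : k ∈ (Finset.univ : Finset (Fin N))) => h1 k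
  rw [Finset.sum_const, Finset.card_univ, Fintype.card_fin, nsmul_eq_mul, Finset.sum_add_distrib,
    Finset.sum_add_distrib, Finset.sum_const, Finset.sum_const, Finset.card_univ, Fintype.card_fin,
    nsmul_eq_mul, nsmul_eq_mul, ← Finset.mul_sum] at h2
  have h3 : ∑ k, colLen k ≤ R.levelSum j (totalLength sk) := by
    rw [hcolLen, levelSum, Finset.sum_comm]
    refine Finset.sum_le_sum fun l _ => Finset.sum_le_sum fun k _ => Finset.sum_le_sum fun t _ =>
      mul_le_mul_of_nonneg_left ?_ (h.gridWeight_nonneg l t)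
    have h4 := sum_col_add_sum_row_le (f := fun v => Admissible.msgLength sk l k t v)
      fun v => Nat.cast_nonneg _
    have h5 : 0 ≤ ∑ a, ∑ i, ∑ η, Admissible.msgLength sk l k t (row η a i) :=
      Finset.sum_nonneg fun _ _ => Finset.sum_nonneg fun _ _ => Finset.sum_nonneg fun _ _ =>
        Nat.cast_nonneg _
    unfold totalLength
    linarith
  have h4 : 4 * R.φ₀ / N * ∑ k, colLen k ≤ 4 * R.φ₀ / N * R.levelSum j (totalLength sk) :=
    mul_le_mul_of_nonneg_left h3 (by have := R.adm₀.φ_pos; positivity)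
  have h5 : 4 * R.φ₀ / N * R.levelSum j (totalLength sk) =
      N * (4 * R.φ₀ / N ^ 2 * R.levelSum j (totalLength sk)) := by
    field_simp
  have h6 : (N : ℝ) * B ≤ N * (W + 4 * R.φ₀ / N ^ 2 * R.levelSum j (totalLength sk) +
      (N + 1) * (2 * u) * (R.φ₀ / N)) := by linarith
  exact le_of_mul_le_mul_left h6 (by linarith)

theorem rowMean_le (j : ℕ) :
    N ^ 2 * ∑ a, ∑ i, Admissible.rowMean sk R.q a i ≤ R.levelSum j (totalLength sk) := by
  have h := R.admφ j
  have h1 : ∀ k : Fin N, _ := fun k => h.sum_rowMean_le sk fun _ => k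
  have h2 := Finset.sum_le_sum fun k (_ : k ∈ (Finset.univ : Finset (Fin N))) => h1 k
  rw [Finset.sum_const, Finset.card_univ, Fintype.card_fin, nsmul_eq_mul] at h2
  rw [sq, mul_assoc]
  refine h2.trans ?_
  rw [levelSum, Finset.sum_comm]
  refine Finset.sum_le_sum fun l _ => Finset.sum_le_sum fun k _ => Finset.sum_le_sum fun t _ =>
    mul_le_mul_of_nonneg_left ?_ (h.gridWeight_nonneg l t)
  have h4 := sum_col_add_sum_row_le (f := fun v => Admissible.msgLength sk l k t v)
    fun v => Nat.cast_nonneg _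
  have h5 : 0 ≤ ∑ x, Admissible.msgLength sk l k t (col x) :=
    Finset.sum_nonneg fun _ _ => Nat.cast_nonneg _
  unfold totalLength
  linarith

/-- The mean over all the levels, lines, keys and data. -/
noncomputable def mean (F : Fin (N + 1) → Fin N → GridData N u → ℝ) : ℝ :=
  (∑ j ∈ Finset.range R.J, R.levelSum j F) / (R.J * ((N + 1) * N))

/-- A lower bound for the error of a deterministic sketching protocol with short messages. -/
theorem le_mean_wrong (hJ : 0 < R.J) {δ : ℝ}
    (hδ : ∀ j < R.J, degenerateBound R.q (R.φ j) u ≤ δ) :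
    (1 - Real.exp (-1)) * (Real.exp (-R.t) *
        (1 / 4 - 2 * R.a / R.J * (R.mean (totalLength sk) / N ^ 2 + 1)) - R.meanLoss u - δ) ≤
      R.mean (wrong sk ref) + R.φ₀ * (4 * R.mean (totalLength sk) + 2 * u) / N ^ 2 := by
  have hN := R.adm₀.one_le_cast
  have hJ' : (0 : ℝ) < R.J := by exact_mod_cast hJ
  have hc0 : 0 ≤ 1 - Real.exp (-1) := by
    have : Real.exp (-1) ≤ 1 := Real.exp_le_one_iff.2 (by norm_num)
    linarith
  have hlog : Real.log 2 ≤ 1 := by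
    have := Real.log_two_lt_d9; linarith
  have hlog0 : 0 ≤ Real.log 2 := Real.log_nonneg (by norm_num)
  set Q : ℝ := (N + 1) * N with hQ
  have hQ0 : 0 < Q := by positivity
  set Wr := ∑ j ∈ Finset.range R.J, R.levelSum j (wrong sk ref) with hWr
  set Tl := ∑ j ∈ Finset.range R.J, R.levelSum j (totalLength sk) with hTl
  set M := ∑ a, ∑ i, Admissible.rowMean sk R.q a i with hM
  have hM0 : 0 ≤ M := Finset.sum_nonneg fun a _ => Finset.sum_nonneg fun i _ =>
    R.adm₀.rowMean_nonneg sk a i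
  have h1 : (R.J : ℝ) * (N ^ 2 * M) ≤ Tl := by
    have := Finset.sum_le_sum fun j (_ : j ∈ Finset.range R.J) => R.rowMean_le sk j
    rwa [Finset.sum_const, Finset.card_range, nsmul_eq_mul] at this
  have h2 := Finset.sum_le_sum fun j (_ : j ∈ Finset.range R.J) => R.level_bound sk ref j
  rw [← Finset.mul_sum, Finset.sum_add_distrib, Finset.sum_add_distrib, ← Finset.mul_sum,
    Finset.sum_const, Finset.card_range, nsmul_eq_mul] at h2
  have hcard : ∀ y : ℝ, ∑ _l : Fin (N + 1), ∑ _i : Fin N, y = Q * y := by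
    intro y
    simp only [Finset.sum_const, Finset.card_univ, Fintype.card_fin, nsmul_eq_mul, hQ]
    push_cast; ring
  have h3 : Real.exp (-R.t) * (Q * (R.J / 4) - R.a * (2 * M + 2 * Q)) -
      Q * (R.J * R.meanLoss u) - R.J * (Q * δ) ≤
      ∑ j ∈ Finset.range R.J, ∑ l, ∑ i, (∑ m ∈ Finset.univ.image (rowMessages sk l i),
        ((R.adm j).channel l i).thinBayes (R.φ j) ∅ (messageWeight sk R.q l i m) -
          degenerateBound R.q (R.φ j) u) := by
    have h4 := Finset.sum_le_sum fun l (_ : l ∈ (Finset.univ : Finset (Fin (N + 1)))) =>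
      Finset.sum_le_sum fun i (_ : i ∈ (Finset.univ : Finset (Fin N))) => R.le_sum_thinBayes sk l i
    have h5 : ∑ l, ∑ i, (Real.exp (-R.t) * (R.J / 4 - R.a * (Real.log 2 *
        (2 * Admissible.rowMean sk R.q l i + 2))) - R.J * R.meanLoss u) =
        Real.exp (-R.t) * (Q * (R.J / 4) - R.a * (Real.log 2 * (2 * M + 2 * Q))) -
          Q * (R.J * R.meanLoss u) := by
      simp only [Finset.sum_sub_distrib, ← Finset.mul_sum, Finset.sum_add_distrib, hcard, ← hM]
      ring
    rw [h5] at h4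
    have h6 : ∑ j ∈ Finset.range R.J, ∑ l : Fin (N + 1), ∑ i : Fin N,
        degenerateBound R.q (R.φ j) u ≤ R.J * (Q * δ) := by
      calc _ ≤ ∑ j ∈ Finset.range R.J, Q * δ := Finset.sum_le_sum fun j hj => by
            rw [hcard]
            exact mul_le_mul_of_nonneg_left (hδ j (Finset.mem_range.1 hj)) hQ0.le
        _ = _ := by rw [Finset.sum_const, Finset.card_range, nsmul_eq_mul]
    have h7 : ∑ l, ∑ i, ∑ j ∈ Finset.range R.J, ∑ m ∈ Finset.univ.image (rowMessages sk l i),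
        ((R.adm j).channel l i).thinBayes (R.φ j) ∅ (messageWeight sk R.q l i m) =
        ∑ j ∈ Finset.range R.J, ∑ l, ∑ i, ∑ m ∈ Finset.univ.image (rowMessages sk l i),
        ((R.adm j).channel l i).thinBayes (R.φ j) ∅ (messageWeight sk R.q l i m) := by
      rw [Finset.sum_congr rfl fun l _ => Finset.sum_comm, Finset.sum_comm]
    rw [h7] at h4
    simp only [Finset.sum_sub_distrib]
    have h8 : R.a * (Real.log 2 * (2 * M + 2 * Q)) ≤ R.a * (2 * M + 2 * Q) :=
      mul_le_mul_of_nonneg_left (mul_le_of_le_one_left (by positivity) hlog) R.a_nonneg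
    have h9 := mul_le_mul_of_nonneg_left h8 (Real.exp_pos (-R.t)).le
    linarith
  have h4 := (mul_le_mul_of_nonneg_left h3 hc0).trans h2
  have hden : 0 < R.J * Q := by positivity
  have hMb : M ≤ Tl / (R.J * N ^ 2) := by
    rw [le_div_iff₀ (by positivity)]
    linarith
  have h5 : (1 - Real.exp (-1)) * (Real.exp (-R.t) *
        (1 / 4 - 2 * R.a / R.J * (R.mean (totalLength sk) / N ^ 2 + 1)) - R.meanLoss u - δ) *
        (R.J * Q) ≤ (1 - Real.exp (-1)) * (Real.exp (-R.t) * (Q * (R.J / 4) -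
          R.a * (2 * M + 2 * Q)) - Q * (R.J * R.meanLoss u) - R.J * (Q * δ)) := by
    rw [mul_assoc]
    refine mul_le_mul_of_nonneg_left ?_ hc0
    have e1 : 2 * R.a / R.J * (R.mean (totalLength sk) / N ^ 2 + 1) * (R.J * Q) =
        R.a * (2 * (Tl / (R.J * N ^ 2)) + 2 * Q) := by
      rw [mean]
      change 2 * R.a / R.J * (Tl / (R.J * Q) / N ^ 2 + 1) * (R.J * Q) = _
      field_simp
    have e2 : R.a * (2 * M + 2 * Q) ≤ R.a * (2 * (Tl / (R.J * N ^ 2)) + 2 * Q) :=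
      mul_le_mul_of_nonneg_left (by linarith) R.a_nonneg
    have e3 := mul_le_mul_of_nonneg_left e2 (Real.exp_pos (-R.t)).le
    have e4 : (Real.exp (-R.t) *
        (1 / 4 - 2 * R.a / R.J * (R.mean (totalLength sk) / N ^ 2 + 1)) - R.meanLoss u - δ) *
        (R.J * Q) = Real.exp (-R.t) * (Q * (R.J / 4) -
        2 * R.a / R.J * (R.mean (totalLength sk) / N ^ 2 + 1) * (R.J * Q)) -
        Q * (R.J * R.meanLoss u) - R.J * (Q * δ) := by ring
    rw [e4, e1]
    linarith
  have h6 := h5.trans h4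
  rw [← le_div_iff₀ hden] at h6
  refine h6.trans (le_of_eq ?_)
  change _ = Wr / (R.J * Q) + R.φ₀ * (4 * (Tl / (R.J * Q)) + 2 * u) / N ^ 2
  change (Wr + 4 * R.φ₀ / N ^ 2 * Tl + R.J * ((N + 1) * (2 * u) * (R.φ₀ / N))) / (R.J * Q) = _
  rw [hQ]
  field_simp
  ring

end Rates

end Rates

open Vertex

/-! ### Choice of the parameters. -/

section Parameters

theorem exp_neg_two_mul_le {x : ℝ} (h0 : 0 ≤ x) (h1 : x ≤ 1 / 2) : Real.exp (-(2 * x)) ≤ 1 - x := by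
  have hx : 0 < 1 - x := by linarith
  rw [← Real.le_log_iff_exp_le hx]
  refine le_trans ?_ (Real.one_sub_inv_le_log_of_pos hx)
  have : (1 - x)⁻¹ ≤ 1 + 2 * x := by
    rw [inv_le_iff_one_le_mul₀ hx]
    nlinarith
  linarith

/-- The constant in the sum of the logarithms of the rates. -/
noncomputable def logConst : ℝ := ∑' k : ℕ, 1 / ((k : ℝ) + 1) ^ 2

theorem logConst_nonneg : 0 ≤ logConst := tsum_nonneg fun k => by positivity

/-- The number of levels. -/
noncomputable def levelCount (w : ℝ) : ℕ := ⌊Real.log w ^ 2 / 8⌋₊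

/-- The ratio of the rates of consecutive levels. -/
noncomputable def levelRatio (w : ℝ) : ℝ := 1 - 4 / Real.log w

theorem levelRatio_pos {w : ℝ} (hw : 8 ≤ Real.log w) : 0 < levelRatio w := by
  rw [levelRatio, sub_pos, div_lt_one (by linarith)]; linarith

theorem levelRatio_lt {w : ℝ} (hw : 8 ≤ Real.log w) : levelRatio w < 1 := by
  have : 0 < 4 / Real.log w := by positivity
  rw [levelRatio]; linarith

/-- Since `1 - 4 / log w ≥ exp (-8 / log w)`, the `log w ^ 2 / 8` levels lower the rate by a factor
of at most `w`. -/
theorem inv_le_levelRatio_pow {w : ℝ} (h0 : 0 < w) (hw : 8 ≤ Real.log w) {j : ℕ}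
    (hj : j < levelCount w) : 1 / w ≤ levelRatio w ^ j := by
  have hL : 0 < Real.log w := by linarith
  have h1 : Real.exp (-(2 * (4 / Real.log w))) ≤ levelRatio w :=
    exp_neg_two_mul_le (by positivity) (by rw [div_le_iff₀ hL]; linarith)
  refine le_trans ?_ (pow_le_pow_left₀ (Real.exp_pos _).le h1 j)
  rw [← Real.exp_nat_mul, one_div, ← Real.exp_log (inv_pos.2 h0), Real.exp_le_exp, Real.log_inv]
  have h2 : (j : ℝ) ≤ Real.log w ^ 2 / 8 :=
    (Nat.cast_le.2 hj.le).trans (Nat.floor_le (by positivity))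
  have h3 : (j : ℝ) * (2 * (4 / Real.log w)) ≤ Real.log w := by
    calc _ ≤ Real.log w ^ 2 / 8 * (2 * (4 / Real.log w)) := by gcongr
      _ = _ := by field_simp; ring
  linarith

theorem levelCount_ge {w : ℝ} (hw : 8 ≤ Real.log w) : Real.log w ^ 2 / 16 ≤ levelCount w := by
  have h1 := Nat.sub_one_lt_floor (Real.log w ^ 2 / 8)
  have : (64 : ℝ) ≤ Real.log w ^ 2 := by nlinarith
  rw [levelCount]
  linarith

variable {N : ℕ} {w : ℝ}

theorem admissible_rates (h0 : 2 ≤ w) (hw : 8 ≤ Real.log w) (hN : w ^ 16 = N + 1) (j : ℕ) :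
    Admissible N (1 / w ^ 28) (1 / w * levelRatio w ^ j) := by
  have hr0 := levelRatio_pos hw
  have hr1 := levelRatio_lt hw
  have hp : levelRatio w ^ j ≤ 1 := pow_le_one₀ hr0.le hr1.le
  have h1 : 1 / w ≤ 1 := by rw [div_le_one (by linarith)]; linarith
  have hφ : 1 / w * levelRatio w ^ j ≤ 1 := mul_le_one₀ h1 (by positivity) hp
  refine ⟨?_, by positivity, by positivity, hφ, ?_⟩
  · have : (2 : ℝ) ^ 16 ≤ w ^ 16 := by gcongr
    have h2 : (1 : ℝ) ≤ N := by linarith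
    exact_mod_cast h2
  · have h2 : (N : ℝ) + 1 / w * levelRatio w ^ j ≤ w ^ 16 := by linarith
    calc 2 * (1 / w ^ 28 * (N + 1 / w * levelRatio w ^ j)) ≤ 2 * (1 / w ^ 28 * w ^ 16) := by
          gcongr
      _ = 2 / w ^ 12 := by field_simp
      _ ≤ 1 := by
        rw [div_le_one (by positivity)]
        calc (2 : ℝ) ≤ 2 ^ 12 := by norm_num
          _ ≤ w ^ 12 := by gcongr

/-- The ratio equals `(1 - 1 / w ^ 28) * w ^ 6`, and one factor `w` absorbs the bracket. -/
theorem log_likelihood_ge (h0 : 2 ≤ w) : 5 * Real.log w ≤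
    Real.log (1 / w ^ 23 / (1 / w ^ 28 / (1 - 1 / w ^ 28) * (1 / w))) := by
  have hw : 0 < w := by linarith
  have h1 : 1 / w ^ 28 ≤ 1 / 2 := by
    apply one_div_le_one_div_of_le (by norm_num)
    calc (2 : ℝ) ≤ 2 ^ 28 := by norm_num
      _ ≤ w ^ 28 := by gcongr
  have h2 : 1 / w ^ 23 / (1 / w ^ 28 / (1 - 1 / w ^ 28) * (1 / w)) = (1 - 1 / w ^ 28) * w ^ 6 := by
    have h3 : 1 - 1 / w ^ 28 ≠ 0 := by linarith
    generalize 1 - 1 / w ^ 28 = y at h3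
    field_simp
  rw [h2, show 5 * Real.log w = Real.log (w ^ 5) by rw [Real.log_pow]; norm_num]
  apply Real.log_le_log (by positivity)
  calc w ^ 5 = 1 / 2 * (2 * w ^ 5) := by ring
    _ ≤ (1 - 1 / w ^ 28) * (w * w ^ 5) := by gcongr <;> linarith
    _ = _ := by ring

/-- The parameters for grids with `N + 1 = w ^ 16` lines. -/
noncomputable def gridRates (h0 : 2 ≤ w) (hw : 8 ≤ Real.log w) (hN : w ^ 16 = N + 1) : Rates N where
  -- With `u = w ^ 32` columns in each half, about `u * q * φ ≥ w ^ 2` elements of a key set lie on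
  -- `l` in each half, so degenerate sets are rare. The threshold `q'` exceeds the odds `q * φ₀` by
  -- about `w ^ 6`, so a forced element is worth order `log w`; yet `u * q * q' * (N + 1) / φ₁` is
  -- only `1 / w`, which keeps the second moment loss small.
  q := 1 / w ^ 28
  φ₀ := 1 / w
  φ₁ := 1 / w ^ 2
  r := levelRatio w
  -- This is `1 / (1 - r)`, and `exp (-t) = w ^ (-1/4)` stays far above the losses of order `1 / w`.
  t := Real.log w / 4
  a := (1 + logConst) / (4 * Real.log w)
  C := logConst
  q' := 1 / w ^ 23
  J := levelCount w
  adm := admissible_rates h0 hw hN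
  r_pos := levelRatio_pos hw
  r_lt := levelRatio_lt hw
  t_pos := by linarith
  a_nonneg := by have := logConst_nonneg; positivity
  C_nonneg := logConst_nonneg
  sum_log D := by
    have h1 := sum_neg_log_one_sub_pow_le (levelRatio_pos hw) (levelRatio_lt hw) D
    have h2 : (1 - levelRatio w)⁻¹ = Real.log w / 4 := by rw [levelRatio]; simp
    rwa [h2] at h1
  φ₁_pos := by positivity
  φ₁_le j hj := by
    have h1 := inv_le_levelRatio_pow (by linarith) hw hj
    calc 1 / w ^ 2 = 1 / w * (1 / w) := by field_simp
      _ ≤ _ := by gcongr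
  q'_pos := by positivity
  one_le_log := by have := log_likelihood_ge h0; linarith
  gain := by
    have h1 := log_likelihood_ge h0
    have h2 := logConst_nonneg
    calc (1 + logConst) / 4 = (1 + logConst) / (4 * Real.log w) * Real.log w := by
          field_simp
      _ ≤ _ := by gcongr; linarith

variable (h0 : 2 ≤ w) (hw : 8 ≤ Real.log w) (hN : w ^ 16 = N + 1)

/-- By `1 + x ≤ exp x`, the two powers have exponents `8 / w ^ 8` and `8 / w`, in all at most `16 /
w ≤ 1`. -/
theorem gridRates_meanLoss_le (h16 : 16 ≤ w) :
    (gridRates h0 hw hN).meanLoss ((N + 1) ^ 2) ≤ 32 / w := by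
  have hw0 : 0 < w := by linarith
  have h1 : ∀ (x : ℝ) (k : ℕ), 0 ≤ x → (1 + x) ^ k ≤ Real.exp (k * x) := by
    intro x k hx
    rw [Real.exp_nat_mul]
    gcongr
    linarith [Real.add_one_le_exp x]
  set k : ℕ := 2 * (N + 1) ^ 2 with hk
  have hkw : (k : ℝ) = 2 * w ^ 32 := by
    rw [hk]; push_cast; rw [← hN]; ring
  have e1 : 0 ≤ 4 * (1 / w ^ 28) ^ 2 * ((N : ℝ) + 1) := by positivity
  have e2 : 0 ≤ 1 / w ^ 28 * (4 * ((N : ℝ) + 1) / (1 / w ^ 2) * (1 / w ^ 23)) := by positivity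
  have h2 := mul_le_mul (h1 _ k e1) (h1 _ k e2) (by positivity) (Real.exp_pos _).le
  rw [← Real.exp_add] at h2
  have h3 : (k : ℝ) * (4 * (1 / w ^ 28) ^ 2 * ((N : ℝ) + 1)) +
      k * (1 / w ^ 28 * (4 * ((N : ℝ) + 1) / (1 / w ^ 2) * (1 / w ^ 23))) ≤ 16 / w := by
    rw [hkw, ← hN]
    have : 2 * w ^ 32 * (4 * (1 / w ^ 28) ^ 2 * w ^ 16) +
        2 * w ^ 32 * (1 / w ^ 28 * (4 * w ^ 16 / (1 / w ^ 2) * (1 / w ^ 23))) =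
        8 / w * (1 / w ^ 7) + 8 / w := by field_simp; norm_num
    rw [this]
    have : 1 / w ^ 7 ≤ 1 := by
      rw [div_le_one (by positivity)]; exact one_le_pow₀ (by linarith)
    calc 8 / w * (1 / w ^ 7) + 8 / w ≤ 8 / w * 1 + 8 / w := by gcongr
      _ = _ := by ring
  have h4 : 16 / w ≤ 1 := by rw [div_le_one hw0]; exact h16
  have h5 : Real.exp (16 / w) ≤ 1 + 2 * (16 / w) := by
    have h6 : |16 / w| ≤ 1 := by rw [abs_of_pos (by positivity)]; exact h4
    have := abs_le.1 (Real.abs_exp_sub_one_le h6)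
    rw [abs_of_pos (show 0 < 16 / w by positivity)] at this
    linarith
  have h6 := h2.trans ((Real.exp_le_exp.2 h3).trans h5)
  change (1 + 4 * (1 / w ^ 28) ^ 2 * ((N : ℝ) + 1)) ^ k *
    (1 + 1 / w ^ 28 * (4 * ((N : ℝ) + 1) / (1 / w ^ 2) * (1 / w ^ 23))) ^ k - 1 ≤ _
  have : 32 / w = 2 * (16 / w) := by ring
  linarith

theorem one_sub_pow_le_inv {x : ℝ} {u : ℕ} (hw0 : 1 ≤ w) (hx : x ≤ 1) (h : w ≤ u * x) :
    (1 - x) ^ u ≤ 1 / w := by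
  calc (1 - x) ^ u ≤ Real.exp (-x) ^ u := by
        refine pow_le_pow_left₀ (by linarith) ?_ u
        linarith [Real.add_one_le_exp (-x)]
    _ = Real.exp (-(u * x)) := by rw [← Real.exp_nat_mul]; ring_nf
    _ ≤ Real.exp (-w) := by gcongr
    _ = 1 / Real.exp w := by rw [Real.exp_neg, one_div]
    _ ≤ 1 / w := by
      gcongr
      linarith [Real.add_one_le_exp w]

theorem gridRates_degenerateBound_le {j : ℕ} (hj : j < (gridRates h0 hw hN).J) :
    degenerateBound (gridRates h0 hw hN).q ((gridRates h0 hw hN).φ j) ((N + 1) ^ 2) ≤ 4 / w := by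
  have hw0 : 0 < w := by linarith
  have h1 : 1 / w ^ 2 ≤ (gridRates h0 hw hN).φ j := (gridRates h0 hw hN).φ₁_le j hj
  have h2 : (gridRates h0 hw hN).φ j ≤ 1 / w := (gridRates h0 hw hN).φ_le_φ₀ j
  generalize (gridRates h0 hw hN).φ j = φ at h1 h2
  have hq : (gridRates h0 hw hN).q = 1 / w ^ 28 := rfl
  have hu : (((N + 1) ^ 2 : ℕ) : ℝ) = w ^ 32 := by push_cast; rw [← hN]; ring
  have h3 : 1 / w ≤ 1 / 2 := by gcongr
  have h4 : 1 / w ^ 2 ≤ 1 / 2 := by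
    gcongr
    nlinarith
  have hφ0 : 0 < φ := lt_of_lt_of_le (by positivity) h1
  have hq1 : 1 / w ^ 28 ≤ 1 := by
    rw [div_le_one (by positivity)]; exact one_le_pow₀ (by linarith)
  have key : ∀ y : ℝ, y ≤ 1 → 1 / w ^ 2 ≤ y → (1 - y * (1 / w ^ 28)) ^ ((N + 1) ^ 2) ≤ 1 / w := by
    intro y hy1 hy
    refine one_sub_pow_le_inv (by linarith) ?_ ?_
    · exact mul_le_one₀ hy1 (by positivity) hq1
    · rw [hu]
      calc w ≤ w * w := by nlinarith
        _ = w ^ 32 * (1 / w ^ 2 * (1 / w ^ 28)) := by field_simp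
        _ ≤ _ := by gcongr
  have k1 := key φ (by linarith) h1
  have k2 := key (1 - φ) (by linarith) (by linarith)
  rw [hq, degenerateBound]
  have : 4 / w = 2 * (1 / w) + 2 * (1 / w) := by ring
  linarith

theorem gridRates_J_pos : 0 < (gridRates h0 hw hN).J := by
  have h1 := levelCount_ge hw
  have h2 : 0 < Real.log w ^ 2 / 16 := by positivity
  exact_mod_cast h2.trans_le h1

/-- The trade-off between the error and the total length of the messages. -/
theorem gridRates_trade_off (h16 : 16 ≤ w)
    (hbig : 1024 * (1 + logConst) * Real.log w ^ 3 ≤ w * Real.exp (-(Real.log w / 4)))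
    (hlog : 256 * (1 + logConst) ≤ Real.log w ^ 3) {X : ℕ}
    (sk : Vertex N ((N + 1) ^ 2) X → Set (Vertex N ((N + 1) ^ 2) X) → List Bool)
    (ref : (Vertex N ((N + 1) ^ 2) X → List Bool) → Bool) :
    Real.exp (-(Real.log w / 4)) / 32 ≤ (gridRates h0 hw hN).mean (Rates.wrong sk ref) +
      Real.exp (-(Real.log w / 4)) * ((36 + 32 * logConst) / Real.log w ^ 3) *
        ((gridRates h0 hw hN).mean (Rates.totalLength sk) / (N + 1) ^ 2) := by
  have hw0 : 0 < w := by linarith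
  have hL : 0 < Real.log w := by linarith
  have hC := logConst_nonneg
  have h1 := (gridRates h0 hw hN).le_mean_wrong sk ref (gridRates_J_pos h0 hw hN)
    fun j hj => gridRates_degenerateBound_le h0 hw hN hj
  have h2 := gridRates_meanLoss_le h0 hw hN h16
  have hΛ0 : 0 ≤ (gridRates h0 hw hN).mean (Rates.totalLength sk) := by
    refine div_nonneg (Finset.sum_nonneg fun j _ => Finset.sum_nonneg fun l _ =>
      Finset.sum_nonneg fun k _ => Finset.sum_nonneg fun t _ => mul_nonneg
        (((gridRates h0 hw hN).admφ j).gridWeight_nonneg l t)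
        (Finset.sum_nonneg fun v _ => Nat.cast_nonneg _)) (by positivity)
  generalize (gridRates h0 hw hN).meanLoss ((N + 1) ^ 2) = ML at h1 h2
  generalize (gridRates h0 hw hN).mean (Rates.totalLength sk) = Λ at h1 hΛ0 ⊢
  generalize (gridRates h0 hw hN).mean (Rates.wrong sk ref) = W at h1 ⊢
  have ha : (gridRates h0 hw hN).a = (1 + logConst) / (4 * Real.log w) := rfl
  have ht : (gridRates h0 hw hN).t = Real.log w / 4 := rfl
  have hφ : (gridRates h0 hw hN).φ₀ = 1 / w := rfl
  have hJ : Real.log w ^ 2 / 16 ≤ ((gridRates h0 hw hN).J : ℝ) := levelCount_ge hw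
  rw [ha, ht, hφ] at h1
  generalize ((gridRates h0 hw hN).J : ℝ) = J at h1 hJ
  set E := Real.exp (-(Real.log w / 4)) with hE
  have hE0 : 0 < E := Real.exp_pos _
  set L := Real.log w with hLdef
  have hN1 : (1 : ℝ) ≤ N := (admissible_rates h0 hw hN 0).one_le_cast
  set s : ℝ := Λ / (N + 1) ^ 2 with hs
  have hs0 : 0 ≤ s := by positivity
  have hΛN : Λ / N ^ 2 ≤ 4 * s := by
    rw [hs, ← mul_div_assoc, div_le_div_iff₀ (by positivity) (by positivity)]
    have : ((N : ℝ) + 1) ^ 2 ≤ 4 * N ^ 2 := by nlinarith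
    nlinarith
  have huN : (((N + 1) ^ 2 : ℕ) : ℝ) / N ^ 2 ≤ 4 := by
    rw [div_le_iff₀ (by positivity)]; push_cast; nlinarith
  have hκ : 2 * ((1 + logConst) / (4 * L)) / J ≤ 8 * (1 + logConst) / L ^ 3 := by
    calc _ ≤ 2 * ((1 + logConst) / (4 * L)) / (L ^ 2 / 16) := by gcongr
      _ = _ := by field_simp; ring
  have hκ0 : 0 ≤ 2 * ((1 + logConst) / (4 * L)) / J :=
    div_nonneg (by positivity) (le_trans (by positivity) hJ)
  have hκ1 : 8 * (1 + logConst) / L ^ 3 ≤ 1 / 32 := by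
    rw [div_le_div_iff₀ (by positivity) (by norm_num)]; linarith
  -- All the error terms, from the second moment, the degenerate sets and the columns on `l`, are of
  -- order `D`; `hbig` makes `D` negligible against `E`.
  set D : ℝ := 1 / w with hD
  have hD0 : 0 < D := by positivity
  have hDE : 1024 * ((1 + logConst) * L ^ 3) * D ≤ E := by
    rw [hD, mul_one_div, div_le_iff₀ hw0]; linarith
  have hL3 : (512 : ℝ) ≤ L ^ 3 := by
    calc (512 : ℝ) = 8 ^ 3 := by norm_num
      _ ≤ L ^ 3 := by gcongr
  have hDE1 : 1024 * (L ^ 3 * D) ≤ E := by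
    have : 0 ≤ logConst * (L ^ 3 * D) := by positivity
    linarith
  have hDE2 : 1024 * D ≤ E := by
    have : 1 * D ≤ L ^ 3 * D := by gcongr; linarith
    linarith
  have hDE3 : 4 * D ≤ E / L ^ 3 := by
    rw [le_div_iff₀ (by positivity)]; nlinarith
  have hc1 : (1 : ℝ) / 2 ≤ 1 - Real.exp (-1) := by
    have h3 : Real.exp (-1) = 1 / Real.exp 1 := by rw [Real.exp_neg, one_div]
    have h4 : 1 / Real.exp 1 ≤ 1 / 2 := by
      gcongr
      linarith [Real.add_one_le_exp 1]
    linarith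
  have hc2 : 1 - Real.exp (-1) ≤ 1 := by linarith [Real.exp_pos (-1)]
  generalize 1 - Real.exp (-1) = c at h1 hc1 hc2
  generalize 2 * ((1 + logConst) / (4 * L)) / J = κ at h1 hκ hκ0
  have hML : ML ≤ 32 * D := by rw [hD, mul_one_div]; exact h2
  have hδ : 4 / w = 4 * D := by rw [hD, mul_one_div]
  rw [hδ] at h1
  have r1 : D * (4 * Λ + 2 * (((N + 1) ^ 2 : ℕ) : ℝ)) / N ^ 2 ≤ D * (16 * s + 8) := by
    have : D * (4 * Λ + 2 * (((N + 1) ^ 2 : ℕ) : ℝ)) / N ^ 2 =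
        D * (4 * (Λ / N ^ 2) + 2 * ((((N + 1) ^ 2 : ℕ) : ℝ) / N ^ 2)) := by field_simp
    rw [this]
    exact mul_le_mul_of_nonneg_left (by linarith) hD0.le
  have r2 : κ * (Λ / N ^ 2 + 1) ≤ 8 * (1 + logConst) / L ^ 3 * (4 * s) + 1 / 32 := by
    calc κ * (Λ / N ^ 2 + 1) ≤ 8 * (1 + logConst) / L ^ 3 * (4 * s + 1) := by
          gcongr
      _ ≤ _ := by linarith
  set Y := 8 * (1 + logConst) / L ^ 3 * (4 * s) with hY
  have hY0 : 0 ≤ Y := by positivity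
  have r3 : E * (1 / 4 - 1 / 32 - Y) - 36 * D ≤
      E * (1 / 4 - κ * (Λ / N ^ 2 + 1)) - ML - 4 * D := by
    have := mul_le_mul_of_nonneg_left r2 hE0.le
    linarith
  have r4 : 1 / 2 * (E * (1 / 4 - 1 / 32) - 36 * D) - E * Y ≤
      c * (E * (1 / 4 - κ * (Λ / N ^ 2 + 1)) - ML - 4 * D) := by
    refine le_trans ?_ (mul_le_mul_of_nonneg_left r3 (by linarith))
    have e1 : 0 ≤ E * (1 / 4 - 1 / 32) - 36 * D := by linarith
    have e2 := mul_le_mul_of_nonneg_right hc1 e1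
    have e3 : c * (E * Y) ≤ 1 * (E * Y) := by gcongr
    linarith
  have r5 : D * (16 * s) ≤ E / L ^ 3 * (4 * s) := by
    have := mul_le_mul_of_nonneg_right hDE3 (show 0 ≤ 4 * s by linarith)
    linarith
  have r6 : E * ((36 + 32 * logConst) / L ^ 3) * s = E * Y + E / L ^ 3 * (4 * s) := by
    rw [hY]; ring
  rw [r6]
  linarith

end Parameters

open Vertex

/-! ### Relabeling of the vertices and shared randomness. -/

section Transport

variable {V W : Type*} (e : W ≃ V) (G : SimpleGraph W)

theorem reachable_map_equiv_iff (v w : W) :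
    (G.map e.toEmbedding).Reachable (e v) (e w) ↔ G.Reachable v w :=
  (SimpleGraph.Iso.map e G).reachable_iff

theorem IsBlock.map_equiv {G : SimpleGraph W} {s₁ s₂ t₁ t₂ : W} (h : IsBlock G s₁ s₂ t₁ t₂) :
    IsBlock (G.map e.toEmbedding) (e s₁) (e s₂) (e t₁) (e t₂) where
  distinct := by simpa using List.Nodup.map e.injective h.distinct
  two_components := by
    rw [← h.two_components]
    exact Nat.card_congr (SimpleGraph.Iso.map e G).connectedComponentEquiv.symm
  separated := by rw [reachable_map_equiv_iff]; exact h.separated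
  joined := by simpa only [reachable_map_equiv_iff] using h.joined

end Transport

theorem PMF.tsum_map_mul {α β : Type*} (p : PMF α) (f : α → β) (F : β → ℝ≥0∞) :
    ∑' b, p.map f b * F b = ∑' a, p a * F (f a) := by
  classical
  simp only [PMF.map_apply, ← ENNReal.tsum_mul_right]
  rw [ENNReal.tsum_comm]
  refine tsum_congr fun a => ?_
  rw [tsum_eq_single (f a)]
  · simp
  · intro b hb
    simp [hb]

namespace SketchProtocol

variable {V : Type*} [Fintype V] {Ω : Type*} [MeasurableSpace Ω] (P : SketchProtocol V Ω)

theorem measurable_length (G : SimpleGraph V) (v : V) :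
    Measurable fun ω => ((P.message ω G v).length : ℝ≥0∞) := by
  let _ : MeasurableSpace (List Bool) := ⊤
  have h1 : Measurable fun ω => P.message ω G v :=
    measurable_to_countable' fun m => P.measurableSet_sketch v (G.neighborSet v) m
  exact (measurable_from_top (f := fun m : List Bool => (m.length : ℝ≥0∞))).comp h1

/-- The families of messages form a countable type, so the event is a countable union over their
values. -/
theorem measurableSet_output (G : SimpleGraph V) : MeasurableSet {ω | P.output ω G = true} := by
  have h1 : {ω | P.output ω G = true} = ⋃ m : V → List Bool,
      (⋂ v, {ω | P.message ω G v = m v}) ∩ {ω | P.referee ω m = true} := by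
    ext ω
    simp only [Set.mem_ofPred_eq, Set.mem_iUnion, Set.mem_inter_iff, Set.mem_iInter]
    refine ⟨fun h => ⟨P.message ω G, fun v => rfl, h⟩, ?_⟩
    rintro ⟨m, hm, h⟩
    rwa [output, show P.message ω G = m from funext hm]
  rw [h1]
  exact MeasurableSet.iUnion fun m => (MeasurableSet.iInter fun v =>
    P.measurableSet_sketch v (G.neighborSet v) (m v)).inter (P.measurableSet_referee m)

theorem measurableSet_correct (s t₁ t₂ : V) (G : SimpleGraph V) :
    MeasurableSet {ω | P.Correct s t₁ t₂ ω G} := by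
  have h1 := P.measurableSet_output G
  have h2 : {ω | P.Correct s t₁ t₂ ω G} = ({ω | P.output ω G = true} ∩ {_ω | G.Reachable s t₁}) ∪
      ({ω | P.output ω G = true}ᶜ ∩ {_ω | G.Reachable s t₂}) := by
    ext ω
    simp [Correct]
  rw [h2]
  exact (h1.inter (.const _)).union (h1.compl.inter (.const _))

open Classical in
/-- A trade-off between the error and the total length for every value of the shared randomness
bounds the expected average size of a protocol. -/
theorem le_expectedAverageSize_of_trade_off [Nonempty V] {S : Type*} [Fintype S] (p : PMF S)
    (f : S → SimpleGraph V) (μ : Measure Ω) [IsProbabilityMeasure μ] (s t₁ t₂ : V)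
    {E κ ε y : ℝ} (hκ : 0 < κ) (hε : 0 ≤ ε)
    (hdet : ∀ ω, E ≤ ∑ x, (p x).toReal * (if P.Correct s t₁ t₂ ω (f x) then 0 else 1) +
      κ * ∑ x, (p x).toReal * ∑ v, ((P.message ω (f x) v).length : ℝ))
    (hy : κ * Fintype.card V * y ≤ E - ε)
    (hsucc : ENNReal.ofReal (1 - ε) ≤ P.successProb μ (p.map f) s t₁ t₂) :
    ENNReal.ofReal y ≤ P.expectedAverageSize μ (p.map f) := by
  rw [successProb, PMF.tsum_map_mul p f fun G => μ {ω | P.Correct s t₁ t₂ ω G}, tsum_fintype]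
    at hsucc
  rw [expectedAverageSize, PMF.tsum_map_mul p f fun G => ∫⁻ ω, (∑ v : V,
    ((P.message ω G v).length : ℝ≥0∞)) / (Fintype.card V : ℝ≥0∞) ∂μ, tsum_fintype]
  have hc0 : (Fintype.card V : ℝ≥0∞) ≠ 0 := by simp
  have hcT : (Fintype.card V : ℝ≥0∞) ≠ ⊤ := by simp
  have hp : ∀ x, ENNReal.ofReal (p x).toReal = p x := fun x => ENNReal.ofReal_toReal (p.apply_ne_top x)
  have hlen : ∀ x, Measurable fun ω => ∑ v, ((P.message ω (f x) v).length : ℝ≥0∞) := fun x =>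
    Finset.measurable_sum _ fun v _ => P.measurable_length (f x) v
  have hmeas : ∀ x, Measurable fun ω => p x *
      ({ω | P.Correct s t₁ t₂ ω (f x)}ᶜ.indicator 1 ω : ℝ≥0∞) := fun x =>
    (measurable_one.indicator (P.measurableSet_correct s t₁ t₂ (f x)).compl).const_mul _
  set T : ℝ≥0∞ := ∑ x, p x * ∫⁻ ω, ∑ v, ((P.message ω (f x) v).length : ℝ≥0∞) ∂μ with hT
  set Err : ℝ≥0∞ := ∑ x, p x * μ {ω | P.Correct s t₁ t₂ ω (f x)}ᶜ with hErr
  have h1 : ∀ ω, ENNReal.ofReal E ≤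
      ∑ x, p x * ({ω | P.Correct s t₁ t₂ ω (f x)}ᶜ.indicator 1 ω : ℝ≥0∞) +
        ENNReal.ofReal κ * ∑ x, p x * ∑ v, ((P.message ω (f x) v).length : ℝ≥0∞) := by
    intro ω
    refine (ENNReal.ofReal_le_ofReal (hdet ω)).trans (ENNReal.ofReal_add_le.trans (le_of_eq ?_))
    congr 1
    · rw [ENNReal.ofReal_sum_of_nonneg fun x _ => mul_nonneg ENNReal.toReal_nonneg
        (by split_ifs <;> simp)]
      refine Finset.sum_congr rfl fun x _ => ?_
      rw [ENNReal.ofReal_mul ENNReal.toReal_nonneg, hp]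
      by_cases h : P.Correct s t₁ t₂ ω (f x) <;> simp [h]
    · rw [ENNReal.ofReal_mul hκ.le, ENNReal.ofReal_sum_of_nonneg fun x _ =>
        mul_nonneg ENNReal.toReal_nonneg (Finset.sum_nonneg fun v _ => Nat.cast_nonneg _)]
      congr 1
      refine Finset.sum_congr rfl fun x _ => ?_
      rw [ENNReal.ofReal_mul ENNReal.toReal_nonneg, hp,
        ENNReal.ofReal_sum_of_nonneg fun v _ => Nat.cast_nonneg _]
      simp
  have h2 : ENNReal.ofReal E ≤ Err + ENNReal.ofReal κ * T := by
    have h3 := lintegral_mono (μ := μ) h1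
    rw [lintegral_const, measure_univ, mul_one,
      lintegral_add_left (Finset.measurable_sum _ fun x _ => hmeas x),
      lintegral_finsetSum _ fun x _ => hmeas x,
      lintegral_const_mul _ (Finset.measurable_sum _ fun x _ => (hlen x).const_mul _),
      lintegral_finsetSum _ fun x _ => (hlen x).const_mul _] at h3
    refine h3.trans (le_of_eq ?_)
    congr 1
    · refine Finset.sum_congr rfl fun x _ => ?_
      rw [lintegral_const_mul _
        (measurable_one.indicator (P.measurableSet_correct s t₁ t₂ (f x)).compl),
        lintegral_indicator_one (P.measurableSet_correct s t₁ t₂ (f x)).compl]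
    · congr 1
      exact Finset.sum_congr rfl fun x _ => lintegral_const_mul _ (hlen x)
  have h3 : Err ≤ ENNReal.ofReal ε := by
    have h4 : (∑ x, p x * μ {ω | P.Correct s t₁ t₂ ω (f x)}) + Err = 1 := by
      rw [hErr, ← Finset.sum_add_distrib]
      simp only [← mul_add, measure_add_measure_compl (P.measurableSet_correct s t₁ t₂ (f _)),
        measure_univ, mul_one]
      rw [← tsum_fintype (L := .unconditional S), p.tsum_coe]
    have h5 : ENNReal.ofReal (1 - ε) + Err ≤ ENNReal.ofReal (1 - ε) + ENNReal.ofReal ε := by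
      calc _ ≤ 1 := h4 ▸ add_le_add_left hsucc Err
        _ = ENNReal.ofReal (1 - ε + ε) := by simp
        _ ≤ _ := ENNReal.ofReal_add_le
    exact (ENNReal.add_le_add_iff_left ENNReal.ofReal_ne_top).1 h5
  have h4 : ∑ x, p x * ∫⁻ ω, (∑ v : V, ((P.message ω (f x) v).length : ℝ≥0∞)) /
      (Fintype.card V : ℝ≥0∞) ∂μ = T / Fintype.card V := by
    simp only [div_eq_mul_inv]
    rw [hT, Finset.sum_mul]
    refine Finset.sum_congr rfl fun x _ => ?_
    rw [lintegral_mul_const _ (hlen x), mul_assoc]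
  rw [h4, ENNReal.le_div_iff_mul_le (.inl hc0) (.inl hcT)]
  by_cases hTt : T = ⊤
  · simp [hTt]
  have h5 : E ≤ ε + κ * T.toReal := by
    have h6 := h2.trans (add_le_add_left h3 _)
    rw [← ENNReal.ofReal_toReal hTt, ← ENNReal.ofReal_mul hκ.le,
      ← ENNReal.ofReal_add hε (by positivity)] at h6
    exact (ENNReal.ofReal_le_ofReal_iff (by positivity)).1 h6
  rw [← ENNReal.ofReal_toReal hTt, ← ENNReal.ofReal_natCast,
    ← ENNReal.ofReal_mul' (Nat.cast_nonneg _)]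
  refine ENNReal.ofReal_le_ofReal ?_
  have h6 : κ * (y * Fintype.card V) ≤ κ * T.toReal := by linarith
  exact le_of_mul_le_mul_left h6 hκ

end SketchProtocol

/-! ### The distribution on blocks and the final bound. -/

section Samples

variable {N : ℕ} (R : Rates N) {u X : ℕ}

/-- The sample space of the distribution on grid blocks. -/
abbrev Sample (J N u : ℕ) := Fin J × Fin (N + 1) × Fin N × GridData N u

namespace Rates

/-- The probability of a sample. -/
noncomputable def sampleWeight (x : Sample R.J N u) : ℝ :=
  gridWeight R.q (R.φ x.1) x.2.1 x.2.2.2 / (R.J * ((N + 1) * N))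

theorem sampleWeight_nonneg (x : Sample R.J N u) : 0 ≤ R.sampleWeight x :=
  div_nonneg ((R.admφ _).gridWeight_nonneg _ _) (by positivity)

theorem sum_sampleWeight_mul (F : Fin (N + 1) → Fin N → GridData N u → ℝ) :
    ∑ x : Sample R.J N u, R.sampleWeight x * F x.2.1 x.2.2.1 x.2.2.2 = R.mean F := by
  rw [mean, Finset.sum_div, ← Fin.sum_univ_eq_sum_range (fun j => R.levelSum j F / _),
    Fintype.sum_prod_type]
  refine Finset.sum_congr rfl fun j _ => ?_
  simp only [levelSum, Fintype.sum_prod_type (α₁ := Fin (N + 1)),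
    Fintype.sum_prod_type (α₁ := Fin N), Finset.sum_div, sampleWeight]
  refine Finset.sum_congr rfl fun l _ => Finset.sum_congr rfl fun k _ =>
    Finset.sum_congr rfl fun t _ => ?_
  ring

theorem sum_sampleWeight (hJ : 0 < R.J) : ∑ x : Sample R.J N u, R.sampleWeight x = 1 := by
  have h1 := R.sum_sampleWeight_mul (u := u) fun _ _ _ => 1
  have hN := R.adm₀.one_le_cast
  have hJ' : (0 : ℝ) < R.J := by exact_mod_cast hJ
  simp only [mul_one] at h1
  rw [h1, mean]
  simp only [levelSum, mul_one, (R.admφ _).sum_gridWeight, Finset.sum_const, Finset.card_univ,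
    Fintype.card_fin, Finset.card_range, nsmul_eq_mul]
  push_cast
  rw [div_eq_one_iff_eq (by positivity)]

/-- The distribution of the samples. -/
noncomputable def samplePMF (hJ : 0 < R.J) (u : ℕ) : PMF (Sample R.J N u) :=
  PMF.ofFintype (fun x => ENNReal.ofReal (R.sampleWeight x)) (by
    rw [← ENNReal.ofReal_sum_of_nonneg fun x _ => R.sampleWeight_nonneg x, R.sum_sampleWeight hJ,
      ENNReal.ofReal_one])

theorem samplePMF_toReal (hJ : 0 < R.J) (x : Sample R.J N u) :
    (R.samplePMF hJ u x).toReal = R.sampleWeight x :=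
  ENNReal.toReal_ofReal (R.sampleWeight_nonneg x)

end Rates

/-- The grid block of a sample. -/
def Sample.graph {J : ℕ} (x : Sample J N u) : SimpleGraph (Vertex N u X) :=
  gridGraph x.2.1 x.2.2.1 x.2.2.2.1 x.2.2.2.2.1 x.2.2.2.2.2

end Samples

open Vertex

section Protocol

variable {N J u X : ℕ} {V : Type*} [Fintype V] {Ω : Type*} [MeasurableSpace Ω]
  (e : Vertex N u X ≃ V) (P : SketchProtocol V Ω) (ω : Ω)

theorem message_map_graph (x : Sample J N u) (v : Vertex N u X) :
    P.message ω ((x.graph (X := X)).map e.toEmbedding) (e v) =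
      P.sketch ω (e v) (e '' (x.graph (X := X)).neighborSet v) :=
  congrArg (P.sketch ω (e v)) (SimpleGraph.neighborSet_map _ e.toEmbedding v)

theorem output_map_graph (x : Sample J N u) :
    P.output ω ((x.graph (X := X)).map e.toEmbedding) =
      gridAnswer (fun v A => P.sketch ω (e v) (e '' A))
        (fun m => P.referee ω fun v => m (e.symm v)) x.2.1 x.2.2.1 x.2.2.2 := by
  rw [SketchProtocol.output, gridAnswer]
  congr 1
  ext1 v
  obtain ⟨w, rfl⟩ := e.surjective v
  rw [message_map_graph, e.symm_apply_apply]
  rfl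

theorem isBlock_map_graph (x : Sample J N u) : IsBlock ((x.graph (X := X)).map e.toEmbedding)
    (e (source false)) (e (source true)) (e (sink true)) (e (sink false)) :=
  (gridGraph_isBlock ..).1.map_equiv e

open Classical in
theorem wrong_eq_ite_correct (x : Sample J N u) :
    Rates.wrong (fun v A => P.sketch ω (e v) (e '' A))
      (fun m => P.referee ω fun v => m (e.symm v)) x.2.1 x.2.2.1 x.2.2.2 =
    if P.Correct (e (source false)) (e (sink true)) (e (sink false)) ω
      ((x.graph (X := X)).map e.toEmbedding) then 0 else 1 := by
  have h1 : ∀ β, (x.graph (X := X)).Reachable (source false) (sink β) ↔ (x.2.2.2.2.2 x.2.2.1).1 = β :=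
    (gridGraph_isBlock ..).2
  rw [Rates.wrong, SketchProtocol.Correct, output_map_graph, reachable_map_equiv_iff,
    reachable_map_equiv_iff, h1, h1]
  generalize gridAnswer _ _ _ _ _ = b
  generalize (x.2.2.2.2.2 x.2.2.1).1 = b'
  cases b <;> cases b' <;> simp

theorem totalLength_eq (x : Sample J N u) :
    Rates.totalLength (fun v A => P.sketch ω (e v) (e '' A)) x.2.1 x.2.2.1 x.2.2.2 =
      ∑ v, ((P.message ω ((x.graph (X := X)).map e.toEmbedding) v).length : ℝ) := by
  rw [← e.sum_comp]
  simp only [message_map_graph]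
  rfl

end Protocol

/-- Lower bound for the expected average size of a protocol on the grid blocks with `N + 1` lines,
`w ^ 16 = N + 1`. -/
theorem le_expectedAverageSize_gridBlocks {N X : ℕ} {w : ℝ} (h0 : 2 ≤ w) (hw : 8 ≤ Real.log w)
    (hN : w ^ 16 = N + 1) (h16 : 16 ≤ w)
    (hbig : 1024 * (1 + logConst) * Real.log w ^ 3 ≤ w * Real.exp (-(Real.log w / 4)))
    (hlog : 256 * (1 + logConst) ≤ Real.log w ^ 3) {V : Type*} [Fintype V]
    (e : Vertex N ((N + 1) ^ 2) X ≃ V) (hV : Fintype.card V ≤ 64 * (N + 1) ^ 2)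
    {Ω : Type*} [MeasurableSpace Ω] (μ : Measure Ω) [IsProbabilityMeasure μ]
    (P : SketchProtocol V Ω) {ε : ℝ} (hε : 0 ≤ ε)
    (hε' : ε ≤ Real.exp (-(Real.log w / 4)) / 64)
    (hsucc : ENNReal.ofReal (1 - ε) ≤ P.successProb μ
      (((gridRates h0 hw hN).samplePMF (gridRates_J_pos h0 hw hN) ((N + 1) ^ 2)).map
        fun x => (Sample.graph (X := X) x).map e.toEmbedding)
      (e (source false)) (e (sink true)) (e (sink false))) :
    ENNReal.ofReal (Real.log w ^ 3 / (4096 * (36 + 32 * logConst))) ≤ P.expectedAverageSize μ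
      (((gridRates h0 hw hN).samplePMF (gridRates_J_pos h0 hw hN) ((N + 1) ^ 2)).map
        fun x => (Sample.graph (X := X) x).map e.toEmbedding) := by
  have hC := logConst_nonneg
  have hL : 0 < Real.log w := by linarith
  have : Nonempty V := ⟨e (source false)⟩
  refine P.le_expectedAverageSize_of_trade_off _ _ μ _ _ _
    (E := Real.exp (-(Real.log w / 4)) / 32)
    (κ := Real.exp (-(Real.log w / 4)) * ((36 + 32 * logConst) / Real.log w ^ 3) / (N + 1) ^ 2)
    (by positivity) hε (fun ω => ?_) ?_ hsucc
  · have h1 := gridRates_trade_off h0 hw hN h16 hbig hlog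
      (fun v A => P.sketch ω (e v) (e '' A)) (fun m => P.referee ω fun v => m (e.symm v))
    rw [← Rates.sum_sampleWeight_mul, ← Rates.sum_sampleWeight_mul] at h1
    simp only [wrong_eq_ite_correct, totalLength_eq] at h1
    simp only [Rates.samplePMF_toReal]
    refine h1.trans (le_of_eq ?_)
    ring
  · have hV' : (Fintype.card V : ℝ) ≤ 64 * (N + 1) ^ 2 := by exact_mod_cast hV
    generalize Real.exp (-(Real.log w / 4)) = E at hε' ⊢
    have hE : 0 ≤ E := by linarith
    -- One factor of `4096 = 64 * 64` comes from `hV`, the other from the slack `E / 32 - ε ≥ E /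
    -- 64`.
    calc _ ≤ E * ((36 + 32 * logConst) / Real.log w ^ 3) / (N + 1) ^ 2 * (64 * (N + 1) ^ 2) *
          (Real.log w ^ 3 / (4096 * (36 + 32 * logConst))) := by gcongr
      _ = E / 64 := by
        have : (36 + 32 * logConst) ≠ 0 := by positivity
        field_simp
        norm_num
      _ ≤ _ := by linarith

/-- The conditions on the size of the grid hold for all large sizes. -/
theorem exists_forall_gridSize : ∃ w₀ : ℝ, 0 ≤ w₀ ∧ ∀ w, w₀ ≤ w → 16 ≤ w ∧ 8 ≤ Real.log w ∧
    1024 * (1 + logConst) * Real.log w ^ 3 ≤ w * Real.exp (-(Real.log w / 4)) ∧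
    256 * (1 + logConst) ≤ Real.log w ^ 3 := by
  have hC := logConst_nonneg
  have hlog := Real.tendsto_log_atTop
  have h1 := (isLittleO_log_rpow_rpow_atTop 3 (show (0 : ℝ) < 3 / 4 by norm_num)).bound
    (show 0 < 1 / (1024 * (1 + logConst)) by positivity)
  have h2 := hlog.eventually_ge_atTop 8
  have h3 := hlog.eventually_ge_atTop (256 * (1 + logConst))
  obtain ⟨w₀, hw₀⟩ := Filter.eventually_atTop.1
    (h1.and (h2.and (h3.and (Filter.eventually_ge_atTop (16 : ℝ)))))
  refine ⟨max w₀ 0, le_max_right _ _, fun w hw => ?_⟩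
  obtain ⟨h1, h2, h3, h4⟩ := hw₀ w ((le_max_left _ _).trans hw)
  have hw0 : 0 < w := by linarith
  refine ⟨h4, h2, ?_, h3.trans ?_⟩
  · have e1 : w * Real.exp (-(Real.log w / 4)) = w ^ (3 / 4 : ℝ) := by
      conv_lhs => rw [← Real.exp_log hw0, Real.log_exp]
      rw [← Real.exp_add, Real.rpow_def_of_pos hw0]
      ring_nf
    have e2 : Real.log w ^ (3 : ℝ) = Real.log w ^ 3 := by norm_cast
    rw [e2, Real.norm_of_nonneg (by positivity), Real.norm_of_nonneg (by positivity),
      one_div_mul_eq_div, le_div_iff₀ (by positivity)] at h1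
    rw [e1]
    linarith
  · calc Real.log w = Real.log w * 1 := (mul_one _).symm
      _ ≤ Real.log w * Real.log w ^ 2 := by gcongr; nlinarith
      _ = _ := by ring

theorem lemma4p1 :
    ∃ c : ℝ, 0 < c ∧ ∃ N : ℕ, ∀ n : ℕ, N ≤ n →
      ∃ (s₁ s₂ t₁ t₂ : Fin (Nat.sqrt n)) (D : PMF (SimpleGraph (Fin (Nat.sqrt n)))),
        (∀ G ∈ D.support, IsBlock G s₁ s₂ t₁ t₂) ∧
        ∀ (Ω : Type*) [MeasurableSpace Ω] (μ : Measure Ω) [IsProbabilityMeasure μ]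
          (P : SketchProtocol (Fin (Nat.sqrt n)) Ω),
          ENNReal.ofReal (1 - 2 / √(n : ℝ)) ≤ P.successProb μ D s₁ t₁ t₂ →
            ENNReal.ofReal (c * Real.log n ^ 3) ≤ P.expectedAverageSize μ D := by
  obtain ⟨w₀, hw₀0, hw₀⟩ := exists_forall_gridSize
  have hC := logConst_nonneg
  -- The power `68 ^ 3` comes from `n ≤ w ^ 68`, which is shown at the end.
  refine ⟨1 / (68 ^ 3 * (4096 * (36 + 32 * logConst))), by positivity,
    (16 * (max ⌈w₀ ^ 16⌉₊ 16) ^ 2) ^ 2, fun n hn => ?_⟩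
  set m := Nat.sqrt n with hm
  have hm1 : 16 * (max ⌈w₀ ^ 16⌉₊ 16) ^ 2 ≤ m := Nat.le_sqrt'.2 hn
  -- A grid with `g` lines and `g ^ 2` columns in each half has `4 * g ^ 2 + 2 * g + 4 ≤ 16 * g ^ 2`
  -- vertices; extra vertices fill up the remaining ones.
  set g := Nat.sqrt (m / 16) with hg
  have hg1 : max ⌈w₀ ^ 16⌉₊ 16 ≤ g := Nat.le_sqrt'.2 ((Nat.le_div_iff_mul_le (by norm_num)).2
    (by linarith))
  have hg16 : 16 ≤ g := (le_max_right _ _).trans hg1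
  have hgm : 16 * g ^ 2 ≤ m := by
    have := Nat.sqrt_le' (m / 16)
    have := Nat.div_mul_le_self m 16
    lia
  have hmg : m < 16 * (g + 1) ^ 2 := by
    have := Nat.lt_succ_sqrt' (m / 16)
    rw [Nat.div_lt_iff_lt_mul (by norm_num)] at this
    rw [Nat.succ_eq_add_one, ← hg] at this
    linarith
  have hmg' : m ≤ 64 * g ^ 2 := by nlinarith
  obtain ⟨N, hNg⟩ : ∃ N, g = N + 1 := ⟨g - 1, by lia⟩
  rw [hNg] at hg16 hgm hmg' hg1
  clear hmg
  clear_value g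
  subst hNg
  set w : ℝ := ((N : ℝ) + 1) ^ (1 / 16 : ℝ) with hw
  have hw16 : w ^ 16 = N + 1 := by
    rw [hw, ← Real.rpow_natCast, ← Real.rpow_mul (by positivity)]
    norm_num
  have hw0 : 0 ≤ w := by positivity
  have hww : w₀ ≤ w := by
    refine le_of_pow_le_pow_left₀ (n := 16) (by norm_num) hw0 ?_
    rw [hw16]
    have h1 : ⌈w₀ ^ 16⌉₊ ≤ N + 1 := (le_max_left _ _).trans hg1
    exact (Nat.le_ceil _).trans (by exact_mod_cast h1)
  obtain ⟨h16, hlog8, hbig, hlog3⟩ := hw₀ w hww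
  obtain ⟨X, hX⟩ : ∃ X, 4 + 4 * (N + 1) + 2 * (N + 1) ^ 2 + 2 * ((N + 1) * N) + X = m := by
    refine ⟨m - (4 + 4 * (N + 1) + 2 * (N + 1) ^ 2 + 2 * ((N + 1) * N)), Nat.add_sub_cancel' ?_⟩
    nlinarith
  have e : Vertex N ((N + 1) ^ 2) X ≃ Fin m := Fintype.equivFinOfCardEq (by rw [card_eq, hX])
  have h2 : (2 : ℝ) ≤ w := by linarith
  refine ⟨e (source false), e (source true), e (sink true), e (sink false),
    ((gridRates h2 hlog8 hw16).samplePMF (gridRates_J_pos h2 hlog8 hw16) ((N + 1) ^ 2)).map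
      fun x => (Sample.graph (X := X) x).map e.toEmbedding, ?_, ?_⟩
  · intro G hG
    obtain ⟨x, -, rfl⟩ := (PMF.mem_support_map_iff _ _ _).1 hG
    exact isBlock_map_graph e x
  · intro Ω _ μ _ P hsucc
    have hwpos : 0 < w := by linarith
    have hw1 : 1 ≤ w := by linarith
    have hmw : 16 * w ^ 32 ≤ (m : ℝ) := by
      have : 16 * ((N : ℝ) + 1) ^ 2 ≤ m := by exact_mod_cast hgm
      rw [← hw16] at this
      linarith
    have hmw' : (m : ℝ) ≤ 64 * w ^ 32 := by
      have : (m : ℝ) ≤ 64 * ((N : ℝ) + 1) ^ 2 := by exact_mod_cast hmg'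
      rw [← hw16] at this
      linarith
    have hsqrt : 16 * w ≤ √(n : ℝ) := by
      calc 16 * w ≤ 16 * w ^ 32 := by
            gcongr
            exact le_self_pow₀ hw1 (by norm_num)
        _ ≤ m := hmw
        _ ≤ √(n : ℝ) := by
          apply Real.le_sqrt_of_sq_le
          exact_mod_cast Nat.sqrt_le' n
    have hE : 1024 ≤ w * Real.exp (-(Real.log w / 4)) := by
      refine le_trans ?_ hbig
      have : 1 ≤ Real.log w ^ 3 := one_le_pow₀ (by linarith)
      nlinarith
    -- The permitted error is at most `1 / (8 * w)`, far below `w ^ (-1/4) / 64`.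
    have hε : 2 / √(n : ℝ) ≤ Real.exp (-(Real.log w / 4)) / 64 := by
      rw [div_le_div_iff₀ (by linarith) (by norm_num)]
      nlinarith [Real.exp_pos (-(Real.log w / 4))]
    refine le_trans (ENNReal.ofReal_le_ofReal ?_) (le_expectedAverageSize_gridBlocks h2 hlog8 hw16
      h16 hbig hlog3 e (by rw [Fintype.card_fin]; exact hmg') μ P (by positivity) hε hsucc)
    have hn0 : (1 : ℝ) ≤ n := by
      have : 0 < n := by
        rcases Nat.eq_zero_or_pos n with h | h
        · rw [h] at hn; simp at hn
        · exact h
      exact_mod_cast this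
    have hlogn : Real.log n ≤ 68 * Real.log w := by
      rw [show 68 * Real.log w = Real.log (w ^ 68) by rw [Real.log_pow]; norm_num]
      apply Real.log_le_log (by linarith)
      have h3 : (n : ℝ) ≤ (m + 1) ^ 2 := by exact_mod_cast (Nat.lt_succ_sqrt' n).le
      calc (n : ℝ) ≤ (m + 1) ^ 2 := h3
        _ ≤ (64 * w ^ 32 + w ^ 32) ^ 2 := by
          gcongr
          exact one_le_pow₀ hw1
        _ = 4225 * w ^ 64 := by ring
        _ ≤ w ^ 4 * w ^ 64 := by
          gcongr
          calc (4225 : ℝ) ≤ 16 ^ 4 := by norm_num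
            _ ≤ w ^ 4 := by gcongr
        _ = w ^ 68 := by ring
    have hlog0 : 0 ≤ Real.log n := Real.log_nonneg hn0
    calc _ ≤ 1 / (68 ^ 3 * (4096 * (36 + 32 * logConst))) * (68 * Real.log w) ^ 3 := by gcongr
      _ = _ := by
        have : (36 + 32 * logConst) ≠ 0 := by positivity
        field_simp
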